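/- Let $m,n\ge 0$ be integers, not both zero. All vector spaces are over $\mathbb C$; modules over superalgebras are $\mathbb Z_2$-graded, and such a module is simple if it is nonzero and has no graded submodules other than $0$ and itself. Let $A=A_{m,n}=\mathbb C[t_1,\dots,t_m]\otimes\Lambda(\xi_1,\dots,\xi_n)$ with $t_i$ even and $\xi_j$ odd, let $W=W_{m,n}$ be the Lie superalgebra of superderivations of $A$, and let $W\ltimes A$ be the Lie superalgebra with $[a,a']=0$ and $[x,a]=-(-1)^{|x||a|}[a,x]=x(a)$ for $x\in W$, $a,a'\in A$. An $AW$-module is a $W\ltimes A$-module on which $A$ acts associatively and $1\in A$ acts as the identity. Let $\mathcal K_{m,n}$ be the Weyl superalgebra, the associative superalgebra of operators on $A$ generated by the multiplications by elements of $A$ and by $\frac{\partial}{\partial t_1},\dots,\frac{\partial}{\partial t_m},\frac{\partial}{\partial \xi_1},\dots,\frac{\partial}{\partial \xi_n}$. Put $d_i=t_i\frac{\partial}{\partial t_i}$ and $\delta_j=\xi_j\frac{\partial}{\partial\xi_j}$. A $\mathcal K_{m,n}$-module or an $AW$-module (respectively a $\mathfrak{gl}(m,n)$-module, a $\mathfrak{gl}_n$-module)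 is a weight module if it is the direct sum of its weight spaces, i.e. of the simultaneous eigenspaces of $d_1,\dots,d_m,\delta_1,\dots,\delta_n$ (respectively of the diagonal matrix units $E_{i,i}$); it is bounded if it is a weight module and the dimensions of its weight spaces are bounded by a common integer. For a $\mathcal K_{m,n}$-module $P$ and a $\mathfrak{gl}(m,n)$-module $M$, let $F(P,M)$ be the $AW$-module with underlying superspace $P\otimes M$ on which $t^\alpha\xi_I$, $t^\alpha\xi_I\frac{\partial}{\partial t_i}$ and $t^\alpha\xi_I\frac{\partial}{\partial \xi_j}$ ($\alpha\in\mathbb Z_{\ge0}^m$, $I\subset\{1,\dots,n\}$, $1\le i\le m$, $1\le j\le n$) act respectively by $$t^\alpha\xi_I\otimes 1,$$ $$t^\alpha\xi_I\tfrac{\partial}{\partial t_i}\otimes 1+\sum_{k=1}^m\tfrac{\partial}{\partial t_k}(t^{\alpha}\xi_I)\otimes E_{k,i}+(-1)^{|I|-1}\sum_{k=1}^n\tfrac{\partial}{\partial\xi_k}(t^\alpha\xi_I)\otimes E_{m+k,i},$$ $$t^\alpha\xi_I\tfrac{\partial}{\partial \xi_j}\otimes 1+\sum_{k=1}^m\tfrac{\partial}{\partial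 t_k}(t^{\alpha}\xi_I)\otimes E_{k,m+j}+(-1)^{|I|-1}\sum_{k=1}^n\tfrac{\partial}{\partial\xi_k}(t^\alpha\xi_I)\otimes E_{m+k,m+j},$$ where $(x\otimes y)(u\otimes v)=(-1)^{|y||u|}xu\otimes yv$ for homogeneous $y$ and $u$. Let $\mathfrak{gl}(m,n)_1=\mathrm{span}\{E_{i,m+j}\mid 1\le i\le m,\ 1\le j\le n\}$ and let $\mathfrak{gl}(m,n)_0=\mathfrak{gl}_m\oplus\mathfrak{gl}_n$ be the even part of $\mathfrak{gl}(m,n)$. For a simple $\mathfrak{gl}(m,n)_0$-module $V$, regarded as purely even and with $\mathfrak{gl}(m,n)_1$ acting by zero, let $K(V)$ be the $\mathfrak{gl}(m,n)$-module induced from the $\mathfrak{gl}(m,n)_0\oplus\mathfrak{gl}(m,n)_1$-module $V$, and let $L(V)$ be its unique simple quotient. Let $\Pi$ denote the parity change. Let $P$ be a simple weight $\mathcal K_{m,n}$-module and let $M$ be a simple weight $\mathfrak{gl}(m,n)$-module. Then $F(P,M)$ is a bounded $AW$-module if and only if there are a finite-dimensional simple $\mathfrak{gl}_m$-module $V_1$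 and a simple bounded $\mathfrak{gl}_n$-module $V_2$ such that $M$ is isomorphic to $L(V_1\otimes V_2)$ or to $\Pi(L(V_1\otimes V_2))$. -/

import Mathlib

open scoped TensorProduct

universe u v

attribute [local instance 100] LieRing.ofAssociativeRing

noncomputable section

namespace SuperLie

/-! ### Superspaces -/

/-- The sign `(-1)^p` of a parity `p`. -/
def sg (p : ZMod 2) : ℂ := if p = 0 then 1 else -1

theorem par_cases (p : ZMod 2) : p = 0 ∨ p = 1 := by decide +revert

theorem sg_zero : sg 0 = 1 := by simp [sg]

theorem sg_one : sg 1 = -1 := by simp [sg]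

theorem sg_add (p q : ZMod 2) : sg (p + q) = sg p * sg q := by
  have h2 : (1 : ZMod 2) + 1 = 0 := by decide
  obtain rfl | rfl := par_cases p <;> obtain rfl | rfl := par_cases q <;> simp [sg, h2]

theorem sg_mul_self (p : ZMod 2) : sg p * sg p = 1 := by
  obtain rfl | rfl := par_cases p <;> simp [sg]

/-- A `ℤ/2`-grading on a complex vector space, given by its parity involution: the component of
parity `p` is the eigenspace of `parity` with eigenvalue `(-1)^p`. -/
class SuperSpace (V : Type*) [AddCommGroup V] [Module ℂ V] where
  parity : V →ₗ[ℂ] V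
  parity_parity : ∀ v, parity (parity v) = v

open SuperSpace

section Super

variable {V : Type*} [AddCommGroup V] [Module ℂ V] [SuperSpace V]

/-- `v` is homogeneous of parity `p` (the zero vector is so for both `p`). -/
def IsHom (p : ZMod 2) (v : V) : Prop := parity v = sg p • v

variable (V) in
/-- The homogeneous component of parity `p`. -/
def component (p : ZMod 2) : Submodule ℂ V where
  carrier := {v | IsHom p v}
  zero_mem' := by simp [IsHom]
  add_mem' := by
    intro a b ha hb
    simp only [Set.mem_ofPred_eq, IsHom] at *
    rw [map_add, ha, hb, smul_add]
  smul_mem' := by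
    intro c a ha
    simp only [Set.mem_ofPred_eq, IsHom] at *
    rw [map_smul, ha, smul_comm]

/-- The projection to the component of parity `p`. -/
def part (p : ZMod 2) : V →ₗ[ℂ] V := (1 / 2 : ℂ) • (LinearMap.id + sg p • parity)

theorem part_apply (p : ZMod 2) (v : V) : part p v = (1 / 2 : ℂ) • (v + sg p • parity v) := rfl

theorem part_isHom (p : ZMod 2) (v : V) : IsHom p (part p v) := by
  simp only [IsHom, part_apply, map_smul, map_add, parity_parity]
  rw [smul_comm (sg p), smul_add (sg p), smul_smul (sg p) (sg p), sg_mul_self, one_smul, add_comm]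

theorem part_add_part (v : V) : part 0 v + part 1 v = v := by
  simp only [part_apply, sg_zero, sg_one]
  module

theorem part_self {p : ZMod 2} {v : V} (h : IsHom p v) : part p v = v := by
  rw [part_apply, h, smul_smul, sg_mul_self]
  module

theorem part_other {p : ZMod 2} {v : V} (h : IsHom p v) : part (p + 1) v = 0 := by
  rw [part_apply, h, smul_smul, sg_add, mul_right_comm, sg_mul_self, sg_one]
  module

/-- A superspace is the direct sum of its even and its odd component. -/
theorem isCompl_component : IsCompl (component V 0) (component V 1) := by
  constructor
  · rw [Submodule.disjoint_def]
    intro v h0 h1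
    have h0' : parity v = sg 0 • v := h0
    have h1' : parity v = sg 1 • v := h1
    rw [sg_zero] at h0'
    rw [sg_one, h0'] at h1'
    have : (2 : ℂ) • v = 0 := by
      have h : (1 : ℂ) • v - (-1 : ℂ) • v = 0 := sub_eq_zero.2 h1'
      rw [← h]
      module
    simpa using this
  · rw [codisjoint_iff, eq_top_iff]
    intro v _
    rw [← part_add_part v]
    exact Submodule.add_mem_sup (part_isHom 0 v) (part_isHom 1 v)

/-- The `p`-th power of the parity involution. -/
def twist (p : ZMod 2) : V →ₗ[ℂ] V := if p = 0 then LinearMap.id else parity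

theorem twist_zero (v : V) : twist 0 v = v := by simp [twist]

theorem twist_one (v : V) : twist 1 v = parity v := by simp [twist]

theorem twist_twist (p q : ZMod 2) (v : V) : twist p (twist q v) = twist (p + q) v := by
  have h2 : (1 : ZMod 2) + 1 = 0 := by decide
  obtain rfl | rfl := par_cases p <;> obtain rfl | rfl := par_cases q <;>
    simp [twist, parity_parity, h2]

theorem twist_hom {p q : ZMod 2} {v : V} (h : IsHom q v) : twist p v = sg (p * q) • v := by
  obtain rfl | rfl := par_cases p
  · simp [twist, sg]
  · simp only [twist, one_ne_zero, if_false, one_mul]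
    exact h

theorem IsHom.twisted {p q : ZMod 2} {v : V} (h : IsHom q v) : IsHom q (twist p v) := by
  rw [twist_hom h]
  exact (component V q).smul_mem _ h

theorem IsHom.smul {q : ZMod 2} {v : V} (h : IsHom q v) (c : ℂ) : IsHom q (c • v) :=
  (component V q).smul_mem _ h

theorem IsHom.add {q : ZMod 2} {v w : V} (h : IsHom q v) (h' : IsHom q w) : IsHom q (v + w) :=
  (component V q).add_mem h h'

theorem IsHom.sub {q : ZMod 2} {v w : V} (h : IsHom q v) (h' : IsHom q w) : IsHom q (v - w) :=
  (component V q).sub_mem h h'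

theorem IsHom.sum {q : ZMod 2} {ι : Type*} {s : Finset ι} {f : ι → V}
    (h : ∀ i, IsHom q (f i)) : IsHom q (∑ i ∈ s, f i) :=
  (component V q).sum_mem fun i _ => h i

theorem IsHom.zero (q : ZMod 2) : IsHom q (0 : V) := (component V q).zero_mem

end Super

/-- Linear maps between homogeneous components: the usual grading of `End V`. -/
instance {V : Type*} [AddCommGroup V] [Module ℂ V] [SuperSpace V] :
    SuperSpace (Module.End ℂ V) where
  parity :=
    { toFun := fun f => parity ∘ₗ f ∘ₗ parity
      map_add' := by intros; ext; simp
      map_smul' := by intros; ext; simp }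
  parity_parity := by intro f; ext; simp [parity_parity]

theorem parity_end_apply {V : Type*} [AddCommGroup V] [Module ℂ V] [SuperSpace V]
    (f : Module.End ℂ V) (v : V) : parity f v = parity (f (parity v)) := rfl

instance {V W : Type*} [AddCommGroup V] [Module ℂ V] [SuperSpace V]
    [AddCommGroup W] [Module ℂ W] [SuperSpace W] : SuperSpace (V ⊗[ℂ] W) where
  parity := TensorProduct.map parity parity
  parity_parity := by
    intro v
    induction v with
    | zero => simp
    | tmul a b => simp [parity_parity]
    | add a b ha hb => rw [map_add, map_add, ha, hb]

theorem parity_tmul {V W : Type*} [AddCommGroup V] [Module ℂ V] [SuperSpace V]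
    [AddCommGroup W] [Module ℂ W] [SuperSpace W] (v : V) (w : W) :
    parity (v ⊗ₜ[ℂ] w) = parity v ⊗ₜ parity w := rfl

instance {V W : Type*} [AddCommGroup V] [Module ℂ V] [SuperSpace V]
    [AddCommGroup W] [Module ℂ W] [SuperSpace W] : SuperSpace (V × W) where
  parity := LinearMap.prodMap parity parity
  parity_parity := by intro v; simp [parity_parity]

theorem isHom_prod {V W : Type*} [AddCommGroup V] [Module ℂ V] [SuperSpace V]
    [AddCommGroup W] [Module ℂ W] [SuperSpace W] {p : ZMod 2} {x : V × W} :
    IsHom p x ↔ IsHom p x.1 ∧ IsHom p x.2 := Prod.ext_iff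

/-! ### Associative superalgebras and Lie superalgebras -/

/-- A unital associative superalgebra. -/
class SuperAlgebra (B : Type*) [Ring B] [Algebra ℂ B] [SuperSpace B] : Prop where
  parity_one : parity (1 : B) = 1
  parity_mul : ∀ a b : B, parity (a * b) = parity a * parity b

open SuperAlgebra

/-- A Lie superalgebra over `ℂ`. -/
class LieSuperalgebra (g : Type*) [AddCommGroup g] [Module ℂ g] [SuperSpace g] where
  bracket : g →ₗ[ℂ] g →ₗ[ℂ] g
  bracket_hom : ∀ {p q : ZMod 2} {x y : g}, IsHom p x → IsHom q y → IsHom (p + q) (bracket x y)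
  bracket_skew : ∀ {p q : ZMod 2} {x y : g}, IsHom p x → IsHom q y →
    bracket x y = -(sg (p * q) • bracket y x)
  jacobi : ∀ {p q r : ZMod 2} {x y z : g}, IsHom p x → IsHom q y → IsHom r z →
    bracket x (bracket y z) = bracket (bracket x y) z + sg (p * q) • bracket y (bracket x z)

open LieSuperalgebra

section Assoc

variable {B : Type*} [Ring B] [Algebra ℂ B] [SuperSpace B] [SuperAlgebra B]

theorem IsHom.mul {p q : ZMod 2} {x y : B} (hx : IsHom p x) (hy : IsHom q y) :
    IsHom (p + q) (x * y) := by
  unfold IsHom at *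
  rw [parity_mul, hx, hy, smul_mul_smul_comm, sg_add]

theorem isHom_one : IsHom 0 (1 : B) := by
  unfold IsHom
  rw [parity_one, sg_zero, one_smul]

theorem twist_mul (p : ZMod 2) (x y : B) : twist p (x * y) = twist p x * twist p y := by
  obtain rfl | rfl := par_cases p
  · simp [twist]
  · simp [twist, parity_mul]

theorem twist_one_eq (p : ZMod 2) : twist p (1 : B) = 1 := by
  obtain rfl | rfl := par_cases p
  · simp [twist]
  · simp [twist, parity_one]

variable (B) in
/-- The supercommutator, `[x, y] = x y - (-1)^{|x| |y|} y x` on homogeneous elements. -/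
def supercomm : B →ₗ[ℂ] B →ₗ[ℂ] B :=
  LinearMap.mul ℂ B - ((LinearMap.mul ℂ B).flip.compl₂ (part 0) +
    ((LinearMap.mul ℂ B).flip.compl₁₂ parity (part 1)))

theorem supercomm_eq {p q : ZMod 2} {x y : B} (hx : IsHom p x) (hy : IsHom q y) :
    supercomm B x y = x * y - sg (p * q) • (y * x) := by
  have key : supercomm B x y = x * y - (part 0 y * x + part 1 y * parity x) := by
    simp [supercomm]
  rw [key]
  have hx' : parity x = sg p • x := hx
  obtain rfl | rfl := par_cases q
  · have h := part_other hy
    rw [zero_add] at h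
    rw [part_self hy, h]
    simp [sg_zero]
  · have h : part ((1 : ZMod 2) + 1) y = 0 := part_other hy
    rw [show (1 : ZMod 2) + 1 = 0 by decide] at h
    rw [part_self hy, h, zero_mul, zero_add, hx', mul_one, mul_smul_comm]

variable (B) in
/-- An associative superalgebra is a Lie superalgebra under the supercommutator. -/
@[reducible] def lieOfAssoc : LieSuperalgebra B where
  bracket := supercomm B
  bracket_hom := by
    intro p q x y hx hy
    rw [supercomm_eq hx hy]
    exact (hx.mul hy).sub ((add_comm q p ▸ hy.mul hx).smul _)
  bracket_skew := by
    intro p q x y hx hy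
    rw [supercomm_eq hx hy, supercomm_eq hy hx, smul_sub, smul_smul, mul_comm q p, sg_mul_self,
      one_smul, neg_sub]
  jacobi := by
    intro p q r x y z hx hy hz
    have hB : ∀ {p q : ZMod 2} {x y : B}, IsHom p x → IsHom q y →
        IsHom (p + q) (supercomm B x y) := by
      intro p q x y hx hy
      rw [supercomm_eq hx hy]
      exact (hx.mul hy).sub ((add_comm q p ▸ hy.mul hx).smul _)
    rw [supercomm_eq hx (hB hy hz), supercomm_eq (hB hx hy) hz, supercomm_eq hy (hB hx hz),
      supercomm_eq hx hy, supercomm_eq hy hz, supercomm_eq hx hz]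
    have e1 : sg (p * (q + r)) = sg (p * q) * sg (p * r) := by rw [mul_add, sg_add]
    have e2 : sg ((p + q) * r) = sg (p * r) * sg (q * r) := by rw [add_mul, sg_add]
    have e3 : sg (q * (p + r)) = sg (p * q) * sg (q * r) := by
      rw [mul_add, sg_add, mul_comm q p]
    rw [e1, e2, e3]
    have h := sg_mul_self (p * q)
    simp only [mul_sub, sub_mul, smul_sub, smul_mul_assoc, mul_smul_comm, smul_smul, mul_assoc]
    have h' : ∀ c : ℂ, sg (p * q) * (sg (p * q) * c) = c := fun c => by
      rw [← mul_assoc, h, one_mul]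
    simp only [h', ← mul_assoc]
    module

end Assoc

instance {V : Type*} [AddCommGroup V] [Module ℂ V] [SuperSpace V] :
    SuperAlgebra (Module.End ℂ V) where
  parity_one := by ext v; simp [parity_end_apply, parity_parity]
  parity_mul := by intro a b; ext v; simp [parity_end_apply, parity_parity]

theorem isHom_end_iff {V : Type*} [AddCommGroup V] [Module ℂ V] [SuperSpace V] {p : ZMod 2}
    {f : Module.End ℂ V} : IsHom p f ↔ ∀ v, parity (f v) = sg p • f (parity v) := by
  constructor
  · intro h v
    have := LinearMap.congr_fun h (parity v)
    rw [parity_end_apply, parity_parity] at this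
    exact this
  · intro h
    ext v
    rw [parity_end_apply, h, parity_parity]
    rfl

theorem IsHom.apply {V : Type*} [AddCommGroup V] [Module ℂ V] [SuperSpace V] {p q : ZMod 2}
    {f : Module.End ℂ V} {v : V} (hf : IsHom p f) (hv : IsHom q v) : IsHom (p + q) (f v) := by
  unfold IsHom
  rw [isHom_end_iff.1 hf, hv, map_smul, smul_smul, sg_add]

theorem IsHom.apply_twist {V : Type*} [AddCommGroup V] [Module ℂ V] [SuperSpace V] {p : ZMod 2}
    {f : Module.End ℂ V} (hf : IsHom p f) (r : ZMod 2) (v : V) :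
    twist r (f v) = sg (r * p) • f (twist r v) := by
  obtain rfl | rfl := par_cases r
  · simp [twist, sg]
  · simpa [twist] using isHom_end_iff.1 hf v

/-- Graded modules over a Lie superalgebra. -/
structure LieSuperModule (g : Type*) [AddCommGroup g] [Module ℂ g] [SuperSpace g]
    [LieSuperalgebra g] (V : Type*) [AddCommGroup V] [Module ℂ V] [SuperSpace V] where
  act : g →ₗ[ℂ] Module.End ℂ V
  act_hom : ∀ {p : ZMod 2} {x : g}, IsHom p x → IsHom p (act x)
  act_bracket : ∀ {p q : ZMod 2} {x y : g}, IsHom p x → IsHom q y →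
    act (bracket x y) = act x * act y - sg (p * q) • (act y * act x)

/-- `N` is a graded subspace that is stable under the operators `T i`. -/
structure IsGradedSub {ι V : Type*} [AddCommGroup V] [Module ℂ V] [SuperSpace V]
    (T : ι → Module.End ℂ V) (N : Submodule ℂ V) : Prop where
  parity_mem : ∀ v ∈ N, parity v ∈ N
  act_mem : ∀ i, ∀ v ∈ N, T i v ∈ N

/-- The operators `T i` make the superspace `V` a simple graded module. -/
def IsGradedSimple {ι V : Type*} [AddCommGroup V] [Module ℂ V] [SuperSpace V]
    (T : ι → Module.End ℂ V) : Prop :=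
  Nontrivial V ∧ ∀ N : Submodule ℂ V, IsGradedSub T N → N = ⊥ ∨ N = ⊤

/-! ### Weights -/

section Weights

variable {ι V : Type*} [AddCommGroup V] [Module ℂ V]

/-- The space of vectors on which each `h i` acts by the scalar `wt i`. -/
def weightSpace (h : ι → Module.End ℂ V) (wt : ι → ℂ) : Submodule ℂ V :=
  ⨅ i, (h i).eigenspace (wt i)

/-- `V` is the sum of its weight spaces (which are always linearly independent). -/
def IsWeight (h : ι → Module.End ℂ V) : Prop := ⨆ wt, weightSpace h wt = ⊤

/-- `V` is a weight module whose weight spaces have uniformly bounded dimension. -/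
def IsBounded (h : ι → Module.End ℂ V) : Prop :=
  IsWeight h ∧ ∃ N : ℕ, ∀ wt, Module.rank ℂ (weightSpace h wt) ≤ N

end Weights

/-! ### The general linear Lie superalgebra -/

/-- Parity of an index: the first `m` coordinates are even, the last `n` are odd. -/
def ip {m n : ℕ} (a : Fin m ⊕ Fin n) : ZMod 2 := Sum.elim (fun _ => 0) (fun _ => 1) a

/-- The underlying space of `𝔤𝔩(m,n)`: all `(m+n) × (m+n)` complex matrices. -/
abbrev GLSuper (m n : ℕ) : Type := Matrix (Fin m ⊕ Fin n) (Fin m ⊕ Fin n) ℂ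

/-- The matrix unit `E_{a,b}` has parity `|a| + |b|`. -/
instance (m n : ℕ) : SuperSpace (GLSuper m n) where
  parity :=
    { toFun := fun X => Matrix.of fun a b => sg (ip a + ip b) * X a b
      map_add' := by intro X Y; ext a b; simp [mul_add]
      map_smul' := by intro c X; ext a b; simp [mul_left_comm] }
  parity_parity := by
    intro X
    ext a b
    simp [← mul_assoc, sg_mul_self]

theorem parity_gl_apply {m n : ℕ} (X : GLSuper m n) (a b : Fin m ⊕ Fin n) :
    (parity X : GLSuper m n) a b = sg (ip a + ip b) * X a b := rfl

instance (m n : ℕ) : SuperAlgebra (GLSuper m n) where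
  parity_one := by
    ext a b
    rw [parity_gl_apply]
    by_cases h : a = b
    · subst h
      have : ip a + ip a = 0 := CharTwo.add_self_eq_zero _
      rw [this, sg_zero, one_mul]
    · simp [h]
  parity_mul := by
    intro X Y
    ext a b
    simp only [parity_gl_apply, Matrix.mul_apply, Finset.mul_sum, sg_add]
    refine Finset.sum_congr rfl fun c _ => ?_
    have := sg_mul_self (ip c)
    linear_combination (- sg (ip a) * sg (ip b) * X a c * Y c b) * this

instance (m n : ℕ) : LieSuperalgebra (GLSuper m n) := lieOfAssoc (GLSuper m n)

/-- The matrix unit `E_{a,b}`. -/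
def unitMat {m n : ℕ} (a b : Fin m ⊕ Fin n) : GLSuper m n := Matrix.single a b 1

theorem unitMat_hom {m n : ℕ} (a b : Fin m ⊕ Fin n) :
    IsHom (ip a + ip b) (unitMat a b : GLSuper m n) := by
  unfold IsHom unitMat
  ext c d
  rw [parity_gl_apply, Matrix.smul_apply, smul_eq_mul, Matrix.single_apply]
  split_ifs with h
  · rw [h.1, h.2]
  · simp

/-! ### The superalgebra `A = ℂ[t₁, …, tₘ] ⊗ Λ(ξ₁, …, ξₙ)` and its derivations -/

/-- Polynomials are even. -/
instance (m : ℕ) : SuperSpace (MvPolynomial (Fin m) ℂ) where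
  parity := LinearMap.id
  parity_parity := fun _ => rfl

/-- The exterior algebra is graded by the parity of the exterior degree. -/
instance (n : ℕ) : SuperSpace (ExteriorAlgebra ℂ (Fin n → ℂ)) where
  parity := CliffordAlgebra.involute.toLinearMap
  parity_parity := CliffordAlgebra.involute_involute

/-- The tensor product of the polynomial algebra in `m` even variables and the exterior algebra in
`n` odd variables. -/
def A (m n : ℕ) : Type := MvPolynomial (Fin m) ℂ ⊗[ℂ] ExteriorAlgebra ℂ (Fin n → ℂ)

instance (m n : ℕ) : Ring (A m n) :=
  inferInstanceAs (Ring (MvPolynomial (Fin m) ℂ ⊗[ℂ] ExteriorAlgebra ℂ (Fin n → ℂ)))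

instance (m n : ℕ) : Algebra ℂ (A m n) :=
  inferInstanceAs (Algebra ℂ (MvPolynomial (Fin m) ℂ ⊗[ℂ] ExteriorAlgebra ℂ (Fin n → ℂ)))

section A

variable {m n : ℕ}

/-- The pure tensor `f ⊗ w` as an element of `A`. -/
def tm (f : MvPolynomial (Fin m) ℂ) (w : ExteriorAlgebra ℂ (Fin n → ℂ)) : A m n := f ⊗ₜ[ℂ] w

theorem tm_mul (f g : MvPolynomial (Fin m) ℂ) (w z : ExteriorAlgebra ℂ (Fin n → ℂ)) :
    tm f w * tm g z = tm (f * g) (w * z) := Algebra.TensorProduct.tmul_mul_tmul f g w z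

theorem tm_one : (tm 1 1 : A m n) = 1 := rfl

theorem tm_zero (f : MvPolynomial (Fin m) ℂ) : (tm f 0 : A m n) = 0 := TensorProduct.tmul_zero _ _

theorem zero_tm (w : ExteriorAlgebra ℂ (Fin n → ℂ)) : (tm 0 w : A m n) = 0 :=
  TensorProduct.zero_tmul _ _

theorem tm_neg (f : MvPolynomial (Fin m) ℂ) (w : ExteriorAlgebra ℂ (Fin n → ℂ)) :
    tm f (-w) = -tm f w := TensorProduct.tmul_neg _ _

theorem tm_add (f : MvPolynomial (Fin m) ℂ) (w z : ExteriorAlgebra ℂ (Fin n → ℂ)) :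
    tm f (w + z) = tm f w + tm f z := TensorProduct.tmul_add _ _ _

theorem add_tm (f g : MvPolynomial (Fin m) ℂ) (w : ExteriorAlgebra ℂ (Fin n → ℂ)) :
    tm (f + g) w = tm f w + tm g w := TensorProduct.add_tmul _ _ _

theorem tm_smul (c : ℂ) (f : MvPolynomial (Fin m) ℂ) (w : ExteriorAlgebra ℂ (Fin n → ℂ)) :
    tm f (c • w) = c • tm f w := TensorProduct.tmul_smul _ _ _

theorem tm_sum (f : MvPolynomial (Fin m) ℂ) (w : Fin n → ExteriorAlgebra ℂ (Fin n → ℂ)) :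
    tm f (∑ j, w j) = ∑ j, tm f (w j) := TensorProduct.tmul_sum _ _ _

@[elab_as_elim]
theorem A_induction {motive : A m n → Prop} (a : A m n) (zero : motive 0)
    (tmul : ∀ f w, motive (tm f w)) (add : ∀ a b, motive a → motive b → motive (a + b)) :
    motive a := TensorProduct.induction_on a zero tmul add

/-- The tensor product grading. -/
instance : SuperSpace (A m n) where
  parity := (parity : Module.End ℂ
    (MvPolynomial (Fin m) ℂ ⊗[ℂ] ExteriorAlgebra ℂ (Fin n → ℂ)))
  parity_parity := fun a => parity_parity
    (V := MvPolynomial (Fin m) ℂ ⊗[ℂ] ExteriorAlgebra ℂ (Fin n → ℂ)) a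

theorem parity_tm (f : MvPolynomial (Fin m) ℂ) (w : ExteriorAlgebra ℂ (Fin n → ℂ)) :
    parity (tm f w) = tm f (CliffordAlgebra.involute w) := rfl

instance : SuperAlgebra (A m n) where
  parity_one := by
    rw [← tm_one, parity_tm, map_one]
  parity_mul := by
    intro a b
    induction a using A_induction with
    | zero => simp
    | add a a' ha ha' => rw [add_mul, map_add, ha, ha', map_add, add_mul]
    | tmul f w =>
      induction b using A_induction with
      | zero => simp
      | add b b' hb hb' => rw [mul_add, map_add, hb, hb', map_add, mul_add]
      | tmul g z => simp only [tm_mul, parity_tm, map_mul]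

/-- The generators: the even variables `t_i` and the odd variables `ξ_j`. -/
def gen : Fin m ⊕ Fin n → A m n :=
  Sum.elim (fun i => tm (MvPolynomial.X i) 1) (fun j => tm 1 (ExteriorAlgebra.ι ℂ (Pi.single j 1)))

/-- The partial derivatives `∂/∂t_i` and the (left) odd partial derivatives `∂/∂ξ_j`. -/
def pd : Fin m ⊕ Fin n → Module.End ℂ (A m n) :=
  Sum.elim
    (fun i => (LinearMap.rTensor _ (MvPolynomial.pderiv i).toLinearMap : Module.End ℂ
      (MvPolynomial (Fin m) ℂ ⊗[ℂ] ExteriorAlgebra ℂ (Fin n → ℂ))))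
    (fun j => (LinearMap.lTensor _ (CliffordAlgebra.contractLeft
      (Q := (0 : QuadraticForm ℂ (Fin n → ℂ))) (LinearMap.proj j)) : Module.End ℂ
      (MvPolynomial (Fin m) ℂ ⊗[ℂ] ExteriorAlgebra ℂ (Fin n → ℂ))))

theorem gen_hom (a : Fin m ⊕ Fin n) : IsHom (ip a) (gen a : A m n) := by
  unfold IsHom
  cases a with
  | inl i => simp [gen, ip, sg_zero, parity_tm]
  | inr j =>
    simp only [gen, ip, Sum.elim_inr, sg_one, parity_tm]
    rw [CliffordAlgebra.involute_ι, tm_neg]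
    simp

theorem ext_supercomm (w z : ExteriorAlgebra ℂ (Fin n → ℂ)) :
    w * z = part 0 z * w + part 1 z * parity w := by
  have hpar : ∀ x : ExteriorAlgebra ℂ (Fin n → ℂ), parity x = CliffordAlgebra.involute x :=
    fun _ => rfl
  have hvec : ∀ (v : Fin n → ℂ) (w : ExteriorAlgebra ℂ (Fin n → ℂ)),
      w * ExteriorAlgebra.ι ℂ v = ExteriorAlgebra.ι ℂ v * CliffordAlgebra.involute w := by
    intro v w
    induction w using ExteriorAlgebra.induction with
    | algebraMap r => rw [AlgHom.commutes, Algebra.commutes]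
    | ι u =>
      rw [CliffordAlgebra.involute_ι, mul_neg, eq_neg_iff_add_eq_zero, add_comm]
      exact ExteriorAlgebra.ι_add_mul_swap v u
    | mul a b ha hb => rw [mul_assoc, hb, ← mul_assoc, ha, map_mul, mul_assoc]
    | add a b ha hb => rw [add_mul, ha, hb, map_add, mul_add]
  induction z using ExteriorAlgebra.induction generalizing w with
  | algebraMap r =>
    simp only [part_apply, hpar, AlgHom.commutes, sg_zero, sg_one]
    rw [← Algebra.commutes]
    simp only [neg_smul, one_smul, add_neg_cancel, smul_zero, zero_mul, add_zero]
    rw [← two_smul ℂ, smul_smul]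
    norm_num
  | ι v =>
    simp only [part_apply, hpar, sg_zero, sg_one]
    have : (CliffordAlgebra.involute (ExteriorAlgebra.ι ℂ v) : ExteriorAlgebra ℂ (Fin n → ℂ)) =
      - ExteriorAlgebra.ι ℂ v := CliffordAlgebra.involute_ι v
    rw [this, hvec]
    simp only [neg_smul, one_smul, add_neg_cancel, smul_zero, zero_mul, zero_add, neg_neg]
    rw [← two_smul ℂ, smul_smul]
    norm_num
  | add a b ha hb =>
    rw [mul_add, ha, hb, map_add, map_add]
    noncomm_ring
  | mul a b ha hb =>
    rw [← mul_assoc, ha, add_mul, mul_assoc, mul_assoc, hb, hb (parity w)]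
    simp only [part_apply, hpar, sg_zero, sg_one, map_mul, CliffordAlgebra.involute_involute]
    simp only [one_smul, neg_smul, smul_mul_assoc, mul_smul_comm, mul_add, add_mul, smul_add,
      mul_neg, neg_mul, smul_neg, mul_assoc]
    module

theorem A_supercomm {p : ZMod 2} {a : A m n} (h : IsHom p a) (b : A m n) :
    a * b = twist p b * a := by
  have key : ∀ a b : A m n, b * a = part 0 a * b + part 1 a * parity b := by
    intro a b
    induction a using A_induction with
    | zero => simp
    | add a a' ha ha' => rw [mul_add, ha, ha', map_add, map_add]; noncomm_ring
    | tmul f w =>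
      induction b using A_induction with
      | zero => simp
      | add b b' hb hb' => rw [add_mul, hb, hb', map_add]; noncomm_ring
      | tmul g z =>
        have hp : ∀ q, part q (tm f w : A m n) = tm f (part q w) := by
          intro q
          simp only [part_apply, parity_tm, tm_smul, tm_add]
          rfl
        rw [hp, hp, parity_tm]
        simp only [tm_mul]
        rw [← mul_comm g f, ← tm_add, ext_supercomm z w]
        rfl
  have k := key a (twist p b)
  rw [k]
  obtain rfl | rfl := par_cases p
  · have h1 := part_other h
    rw [zero_add] at h1
    rw [part_self h, h1, twist_zero, zero_mul, add_zero]
  · have h1 : part ((1 : ZMod 2) + 1) a = 0 := part_other h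
    rw [show (1 : ZMod 2) + 1 = 0 by decide] at h1
    rw [part_self h, h1, twist_one, parity_parity, zero_mul, zero_add]

theorem A_swap {p q : ZMod 2} {a b : A m n} (ha : IsHom p a) (hb : IsHom q b) :
    a * b = sg (p * q) • (b * a) := by
  rw [A_supercomm ha, twist_hom hb, smul_mul_assoc]

theorem adjoin_gen : Algebra.adjoin ℂ (Set.range (gen : Fin m ⊕ Fin n → A m n)) = ⊤ := by
  set S := Algebra.adjoin ℂ (Set.range (gen : Fin m ⊕ Fin n → A m n)) with hS
  have h1 : ∀ f : MvPolynomial (Fin m) ℂ,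
      (tm f 1 : A m n) ∈ S := by
    intro f
    induction f using MvPolynomial.induction_on with
    | C r =>
      have : (tm (MvPolynomial.C r) 1 : A m n) = algebraMap ℂ _ r := rfl
      rw [this]
      exact S.algebraMap_mem r
    | add p q hp hq => rw [add_tm]; exact S.add_mem hp hq
    | mul_X p i hp =>
      have : (tm (p * MvPolynomial.X i) 1 : A m n) = tm p 1 * gen (Sum.inl i) := by
        simp [gen, tm_mul]
      rw [this]
      exact S.mul_mem hp (Algebra.subset_adjoin ⟨_, rfl⟩)
  have h2 : ∀ w : ExteriorAlgebra ℂ (Fin n → ℂ),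
      (tm 1 w : A m n) ∈ S := by
    intro w
    induction w using ExteriorAlgebra.induction with
    | algebraMap r =>
      rw [Algebra.algebraMap_eq_smul_one, tm_smul]
      exact S.smul_mem S.one_mem r
    | ι v =>
      have hv : v = ∑ j, v j • (Pi.single j 1 : Fin n → ℂ) := by
        ext k
        simp [Finset.sum_apply, Pi.single_apply]
      rw [hv, map_sum, tm_sum]
      refine S.sum_mem fun j _ => ?_
      rw [map_smul, tm_smul]
      exact S.smul_mem (Algebra.subset_adjoin ⟨Sum.inr j, rfl⟩) _
    | mul a b ha hb =>
      have : (tm 1 (a * b) : A m n) = tm 1 a * tm 1 b := by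
        rw [tm_mul, one_mul]
      rw [this]
      exact S.mul_mem ha hb
    | add a b ha hb => rw [tm_add]; exact S.add_mem ha hb
  rw [eq_top_iff]
  intro x _
  induction x using A_induction with
  | zero => exact S.zero_mem
  | add a b ha hb => exact S.add_mem (ha trivial) (hb trivial)
  | tmul f w =>
    have : tm f w = tm f 1 * tm 1 w := by rw [tm_mul, mul_one, one_mul]
    rw [this]
    exact S.mul_mem (h1 f) (h2 w)

end A

/-- The super Leibniz rule for an operator of parity `p`:
`X (a b) = X a * b + (-1)^{p |a|} a * X b`. -/
def SuperLeibniz {B : Type*} [Ring B] [Algebra ℂ B] [SuperSpace B] (p : ZMod 2)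
    (X : Module.End ℂ B) : Prop :=
  ∀ a b, X (a * b) = X a * b + twist p a * X b

/-- The space of superderivations: sums of an even and an odd operator satisfying the respective
Leibniz rule. -/
def superDer (B : Type*) [Ring B] [Algebra ℂ B] [SuperSpace B] :
    Submodule ℂ (Module.End ℂ B) where
  carrier := {X | SuperLeibniz 0 (part 0 X) ∧ SuperLeibniz 1 (part 1 X)}
  zero_mem' := by constructor <;> intro a b <;> simp
  add_mem' := by
    rintro X Y ⟨h1, h2⟩ ⟨h3, h4⟩
    constructor <;> intro a b
    · rw [map_add, LinearMap.add_apply, h1, h3, LinearMap.add_apply, LinearMap.add_apply]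
      noncomm_ring
    · rw [map_add, LinearMap.add_apply, h2, h4, LinearMap.add_apply, LinearMap.add_apply]
      noncomm_ring
  smul_mem' := by
    rintro c X ⟨h1, h2⟩
    constructor <;> intro a b
    · rw [map_smul, LinearMap.smul_apply, h1]
      simp
    · rw [map_smul, LinearMap.smul_apply, h2]
      simp

section Der

variable {B : Type*} [Ring B] [Algebra ℂ B] [SuperSpace B]

theorem mem_superDer {p : ZMod 2} {X : Module.End ℂ B} (h : IsHom p X) :
    X ∈ superDer B ↔ SuperLeibniz p X := by
  have h0 : SuperLeibniz (p + 1) (0 : Module.End ℂ B) := by intro a b; simp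
  have h1 := part_other h
  have h2 := part_self h
  change SuperLeibniz 0 (part 0 X) ∧ SuperLeibniz 1 (part 1 X) ↔ _
  obtain rfl | rfl := par_cases p
  · rw [zero_add] at h0 h1
    rw [h2, h1]
    exact and_iff_left h0
  · rw [show (1 : ZMod 2) + 1 = 0 by decide] at h0 h1
    rw [h2, h1]
    exact and_iff_right h0

theorem part_mem_superDer {X : Module.End ℂ B} (h : X ∈ superDer B) (p : ZMod 2) :
    part p X ∈ superDer B := by
  rw [mem_superDer (part_isHom p X)]
  obtain rfl | rfl := par_cases p
  · exact h.1
  · exact h.2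

theorem parity_eq_part {V : Type*} [AddCommGroup V] [Module ℂ V] [SuperSpace V] (v : V) :
    parity v = part 0 v - part 1 v := by
  simp only [part_apply, sg_zero, sg_one]
  module

variable (B) in
/-- The type of superderivations. -/
def SuperDer : Type _ := superDer B

instance : AddCommGroup (SuperDer B) := inferInstanceAs (AddCommGroup (superDer B))

instance : Module ℂ (SuperDer B) := inferInstanceAs (Module ℂ (superDer B))

/-- The operator given by a superderivation. -/
def SuperDer.toEnd : SuperDer B →ₗ[ℂ] Module.End ℂ B := (superDer B).subtype

/-- The superderivation given by an operator. -/
def SuperDer.mk (X : Module.End ℂ B) (h : X ∈ superDer B) : SuperDer B := Subtype.mk X h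

theorem SuperDer.toEnd_mk (X : Module.End ℂ B) (h : X ∈ superDer B) :
    (SuperDer.mk X h).toEnd = X := rfl

theorem SuperDer.mem (X : SuperDer B) : X.toEnd ∈ superDer B := Subtype.property X

theorem SuperDer.ext {X Y : SuperDer B} (h : X.toEnd = Y.toEnd) : X = Y := Subtype.ext h

instance : SuperSpace (SuperDer B) where
  parity := parity.restrict (p := superDer B) (q := superDer B) fun X hX => by
    rw [parity_eq_part]
    exact (superDer B).sub_mem (part_mem_superDer hX 0) (part_mem_superDer hX 1)
  parity_parity := fun X => SuperDer.ext (parity_parity X.toEnd)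

theorem isHom_superDer {p : ZMod 2} {X : SuperDer B} : IsHom p X ↔ IsHom p X.toEnd :=
  Subtype.ext_iff

variable [SuperAlgebra B]

theorem supercomm_mem_superDer {X Y : Module.End ℂ B} (hX : X ∈ superDer B)
    (hY : Y ∈ superDer B) : supercomm (Module.End ℂ B) X Y ∈ superDer B := by
  have key : ∀ (p q : ZMod 2) (X Y : Module.End ℂ B), IsHom p X → IsHom q Y →
      X ∈ superDer B → Y ∈ superDer B → supercomm (Module.End ℂ B) X Y ∈ superDer B := by
    intro p q X Y hp hq hX hY
    have hpq : IsHom (p + q) (X * Y - sg (p * q) • (Y * X)) :=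
      (hp.mul hq).sub ((add_comm q p ▸ hq.mul hp).smul _)
    rw [supercomm_eq hp hq, mem_superDer hpq]
    rw [mem_superDer hp] at hX
    rw [mem_superDer hq] at hY
    intro a b
    simp only [LinearMap.sub_apply, LinearMap.smul_apply, Module.End.mul_apply]
    rw [hX a b, hY a b, map_add, map_add, hX, hX, hY, hY, hp.apply_twist, hq.apply_twist,
      twist_twist, twist_twist, add_comm q p, mul_comm q p]
    have h := sg_mul_self (p * q)
    simp only [smul_add, sub_mul, mul_sub, smul_mul_assoc, mul_smul_comm, smul_smul, h, one_smul]
    abel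
  rw [← part_add_part X, ← part_add_part Y]
  simp only [map_add, LinearMap.add_apply]
  have hXp := part_mem_superDer hX
  have hYp := part_mem_superDer hY
  refine (superDer B).add_mem ((superDer B).add_mem ?_ ?_) ((superDer B).add_mem ?_ ?_) <;>
  exact key _ _ _ _ (part_isHom _ _) (part_isHom _ _) (hXp _) (hYp _)

/-- Superderivations form a Lie superalgebra under the supercommutator. -/
instance : LieSuperalgebra (SuperDer B) where
  bracket := LinearMap.mk₂ ℂ
    (fun X Y => SuperDer.mk (supercomm (Module.End ℂ B) X.toEnd Y.toEnd)
      (supercomm_mem_superDer X.mem Y.mem))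
    (by intros; apply SuperDer.ext; simp [SuperDer.toEnd_mk])
    (by intros; apply SuperDer.ext; simp [SuperDer.toEnd_mk])
    (by intros; apply SuperDer.ext; simp [SuperDer.toEnd_mk])
    (by intros; apply SuperDer.ext; simp [SuperDer.toEnd_mk])
  bracket_hom := by
    intro p q x y hx hy
    rw [isHom_superDer] at *
    exact (lieOfAssoc (Module.End ℂ B)).bracket_hom hx hy
  bracket_skew := by
    intro p q x y hx hy
    rw [isHom_superDer] at *
    exact SuperDer.ext ((lieOfAssoc (Module.End ℂ B)).bracket_skew hx hy)
  jacobi := by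
    intro p q r x y z hx hy hz
    rw [isHom_superDer] at *
    exact SuperDer.ext ((lieOfAssoc (Module.End ℂ B)).jacobi hx hy hz)

theorem bracket_superDer {p q : ZMod 2} {X Y : SuperDer B} (hX : IsHom p X) (hY : IsHom q Y) :
    (bracket X Y).toEnd = X.toEnd * Y.toEnd - sg (p * q) • (Y.toEnd * X.toEnd) :=
  supercomm_eq (isHom_superDer.1 hX) (isHom_superDer.1 hY)

end Der

section W

variable {m n : ℕ}

/-- The Witt superalgebra `W(m,n)` of superderivations of `A`. -/
abbrev W (m n : ℕ) : Type := SuperDer (A m n)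

/-- Left multiplication on `A`. -/
def mulA (f : A m n) : Module.End ℂ (A m n) := LinearMap.mulLeft ℂ f

theorem mulA_apply (f g : A m n) : mulA f g = f * g := rfl

theorem mulA_hom {p : ZMod 2} {f : A m n} (h : IsHom p f) : IsHom p (mulA f) := by
  rw [isHom_end_iff]
  intro v
  have h' : parity f = sg p • f := h
  rw [mulA_apply, parity_mul, h', smul_mul_assoc]
  rfl

theorem pd_inl (i : Fin m) (f : MvPolynomial (Fin m) ℂ) (w : ExteriorAlgebra ℂ (Fin n → ℂ)) :
    pd (Sum.inl i) (tm f w : A m n) = tm (MvPolynomial.pderiv i f) w := rfl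

theorem pd_inr (j : Fin n) (f : MvPolynomial (Fin m) ℂ) (w : ExteriorAlgebra ℂ (Fin n → ℂ)) :
    pd (Sum.inr j) (tm f w : A m n) = tm f (CliffordAlgebra.contractLeft
      (Q := (0 : QuadraticForm ℂ (Fin n → ℂ))) (LinearMap.proj j) w) := rfl

theorem contract_involute (d : Module.Dual ℂ (Fin n → ℂ))
    (w : CliffordAlgebra (0 : QuadraticForm ℂ (Fin n → ℂ))) :
    CliffordAlgebra.involute (CliffordAlgebra.contractLeft d w) =
      - CliffordAlgebra.contractLeft d (CliffordAlgebra.involute w) := by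
  induction w using CliffordAlgebra.left_induction with
  | algebraMap r => simp
  | add x y hx hy => simp only [map_add, hx, hy, neg_add]
  | ι_mul x v hx =>
    simp only [CliffordAlgebra.contractLeft_ι_mul, map_sub, map_mul, map_smul,
      CliffordAlgebra.involute_ι, neg_mul, map_neg, hx]
    simp

theorem contract_mul (d : Module.Dual ℂ (Fin n → ℂ))
    (w z : CliffordAlgebra (0 : QuadraticForm ℂ (Fin n → ℂ))) :
    CliffordAlgebra.contractLeft d (w * z) = CliffordAlgebra.contractLeft d w * z +
      CliffordAlgebra.involute w * CliffordAlgebra.contractLeft d z := by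
  induction w using CliffordAlgebra.left_induction with
  | algebraMap r => simp [CliffordAlgebra.contractLeft_algebraMap_mul]
  | add x y hx hy => simp only [add_mul, map_add, hx, hy]; abel
  | ι_mul x v hx =>
    rw [mul_assoc, CliffordAlgebra.contractLeft_ι_mul, CliffordAlgebra.contractLeft_ι_mul, hx,
      map_mul, CliffordAlgebra.involute_ι]
    simp only [sub_mul, mul_add, smul_mul_assoc, mul_assoc, neg_mul]
    abel

theorem pd_hom (a : Fin m ⊕ Fin n) : IsHom (ip a) (pd a : Module.End ℂ (A m n)) := by
  rw [isHom_end_iff]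
  intro v
  induction v using A_induction with
  | zero => simp
  | add a b ha hb => simp only [map_add, ha, hb, smul_add]
  | tmul f w =>
    cases a with
    | inl i => rw [parity_tm, pd_inl, pd_inl, parity_tm]; simp [ip, sg_zero]
    | inr j =>
      rw [parity_tm, pd_inr, pd_inr, parity_tm, contract_involute]
      simp [ip, sg_one, tm_neg]

theorem pd_leibniz (a : Fin m ⊕ Fin n) :
    SuperLeibniz (ip a) (pd a : Module.End ℂ (A m n)) := by
  intro x y
  induction x using A_induction with
  | zero => simp
  | add x x' hx hx' => simp only [add_mul, map_add, hx, hx']; abel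
  | tmul f w =>
    induction y using A_induction with
    | zero => simp
    | add y y' hy hy' => simp only [mul_add, map_add, hy, hy']; abel
    | tmul g z =>
      cases a with
      | inl i =>
        rw [show ip (Sum.inl i : Fin m ⊕ Fin n) = 0 from rfl, twist_zero,
          tm_mul, pd_inl, pd_inl, pd_inl,
          tm_mul, tm_mul,
          Derivation.leibniz, ← add_tm, smul_eq_mul, smul_eq_mul, add_comm,
          mul_comm g]
      | inr j =>
        rw [show ip (Sum.inr j : Fin m ⊕ Fin n) = 1 from rfl, twist_one, parity_tm,
          tm_mul, pd_inr, pd_inr, pd_inr,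
          tm_mul, tm_mul,
          ← tm_add, contract_mul]

theorem pd_gen (a b : Fin m ⊕ Fin n) : pd a (gen b : A m n) = if a = b then 1 else 0 := by
  cases a with
  | inl i =>
    cases b with
    | inl k =>
      rw [show (gen (Sum.inl k) : A m n) = tm (MvPolynomial.X k) 1 from rfl, pd_inl,
        MvPolynomial.pderiv_X]
      by_cases h : i = k
      · subst h; simp [tm_one]
      · simp [h, Ne.symm h, zero_tm]
    | inr k =>
      rw [show (gen (Sum.inr k) : A m n) = tm 1 (ExteriorAlgebra.ι ℂ (Pi.single k 1)) from rfl,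
        pd_inl]
      simp [zero_tm]
  | inr j =>
    cases b with
    | inl k =>
      rw [show (gen (Sum.inl k) : A m n) = tm (MvPolynomial.X k) 1 from rfl, pd_inr,
        CliffordAlgebra.contractLeft_one]
      simp [tm_zero]
    | inr k =>
      rw [show (gen (Sum.inr k) : A m n) = tm 1 (ExteriorAlgebra.ι ℂ (Pi.single k 1)) from rfl,
        pd_inr, CliffordAlgebra.contractLeft_ι]
      by_cases h : j = k
      · subst h; simp [tm_one]
      · simp [h, tm_zero]

theorem mulA_pd_leibniz {p : ZMod 2} {f : A m n} (hf : IsHom p f) (a : Fin m ⊕ Fin n) :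
    SuperLeibniz (p + ip a) (mulA f * pd a) := by
  intro x y
  simp only [Module.End.mul_apply, mulA_apply]
  rw [pd_leibniz a x y, mul_add, ← mul_assoc, ← mul_assoc, ← mul_assoc,
    A_supercomm hf (twist (ip a) x), twist_twist]

/-- The vector field `f ∂_a`. -/
def fieldOf (f : A m n) (a : Fin m ⊕ Fin n) : W m n :=
  SuperDer.mk (mulA f * pd a) (by
    have h : ∀ p : ZMod 2, mulA (part p f) * pd a ∈ superDer (A m n) := fun p =>
      (mem_superDer ((mulA_hom (part_isHom p f)).mul (pd_hom a))).2
        (mulA_pd_leibniz (part_isHom p f) a)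
    have hf : mulA f * pd a = mulA (part 0 f) * pd a + mulA (part 1 f) * pd a := by
      rw [← add_mul]
      congr 1
      refine LinearMap.ext fun g => ?_
      rw [LinearMap.add_apply, mulA_apply, mulA_apply, mulA_apply, ← add_mul, part_add_part]
    rw [hf]
    exact (superDer (A m n)).add_mem (h 0) (h 1))

theorem leibniz_ext {p : ZMod 2} {X : Module.End ℂ (A m n)} (h : SuperLeibniz p X)
    (hg : ∀ a, X (gen a) = 0) : X = 0 := by
  have h1 : X 1 = 0 := by
    have := h 1 1
    rw [twist_one_eq, mul_one, mul_one, one_mul] at this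
    simpa using this
  refine LinearMap.ext fun f => ?_
  have hf : f ∈ Algebra.adjoin ℂ (Set.range (gen : Fin m ⊕ Fin n → A m n)) := by
    rw [adjoin_gen]; trivial
  induction hf using Algebra.adjoin_induction with
  | mem x hx => obtain ⟨a, rfl⟩ := hx; exact hg a
  | algebraMap r => rw [Algebra.algebraMap_eq_smul_one, map_smul, h1, smul_zero]; rfl
  | add x y _ _ hx hy => rw [map_add, hx, hy, map_add]
  | mul x y _ _ hx hy => rw [h, hx, hy]; simp

/-- Every superderivation is the combination of the partial derivatives with its values on the
generators as coefficients. -/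
theorem der_expand {X : Module.End ℂ (A m n)} (hX : X ∈ superDer (A m n)) :
    X = ∑ a, mulA (X (gen a)) * pd a := by
  have key : ∀ p (X : Module.End ℂ (A m n)), IsHom p X → X ∈ superDer (A m n) →
      X = ∑ a, mulA (X (gen a)) * pd a := by
    intro p X hp hX
    rw [← sub_eq_zero]
    have hs : SuperLeibniz p (∑ a, mulA (X (gen a)) * pd a) := by
      intro x y
      simp only [LinearMap.sum_apply]
      rw [Finset.sum_mul, Finset.mul_sum, ← Finset.sum_add_distrib]
      refine Finset.sum_congr rfl fun a _ => ?_
      rw [mulA_pd_leibniz (hp.apply (gen_hom a)) a x y, add_assoc, CharTwo.add_self_eq_zero,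
        add_zero]
    have hX' := (mem_superDer hp).1 hX
    refine leibniz_ext (p := p) (fun x y => ?_) fun b => ?_
    · rw [LinearMap.sub_apply, LinearMap.sub_apply, LinearMap.sub_apply, hX', hs, sub_mul, mul_sub]
      abel
    · simp only [LinearMap.sub_apply, LinearMap.sum_apply, Module.End.mul_apply, mulA_apply, pd_gen]
      simp
  have h0 := key 0 _ (part_isHom 0 X) (part_mem_superDer hX 0)
  have h1 := key 1 _ (part_isHom 1 X) (part_mem_superDer hX 1)
  conv_lhs => rw [← part_add_part X, h0, h1]
  rw [← Finset.sum_add_distrib]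
  refine Finset.sum_congr rfl fun a _ => ?_
  rw [← add_mul]
  congr 1
  refine LinearMap.ext fun g => ?_
  rw [LinearMap.add_apply, mulA_apply, mulA_apply, mulA_apply, ← add_mul, ← LinearMap.add_apply,
    part_add_part]

theorem pd_comm (a b : Fin m ⊕ Fin n) (f : A m n) :
    pd a (pd b f) = sg (ip a * ip b) • pd b (pd a f) := by
  have hc := supercomm_mem_superDer (B := A m n) ((mem_superDer (pd_hom a)).2 (pd_leibniz a))
    ((mem_superDer (pd_hom b)).2 (pd_leibniz b))
  rw [supercomm_eq (pd_hom a) (pd_hom b)] at hc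
  have hp : IsHom (ip a + ip b) (pd a * pd b - sg (ip a * ip b) • (pd b * pd a) :
      Module.End ℂ (A m n)) :=
    ((pd_hom a).mul (pd_hom b)).sub ((add_comm (ip b) (ip a) ▸ (pd_hom b).mul (pd_hom a)).smul _)
  have hone : ∀ c : Fin m ⊕ Fin n, pd c (1 : A m n) = 0 := by
    intro c
    have := pd_leibniz c (1 : A m n) 1
    rw [twist_one_eq, mul_one, mul_one, one_mul] at this
    simpa using this
  have hz := leibniz_ext ((mem_superDer hp).1 hc) fun c => by
    simp only [LinearMap.sub_apply, LinearMap.smul_apply, Module.End.mul_apply, pd_gen]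
    split_ifs <;> simp [hone]
  have := LinearMap.congr_fun hz f
  simp only [LinearMap.sub_apply, LinearMap.smul_apply, Module.End.mul_apply,
    LinearMap.zero_apply] at this
  exact sub_eq_zero.1 this

/-! ### The extended Witt superalgebra -/

/-- The underlying space of the semidirect product `W ⋉ A`. -/
abbrev WTilde (m n : ℕ) : Type := W m n × A m n

/-- The second component of the semidirect product bracket. -/
def semiSnd (x y : WTilde m n) : A m n :=
  x.1.toEnd y.2 - (SuperDer.toEnd (part 0 y.1) x.2 + SuperDer.toEnd (part 1 y.1) (parity x.2))

/-- The semidirect product bracket: `[X + a, Y + b] = [X, Y] + X(b) - (-1)^{|a| |Y|} Y(a)`. -/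
def semiBracket : WTilde m n →ₗ[ℂ] WTilde m n →ₗ[ℂ] WTilde m n :=
  LinearMap.mk₂ ℂ (fun x y => (bracket x.1 y.1, semiSnd x y))
    (by
      intro x x' y
      refine Prod.ext ?_ ?_
      · change bracket (x.1 + x'.1) y.1 = bracket x.1 y.1 + bracket x'.1 y.1
        rw [map_add, LinearMap.add_apply]
      · change semiSnd (x + x') y = semiSnd x y + semiSnd x' y
        simp only [semiSnd, Prod.fst_add, Prod.snd_add, map_add, LinearMap.add_apply]
        abel)
    (by
      intro c x y
      refine Prod.ext ?_ ?_
      · change bracket (c • x.1) y.1 = c • bracket x.1 y.1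
        rw [map_smul, LinearMap.smul_apply]
      · change semiSnd (c • x) y = c • semiSnd x y
        simp only [semiSnd, Prod.smul_fst, Prod.smul_snd, map_smul, LinearMap.smul_apply,
          smul_sub, smul_add])
    (by
      intro x y y'
      refine Prod.ext ?_ ?_
      · change bracket x.1 (y.1 + y'.1) = bracket x.1 y.1 + bracket x.1 y'.1
        rw [map_add]
      · change semiSnd x (y + y') = semiSnd x y + semiSnd x y'
        simp only [semiSnd, Prod.fst_add, Prod.snd_add, map_add, LinearMap.add_apply]
        abel)
    (by
      intro c x y
      refine Prod.ext ?_ ?_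
      · change bracket x.1 (c • y.1) = c • bracket x.1 y.1
        rw [map_smul]
      · change semiSnd x (c • y) = c • semiSnd x y
        simp only [semiSnd, Prod.smul_fst, Prod.smul_snd, map_smul, LinearMap.smul_apply,
          smul_sub, smul_add])

theorem semiBracket_eq {p q : ZMod 2} {x y : WTilde m n} (hx : IsHom p x) (hy : IsHom q y) :
    semiBracket x y = (bracket x.1 y.1, x.1.toEnd y.2 - sg (p * q) • y.1.toEnd x.2) := by
  rw [isHom_prod] at hx hy
  have hx2 : parity x.2 = sg p • x.2 := hx.2
  have hyy := hy.1
  refine Prod.ext rfl ?_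
  change semiSnd x y = x.1.toEnd y.2 - sg (p * q) • y.1.toEnd x.2
  rw [semiSnd]
  congr 1
  obtain rfl | rfl := par_cases q
  · have h := part_other hyy
    rw [zero_add] at h
    rw [part_self hyy, h, map_zero, mul_zero, sg_zero, one_smul, LinearMap.zero_apply, add_zero]
  · have h : part ((1 : ZMod 2) + 1) y.1 = 0 := part_other hyy
    rw [show (1 : ZMod 2) + 1 = 0 by decide] at h
    rw [part_self hyy, h, map_zero, LinearMap.zero_apply, zero_add, hx2, map_smul, mul_one]

/-- The extended Witt superalgebra `W ⋉ A`. -/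
instance : LieSuperalgebra (WTilde m n) where
  bracket := semiBracket
  bracket_hom := by
    intro p q x y hx hy
    rw [semiBracket_eq hx hy]
    rw [isHom_prod] at *
    refine ⟨bracket_hom hx.1 hy.1, ?_⟩
    exact ((isHom_superDer.1 hx.1).apply hy.2).sub
      ((add_comm q p ▸ (isHom_superDer.1 hy.1).apply hx.2).smul _)
  bracket_skew := by
    intro p q x y hx hy
    rw [semiBracket_eq hx hy, semiBracket_eq hy hx]
    rw [isHom_prod] at *
    refine Prod.ext (bracket_skew hx.1 hy.1) ?_
    simp only [Prod.snd_neg, Prod.smul_snd, smul_sub, smul_smul, mul_comm q p, sg_mul_self,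
      one_smul, neg_sub]
  jacobi := by
    intro p q r x y z hx hy hz
    have hB : ∀ {p q : ZMod 2} {x y : WTilde m n}, IsHom p x → IsHom q y →
        IsHom (p + q) (semiBracket x y) := by
      intro p q x y hx hy
      rw [semiBracket_eq hx hy]
      rw [isHom_prod] at *
      refine ⟨bracket_hom hx.1 hy.1, ?_⟩
      exact ((isHom_superDer.1 hx.1).apply hy.2).sub
        ((add_comm q p ▸ (isHom_superDer.1 hy.1).apply hx.2).smul _)
    rw [semiBracket_eq hx (hB hy hz), semiBracket_eq (hB hx hy) hz, semiBracket_eq hy (hB hx hz),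
      semiBracket_eq hx hy, semiBracket_eq hy hz, semiBracket_eq hx hz]
    rw [isHom_prod] at hx hy hz
    refine Prod.ext (jacobi hx.1 hy.1 hz.1) ?_
    have e1 : sg (p * (q + r)) = sg (p * q) * sg (p * r) := by rw [mul_add, sg_add]
    have e2 : sg ((p + q) * r) = sg (p * r) * sg (q * r) := by rw [add_mul, sg_add]
    have e3 : sg (q * (p + r)) = sg (p * q) * sg (q * r) := by
      rw [mul_add, sg_add, mul_comm q p]
    have h' : ∀ c : ℂ, sg (p * q) * (sg (p * q) * c) = c := fun c => by
      rw [← mul_assoc, sg_mul_self, one_mul]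
    simp only [bracket_superDer hx.1 hy.1, bracket_superDer hy.1 hz.1, bracket_superDer hx.1 hz.1,
      e1, e2, e3, LinearMap.sub_apply, LinearMap.smul_apply, Module.End.mul_apply, map_sub,
      map_smul, Prod.snd_add, Prod.smul_snd, smul_sub, smul_smul, mul_assoc, h']
    module

end W

/-! ### The Weyl superalgebra, `AW`-modules and tensor modules -/

/-- The Weyl superalgebra `𝒦(m,n)`: the associative superalgebra of operators on `A` generated by
the multiplications by elements of `A` and the partial derivatives. -/
def weyl (m n : ℕ) : Subalgebra ℂ (Module.End ℂ (A m n)) :=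
  Algebra.adjoin ℂ (Set.range mulA ∪ Set.range pd)

/-- Graded modules over the Weyl superalgebra. -/
structure WeylModule (m n : ℕ) (P : Type*) [AddCommGroup P] [Module ℂ P] [SuperSpace P] where
  act : weyl m n →ₐ[ℂ] Module.End ℂ P
  act_hom : ∀ {p : ZMod 2} {k : weyl m n}, IsHom p (k : Module.End ℂ (A m n)) → IsHom p (act k)

/-- `AW`-modules: graded modules over `W ⋉ A` on which `A` acts associatively and unitally. -/
structure AWModule (m n : ℕ) (V : Type*) [AddCommGroup V] [Module ℂ V] [SuperSpace V] extends
    LieSuperModule (WTilde m n) V where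
  act_mul : ∀ f g : A m n, act (0, f) * act (0, g) = act (0, f * g)
  act_one : act (0, 1) = 1

section Tensor

variable {m n : ℕ}

/-- Multiplication by `f` as an element of the Weyl superalgebra. -/
def wmul : A m n →ₐ[ℂ] weyl m n :=
  (Algebra.lmul ℂ (A m n)).codRestrict (weyl m n)
    fun f => Algebra.subset_adjoin (Or.inl ⟨f, rfl⟩)

theorem wmul_coe (f : A m n) : (wmul f : Module.End ℂ (A m n)) = mulA f := rfl

/-- The partial derivative as an element of the Weyl superalgebra. -/
def wpd (a : Fin m ⊕ Fin n) : weyl m n := ⟨pd a, Algebra.subset_adjoin (Or.inr ⟨a, rfl⟩)⟩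

/-- A superderivation as an element of the Weyl superalgebra. -/
def wder : W m n →ₗ[ℂ] weyl m n where
  toFun X := ⟨X.toEnd, by
    rw [der_expand X.mem]
    exact (weyl m n).sum_mem fun a _ => (weyl m n).mul_mem (wmul _).2 (wpd a).2⟩
  map_add' _ _ := Subtype.ext (map_add SuperDer.toEnd _ _)
  map_smul' _ _ := Subtype.ext (map_smul SuperDer.toEnd _ _)

theorem wder_coe (X : W m n) : (wder X : Module.End ℂ (A m n)) = X.toEnd := rfl

/-- The right partial derivative of `f`, that is `(-1)^{|b| (|f| - 1)} ∂_b f`. -/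
def rightPd (b : Fin m ⊕ Fin n) : A m n →ₗ[ℂ] A m n := twist (ip b) ∘ₗ pd b

theorem rightPd_apply (b : Fin m ⊕ Fin n) (f : A m n) : rightPd b f = twist (ip b) (pd b f) := rfl

theorem rightPd_hom {p : ZMod 2} {f : A m n} (hf : IsHom p f) (b : Fin m ⊕ Fin n) :
    IsHom (p + ip b) (rightPd b f) := by
  rw [add_comm]
  exact ((pd_hom b).apply hf).twisted

theorem rightPd_mul (d : Fin m ⊕ Fin n) (f g : A m n) :
    rightPd d (f * g) = rightPd d f * twist (ip d) g + f * rightPd d g := by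
  rw [rightPd_apply, pd_leibniz, map_add, twist_mul, twist_mul, twist_twist,
    CharTwo.add_self_eq_zero, twist_zero]
  rfl

theorem rightPd_pd (d a : Fin m ⊕ Fin n) (g : A m n) :
    rightPd d (pd a g) = pd a (rightPd d g) := by
  have h := (pd_hom a).apply_twist (ip d) (pd d g)
  rw [rightPd_apply, rightPd_apply, pd_comm, map_smul, h, smul_smul, sg_mul_self, one_smul]

theorem rightPd_der (X : W m n) (d : Fin m ⊕ Fin n) {s : ZMod 2} {g : A m n} (hg : IsHom s g) :
    rightPd d (X.toEnd g) = X.toEnd (rightPd d g) +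
      ∑ a, sg ((ip a + ip d) * (s + ip a)) • (rightPd d (X.toEnd (gen a)) * rightPd a g) := by
  have hx : ∀ g : A m n, X.toEnd g = ∑ a, X.toEnd (gen a) * pd a g := by
    intro g
    conv_lhs => rw [der_expand X.mem]
    rw [LinearMap.sum_apply]
    rfl
  rw [hx g, hx (rightPd d g), map_sum, ← Finset.sum_add_distrib]
  refine Finset.sum_congr rfl fun a _ => ?_
  have h1 : twist (ip d) (pd a g) = sg ((ip a + ip d) * (s + ip a)) • rightPd a g := by
    rw [← twist_hom (rightPd_hom hg a), rightPd_apply, twist_twist, add_comm (ip a) (ip d),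
      add_assoc, CharTwo.add_self_eq_zero, add_zero]
  rw [rightPd_mul, rightPd_pd, h1, mul_smul_comm, add_comm]

variable {P M : Type*} [AddCommGroup P] [Module ℂ P] [SuperSpace P]
  [AddCommGroup M] [Module ℂ M] [SuperSpace M]
  (ρ : WeylModule m n P) (φ : LieSuperModule (GLSuper m n) M)

variable (M) in
/-- The action `k ⊗ 1` of an element of the Weyl superalgebra on `P ⊗ M`. -/
def leftOp : weyl m n →ₐ[ℂ] Module.End ℂ (P ⊗[ℂ] M) :=
  (Module.End.rTensorAlgHom ℂ P M).comp ρ.act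

theorem leftOp_tmul (k : weyl m n) (u : P) (v : M) :
    leftOp M ρ k (u ⊗ₜ v) = ρ.act k u ⊗ₜ v := rfl

variable (P) in
/-- The action `1 ⊗ E_{b,a}` on `P ⊗ M`:
`(1 ⊗ E_{b,a}) (u ⊗ v) = (-1)^{(|a| + |b|) |u|} u ⊗ E_{b,a} v`. -/
def rightOp (b a : Fin m ⊕ Fin n) : Module.End ℂ (P ⊗[ℂ] M) :=
  TensorProduct.map (twist (ip b + ip a)) (φ.act (unitMat b a))

theorem rightOp_tmul (b a : Fin m ⊕ Fin n) (u : P) (v : M) :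
    rightOp P φ b a (u ⊗ₜ v) = twist (ip b + ip a) u ⊗ₜ φ.act (unitMat b a) v := rfl

variable (M) in
/-- The action `f ⊗ 1` of an element of `A` on `P ⊗ M`. -/
def coefOp : A m n →ₐ[ℂ] Module.End ℂ (P ⊗[ℂ] M) := (leftOp M ρ).comp wmul

/-- The part `∑_{a,b} (-1)^{|b| (|X(x_a)| - 1)} ∂_b(X(x_a)) ⊗ E_{b,a}` of the action of `X ∈ W` on
`P ⊗ M`, where `x_a` runs through the generators of `A`. For `X = t^α ξ_I ∂_i` only the terms with
`a = i` remain, and the coefficients are `∂_b(t^α ξ_I)` for even and `(-1)^{|I| - 1} ∂_b(t^α ξ_I)`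
for odd `b`. -/
def glOp : W m n →ₗ[ℂ] Module.End ℂ (P ⊗[ℂ] M) :=
  ∑ b, ∑ a, LinearMap.mulRight ℂ (rightOp P φ b a) ∘ₗ (coefOp M ρ).toLinearMap ∘ₗ rightPd b ∘ₗ
    (LinearMap.applyₗ (gen a)) ∘ₗ SuperDer.toEnd

theorem glOp_apply (X : W m n) : glOp ρ φ X =
    ∑ b, ∑ a, coefOp M ρ (rightPd b (X.toEnd (gen a))) * rightOp P φ b a := by
  simp only [glOp, LinearMap.sum_apply]
  rfl

/-- The action of `X ∈ W` on `P ⊗ M`: the sum of `X ⊗ 1` and `glOp X`. -/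
def derOp : W m n →ₗ[ℂ] Module.End ℂ (P ⊗[ℂ] M) :=
  (leftOp M ρ).toLinearMap ∘ₗ wder + glOp ρ φ

theorem derOp_apply (X : W m n) : derOp ρ φ X = leftOp M ρ (wder X) + glOp ρ φ X := rfl

theorem leftOp_hom {p : ZMod 2} {k : weyl m n} (hk : IsHom p (k : Module.End ℂ (A m n))) :
    IsHom p (leftOp M ρ k) := by
  rw [isHom_end_iff]
  intro x
  induction x using TensorProduct.induction_on with
  | zero => simp
  | add x y hx hy => simp only [map_add, hx, hy, smul_add]
  | tmul u v =>
    rw [parity_tmul, leftOp_tmul, leftOp_tmul, parity_tmul, isHom_end_iff.1 (ρ.act_hom hk),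
      TensorProduct.smul_tmul']

theorem coefOp_hom {p : ZMod 2} {f : A m n} (hf : IsHom p f) : IsHom p (coefOp M ρ f) :=
  leftOp_hom ρ (mulA_hom hf)

theorem rightOp_hom (b a : Fin m ⊕ Fin n) : IsHom (ip b + ip a) (rightOp P φ b a) := by
  rw [isHom_end_iff]
  intro x
  induction x using TensorProduct.induction_on with
  | zero => simp
  | add x y hx hy => simp only [map_add, hx, hy, smul_add]
  | tmul u v =>
    rw [parity_tmul, rightOp_tmul, rightOp_tmul, parity_tmul,
      isHom_end_iff.1 (φ.act_hom (unitMat_hom b a)), TensorProduct.tmul_smul, ← twist_one,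
      ← twist_one u, twist_twist, twist_twist, add_comm 1 _]

theorem derOp_hom {p : ZMod 2} {X : W m n} (hX : IsHom p X) : IsHom p (derOp ρ φ X) := by
  rw [isHom_superDer] at hX
  rw [derOp_apply, glOp_apply]
  refine (leftOp_hom ρ hX).add (IsHom.sum fun b => IsHom.sum fun a => ?_)
  have h := (coefOp_hom (M := M) ρ (rightPd_hom (hX.apply (gen_hom a)) b)).mul (rightOp_hom φ b a)
  have e : ∀ p a b : ZMod 2, p + a + b + (b + a) = p := by decide
  rwa [e] at h

theorem rightOp_mul_leftOp {p : ZMod 2} {k : weyl m n}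
    (hk : IsHom p (k : Module.End ℂ (A m n))) (b a : Fin m ⊕ Fin n) :
    rightOp P φ b a * leftOp M ρ k =
      sg ((ip b + ip a) * p) • (leftOp M ρ k * rightOp P φ b a) := by
  refine TensorProduct.ext' fun u v => ?_
  simp only [Module.End.mul_apply, LinearMap.smul_apply, leftOp_tmul, rightOp_tmul]
  rw [(ρ.act_hom hk).apply_twist, TensorProduct.smul_tmul']

theorem rightOp_mul_coefOp {p : ZMod 2} {f : A m n} (hf : IsHom p f) (b a : Fin m ⊕ Fin n) :
    rightOp P φ b a * coefOp M ρ f =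
      sg ((ip b + ip a) * p) • (coefOp M ρ f * rightOp P φ b a) :=
  rightOp_mul_leftOp ρ φ (mulA_hom hf) b a

theorem bracket_unitMat (a b c d : Fin m ⊕ Fin n) :
    bracket (unitMat b a : GLSuper m n) (unitMat d c) =
      (if a = d then unitMat b c else 0) -
        sg ((ip b + ip a) * (ip d + ip c)) • (if b = c then unitMat d a else 0) := by
  have h := supercomm_eq (unitMat_hom b a : IsHom _ (unitMat b a : GLSuper m n)) (unitMat_hom d c)
  refine h.trans ?_
  congr 1
  · split_ifs with h
    · subst h; simp [unitMat]
    · simp [unitMat, h]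
  · congr 1
    split_ifs with h
    · subst h; simp [unitMat]
    · simp [unitMat, Ne.symm h]

theorem rightOp_comm (b a d c : Fin m ⊕ Fin n) :
    rightOp P φ b a * rightOp P φ d c -
        sg ((ip b + ip a) * (ip d + ip c)) • (rightOp P φ d c * rightOp P φ b a) =
      (if a = d then rightOp P φ b c else 0) -
        sg ((ip b + ip a) * (ip d + ip c)) • (if b = c then rightOp P φ d a else 0) := by
  refine TensorProduct.ext' fun u v => ?_
  have h := LinearMap.congr_fun (φ.act_bracket (unitMat_hom b a) (unitMat_hom d c)) v
  rw [bracket_unitMat] at h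
  simp only [map_sub, map_smul, LinearMap.sub_apply, LinearMap.smul_apply,
    Module.End.mul_apply] at h
  simp only [Module.End.mul_apply, LinearMap.smul_apply, LinearMap.sub_apply, rightOp_tmul,
    twist_twist]
  rw [add_comm (ip d + ip c) (ip b + ip a), ← TensorProduct.tmul_smul, ← TensorProduct.tmul_sub,
    ← h, TensorProduct.tmul_sub, TensorProduct.tmul_smul]
  have e1 : ∀ a b c : ZMod 2, b + a + (a + c) = b + c := by decide
  have e2 : ∀ a b d : ZMod 2, b + a + (d + b) = d + a := by decide
  congr 1
  · split_ifs with h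
    · subst h; rw [rightOp_tmul, e1]
    · simp
  · congr 1
    split_ifs with h
    · subst h; rw [rightOp_tmul, e2]
    · simp

theorem coefOp_swap {p q : ZMod 2} {f g : A m n} (hf : IsHom p f) (hg : IsHom q g) :
    coefOp M ρ f * coefOp M ρ g = sg (p * q) • (coefOp M ρ g * coefOp M ρ f) := by
  rw [← map_mul, A_swap hf hg, map_smul, map_mul]

theorem wder_wmul {p q : ZMod 2} {X : W m n} {f : A m n} (hX : IsHom p X) (hf : IsHom q f) :
    wder X * wmul f - sg (p * q) • (wmul f * wder X) = wmul (X.toEnd f) := by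
  apply Subtype.ext
  refine LinearMap.ext fun g => ?_
  have h := (mem_superDer (isHom_superDer.1 hX)).1 X.mem f g
  rw [twist_hom hf, smul_mul_assoc] at h
  change X.toEnd (f * g) - sg (p * q) • (f * X.toEnd g) = X.toEnd f * g
  rw [h, add_sub_cancel_right]

theorem leftOp_comb (k l : weyl m n) (c : ℂ) :
    leftOp M ρ (k - c • l) = leftOp M ρ k - c • leftOp M ρ l := by
  have h : k - c • l = k + (-c) • l := by
    refine Subtype.ext (LinearMap.ext fun x => ?_)
    change k.1 x - c • l.1 x = k.1 x + (-c) • l.1 x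
    module
  rw [h, map_add, map_smul]
  refine LinearMap.ext fun x => ?_
  change leftOp M ρ k x + (-c) • leftOp M ρ l x = leftOp M ρ k x - c • leftOp M ρ l x
  module

theorem leftOp_coefOp {p q : ZMod 2} {X : W m n} {f : A m n} (hX : IsHom p X) (hf : IsHom q f) :
    leftOp M ρ (wder X) * coefOp M ρ f =
      coefOp M ρ (X.toEnd f) + sg (p * q) • (coefOp M ρ f * leftOp M ρ (wder X)) := by
  have h := congrArg (leftOp M ρ) (wder_wmul hX hf)
  rw [leftOp_comb, map_mul, map_mul] at h
  exact sub_eq_iff_eq_add.1 h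

theorem derOp_coefOp {p q : ZMod 2} {X : W m n} {f : A m n} (hX : IsHom p X) (hf : IsHom q f) :
    derOp ρ φ X * coefOp M ρ f - sg (p * q) • (coefOp M ρ f * derOp ρ φ X) =
      coefOp M ρ (X.toEnd f) := by
  have hg : glOp ρ φ X * coefOp M ρ f = sg (p * q) • (coefOp M ρ f * glOp ρ φ X) := by
    rw [glOp_apply, Finset.sum_mul, Finset.mul_sum, Finset.smul_sum]
    refine Finset.sum_congr rfl fun b _ => ?_
    rw [Finset.sum_mul, Finset.mul_sum, Finset.smul_sum]
    refine Finset.sum_congr rfl fun a _ => ?_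
    have hr := rightPd_hom ((isHom_superDer.1 hX).apply (gen_hom a)) b
    rw [mul_assoc, rightOp_mul_coefOp ρ φ hf, ← mul_assoc (coefOp M ρ f), coefOp_swap ρ hf hr,
      mul_smul_comm, smul_mul_assoc, smul_smul, mul_assoc, ← sg_add]
    have e : ∀ p q a b : ZMod 2, (b + a) * q = p * q + q * (p + a + b) := by decide
    rw [e p q (ip a) (ip b)]
  rw [derOp_apply, add_mul, leftOp_coefOp ρ hX hf, hg, mul_add, smul_add]
  abel

theorem leftOp_glOp {p q : ZMod 2} {X Y : W m n} (hX : IsHom p X) (hY : IsHom q Y) :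
    leftOp M ρ (wder X) * glOp ρ φ Y - sg (p * q) • (glOp ρ φ Y * leftOp M ρ (wder X)) =
      ∑ d, ∑ c, coefOp M ρ (X.toEnd (rightPd d (Y.toEnd (gen c)))) * rightOp P φ d c := by
  rw [glOp_apply, Finset.mul_sum, Finset.sum_mul, Finset.smul_sum, ← Finset.sum_sub_distrib]
  refine Finset.sum_congr rfl fun d _ => ?_
  rw [Finset.mul_sum, Finset.sum_mul, Finset.smul_sum, ← Finset.sum_sub_distrib]
  refine Finset.sum_congr rfl fun c _ => ?_
  have hr := rightPd_hom ((isHom_superDer.1 hY).apply (gen_hom c)) d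
  have hX' : IsHom p (wder X : Module.End ℂ (A m n)) := isHom_superDer.1 hX
  rw [← mul_assoc, leftOp_coefOp ρ hX hr, mul_assoc (coefOp M ρ _) (rightOp P φ d c),
    rightOp_mul_leftOp ρ φ hX', mul_smul_comm, smul_smul, add_mul, smul_mul_assoc, mul_assoc,
    ← sg_add]
  have e : ∀ p q c d : ZMod 2, p * (q + c + d) = p * q + (d + c) * p := by decide
  rw [e p q (ip c) (ip d), add_sub_cancel_right]

theorem glOp_glOp {p q : ZMod 2} {X Y : W m n} (hX : IsHom p X) (hY : IsHom q Y) :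
    glOp ρ φ X * glOp ρ φ Y - sg (p * q) • (glOp ρ φ Y * glOp ρ φ X) =
      ∑ d, ∑ c, coefOp M ρ
        (∑ a, sg ((ip a + ip d) * (q + ip c + ip a)) •
            (rightPd d (X.toEnd (gen a)) * rightPd a (Y.toEnd (gen c))) -
          sg (p * q) • ∑ a, sg ((ip a + ip d) * (p + ip c + ip a)) •
            (rightPd d (Y.toEnd (gen a)) * rightPd a (X.toEnd (gen c)))) * rightOp P φ d c := by
  set r : Fin m ⊕ Fin n → Fin m ⊕ Fin n → A m n := fun b a => rightPd b (X.toEnd (gen a)) with hr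
  set s : Fin m ⊕ Fin n → Fin m ⊕ Fin n → A m n := fun b a => rightPd b (Y.toEnd (gen a)) with hs
  have hrh : ∀ b a, IsHom (p + ip a + ip b) (r b a) := fun b a => by
    have := rightPd_hom ((isHom_superDer.1 hX).apply (gen_hom a)) b
    exact this
  have hsh : ∀ b a, IsHom (q + ip a + ip b) (s b a) := fun b a => by
    have := rightPd_hom ((isHom_superDer.1 hY).apply (gen_hom a)) b
    exact this
  have hXs : glOp ρ φ X = ∑ b, ∑ a, coefOp M ρ (r b a) * rightOp P φ b a := glOp_apply ρ φ X
  have hYs : glOp ρ φ Y = ∑ b, ∑ a, coefOp M ρ (s b a) * rightOp P φ b a := glOp_apply ρ φ Y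
  -- the contribution of one pair of terms
  have term : ∀ b a d c, coefOp M ρ (r b a) * rightOp P φ b a *
        (coefOp M ρ (s d c) * rightOp P φ d c) -
      sg (p * q) • (coefOp M ρ (s d c) * rightOp P φ d c *
        (coefOp M ρ (r b a) * rightOp P φ b a)) =
      (if a = d then sg ((ip a + ip b) * (q + ip c + ip a)) •
        (coefOp M ρ (r b a * s a c) * rightOp P φ b c) else 0) -
      (if b = c then sg (p * q) • sg ((ip b + ip d) * (p + ip a + ip b)) •
        (coefOp M ρ (s d b * r b a) * rightOp P φ d a) else 0) := by
    intro b a d c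
    have e1 : coefOp M ρ (r b a) * rightOp P φ b a * (coefOp M ρ (s d c) * rightOp P φ d c) =
        sg ((ip b + ip a) * (q + ip c + ip d)) •
          (coefOp M ρ (r b a * s d c) * (rightOp P φ b a * rightOp P φ d c)) := by
      rw [mul_assoc, ← mul_assoc (rightOp P φ b a), rightOp_mul_coefOp ρ φ (hsh d c),
        smul_mul_assoc, mul_smul_comm, map_mul]
      simp only [mul_assoc]
    have e2 : coefOp M ρ (s d c) * rightOp P φ d c * (coefOp M ρ (r b a) * rightOp P φ b a) =
        sg ((ip d + ip c) * (p + ip a + ip b)) •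
          (coefOp M ρ (s d c * r b a) * (rightOp P φ d c * rightOp P φ b a)) := by
      rw [mul_assoc, ← mul_assoc (rightOp P φ d c), rightOp_mul_coefOp ρ φ (hrh b a),
        smul_mul_assoc, mul_smul_comm, map_mul]
      simp only [mul_assoc]
    have e3 : s d c * r b a = sg ((q + ip c + ip d) * (p + ip a + ip b)) • (r b a * s d c) :=
      A_swap (hsh d c) (hrh b a)
    have hc := rightOp_comm (P := P) φ b a d c
    have e4 : rightOp P φ b a * rightOp P φ d c =
        sg ((ip b + ip a) * (ip d + ip c)) • (rightOp P φ d c * rightOp P φ b a) +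
        ((if a = d then rightOp P φ b c else 0) -
        sg ((ip b + ip a) * (ip d + ip c)) • (if b = c then rightOp P φ d a else 0)) := by
      rw [← hc]; abel
    rw [e1, e2, e3, e4, mul_add (coefOp M ρ _), mul_sub (coefOp M ρ _), map_smul]
    simp only [mul_smul_comm, smul_mul_assoc, smul_add, smul_sub, smul_smul, ← sg_add]
    have s1 : ∀ p q a b c d : ZMod 2, p * q + ((d + c) * (p + a + b) +
        (q + c + d) * (p + a + b)) = (b + a) * (q + c + d) + (b + a) * (d + c) := by decide
    rw [← add_assoc (p * q)]
    have s1' := s1 p q (ip a) (ip b) (ip c) (ip d)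
    rw [← add_assoc (p * q)] at s1'
    rw [s1', add_comm (sg _ • (coefOp M ρ (r b a * s d c) * (rightOp P φ d c * rightOp P φ b a))),
      add_sub_cancel_right]
    congr 1
    · split_ifs with h
      · subst h; rw [add_comm (ip b)]
      · simp
    · split_ifs with h
      · subst h
        rw [A_swap (hsh d b) (hrh b a), map_smul, smul_mul_assoc, smul_smul, ← sg_add]
        have e : ∀ p q a b d : ZMod 2, (b + a) * (q + b + d) + (b + a) * (d + b) =
            p * q + (b + d) * (p + a + b) + (q + b + d) * (p + a + b) := by decide
        rw [e p q (ip a) (ip b) (ip d)]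
      · simp
  rw [hXs, hYs]
  have expand : (∑ b, ∑ a, coefOp M ρ (r b a) * rightOp P φ b a) *
        (∑ d, ∑ c, coefOp M ρ (s d c) * rightOp P φ d c) -
      sg (p * q) • ((∑ d, ∑ c, coefOp M ρ (s d c) * rightOp P φ d c) *
        (∑ b, ∑ a, coefOp M ρ (r b a) * rightOp P φ b a)) =
      ∑ b, ∑ a, ∑ d, ∑ c, (coefOp M ρ (r b a) * rightOp P φ b a *
        (coefOp M ρ (s d c) * rightOp P φ d c) -
      sg (p * q) • (coefOp M ρ (s d c) * rightOp P φ d c *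
        (coefOp M ρ (r b a) * rightOp P φ b a))) := by
    simp only [Finset.sum_sub_distrib]
    congr 1
    · simp only [Finset.sum_mul]
      simp only [Finset.mul_sum]
    · simp only [Finset.mul_sum]
      simp only [Finset.sum_mul, Finset.smul_sum]
  rw [expand]
  simp only [term, Finset.sum_sub_distrib]
  simp only [map_sub, map_sum, map_smul, sub_mul, Finset.sum_mul, smul_mul_assoc,
    Finset.sum_sub_distrib, Finset.smul_sum]
  congr 1
  · refine Finset.sum_congr rfl fun b _ => ?_
    rw [Finset.sum_comm (s := Finset.univ) (t := Finset.univ)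
      (f := fun c a => sg ((ip a + ip b) * (q + ip c + ip a)) •
        (coefOp M ρ (r b a * s a c) * rightOp P φ b c))]
    refine Finset.sum_congr rfl fun a _ => ?_
    rw [Finset.sum_comm]
    refine Finset.sum_congr rfl fun c _ => ?_
    simp
  · have collapse : ∀ b a d, (∑ c, if b = c then sg (p * q) •
        sg ((ip b + ip d) * (p + ip a + ip b)) •
        (coefOp M ρ (s d b * r b a) * rightOp P φ d a) else 0) =
        sg (p * q) • sg ((ip b + ip d) * (p + ip a + ip b)) •
        (coefOp M ρ (s d b * r b a) * rightOp P φ d a) := by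
      intro b a d
      simp
    simp only [collapse]
    have reorder : ∀ G : (Fin m ⊕ Fin n) → (Fin m ⊕ Fin n) → (Fin m ⊕ Fin n) →
        Module.End ℂ (P ⊗[ℂ] M), ∑ b, ∑ a, ∑ d, G b a d = ∑ d, ∑ a, ∑ b, G b a d := by
      intro G
      calc ∑ b, ∑ a, ∑ d, G b a d = ∑ b, ∑ d, ∑ a, G b a d :=
            Finset.sum_congr rfl fun b _ => Finset.sum_comm
        _ = ∑ d, ∑ b, ∑ a, G b a d := Finset.sum_comm
        _ = _ := Finset.sum_congr rfl fun d _ => Finset.sum_comm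
    rw [reorder]

theorem derOp_bracket {p q : ZMod 2} {X Y : W m n} (hX : IsHom p X) (hY : IsHom q Y) :
    derOp ρ φ (bracket X Y) =
      derOp ρ φ X * derOp ρ φ Y - sg (p * q) • (derOp ρ φ Y * derOp ρ φ X) := by
  have h1 : wder (bracket X Y) = wder X * wder Y - sg (p * q) • (wder Y * wder X) :=
    Subtype.ext (bracket_superDer hX hY)
  have h2 : leftOp M ρ (wder (bracket X Y)) = leftOp M ρ (wder X) * leftOp M ρ (wder Y) -
      sg (p * q) • (leftOp M ρ (wder Y) * leftOp M ρ (wder X)) := by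
    rw [h1, leftOp_comb, map_mul, map_mul]
  have h3 := leftOp_glOp ρ φ hX hY
  have h4 := leftOp_glOp ρ φ hY hX
  have h5 := glOp_glOp ρ φ hX hY
  have h6 : glOp ρ φ (bracket X Y) =
      (leftOp M ρ (wder X) * glOp ρ φ Y - sg (p * q) • (glOp ρ φ Y * leftOp M ρ (wder X))) -
      sg (p * q) • (leftOp M ρ (wder Y) * glOp ρ φ X -
        sg (q * p) • (glOp ρ φ X * leftOp M ρ (wder Y))) +
      (glOp ρ φ X * glOp ρ φ Y - sg (p * q) • (glOp ρ φ Y * glOp ρ φ X)) := by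
    rw [h3, h4, h5, glOp_apply, Finset.smul_sum, ← Finset.sum_sub_distrib,
      ← Finset.sum_add_distrib]
    refine Finset.sum_congr rfl fun d _ => ?_
    rw [Finset.smul_sum, ← Finset.sum_sub_distrib, ← Finset.sum_add_distrib]
    refine Finset.sum_congr rfl fun c _ => ?_
    rw [← smul_mul_assoc, ← sub_mul, ← add_mul, ← map_smul, ← map_sub, ← map_add]
    congr 2
    rw [bracket_superDer hX hY]
    simp only [LinearMap.sub_apply, LinearMap.smul_apply, Module.End.mul_apply, map_sub, map_smul]
    rw [rightPd_der X d ((isHom_superDer.1 hY).apply (gen_hom c)),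
      rightPd_der Y d ((isHom_superDer.1 hX).apply (gen_hom c)), smul_add]
    abel
  rw [derOp_apply, derOp_apply, derOp_apply, h2, h6, smul_sub, smul_smul, mul_comm q p,
    sg_mul_self, one_smul]
  simp only [add_mul, mul_add, smul_add]
  abel

/-- The tensor module `F(P, M)`, an `AW`-module with underlying superspace `P ⊗ M`. -/
def tensorModule : AWModule m n (P ⊗[ℂ] M) where
  act := (derOp ρ φ).coprod (coefOp M ρ).toLinearMap
  act_hom := by
    intro p x hx
    rw [isHom_prod] at hx
    exact (derOp_hom ρ φ hx.1).add (coefOp_hom ρ hx.2)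
  act_bracket := by
    intro p q x y hx hy
    have hb : bracket x y = (bracket x.1 y.1, x.1.toEnd y.2 - sg (p * q) • y.1.toEnd x.2) :=
      semiBracket_eq hx hy
    rw [isHom_prod] at hx hy
    rw [hb]
    simp only [LinearMap.coprod_apply, AlgHom.toLinearMap_apply]
    rw [derOp_bracket ρ φ hx.1 hy.1, map_sub, map_smul, ← derOp_coefOp ρ φ hx.1 hy.2,
      ← derOp_coefOp ρ φ hy.1 hx.2, mul_comm q p]
    have h := coefOp_swap (M := M) ρ hx.2 hy.2
    simp only [add_mul, mul_add, smul_add, smul_sub, smul_smul, sg_mul_self, one_smul, h]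
    abel
  act_mul := by
    intro f g
    simp only [LinearMap.coprod_apply, map_zero, zero_add, AlgHom.toLinearMap_apply, map_mul]
  act_one := by
    simp only [LinearMap.coprod_apply, map_zero, zero_add, AlgHom.toLinearMap_apply, map_one]

end Tensor

section Cartan

variable {m n : ℕ}

/-- The elements `t_i ∂/∂t_i` and `ξ_j ∂/∂ξ_j` of the Weyl superalgebra acting on `P`. -/
def WeylModule.cartan {P : Type*} [AddCommGroup P] [Module ℂ P] [SuperSpace P]
    (ρ : WeylModule m n P) (a : Fin m ⊕ Fin n) : Module.End ℂ P :=
  ρ.act (wmul (gen a) * wpd a)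

/-- The elements `t_i ∂/∂t_i` and `ξ_j ∂/∂ξ_j` of `W` acting on an `AW`-module. -/
def AWModule.cartan {V : Type*} [AddCommGroup V] [Module ℂ V] [SuperSpace V]
    (ρ : AWModule m n V) (a : Fin m ⊕ Fin n) : Module.End ℂ V :=
  ρ.act (fieldOf (gen a) a, 0)

/-- The diagonal matrix units acting on a `𝔤𝔩(m,n)`-module. -/
def LieSuperModule.cartan {V : Type*} [AddCommGroup V] [Module ℂ V] [SuperSpace V]
    (φ : LieSuperModule (GLSuper m n) V) (a : Fin m ⊕ Fin n) : Module.End ℂ V :=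
  φ.act (unitMat a a)

end Cartan

/-! ### Universal enveloping superalgebras, Kac modules and their simple tops -/

section Enveloping

variable (g : Type*) [AddCommGroup g] [Module ℂ g] [SuperSpace g] [LieSuperalgebra g]

/-- The defining relations `x y - (-1)^{|x| |y|} y x = [x, y]` of the enveloping superalgebra. -/
inductive EnvRel : TensorAlgebra ℂ g → TensorAlgebra ℂ g → Prop
  | comm {p q : ZMod 2} {x y : g} (hx : IsHom p x) (hy : IsHom q y) :
      EnvRel (TensorAlgebra.ι ℂ x * TensorAlgebra.ι ℂ y)
        (TensorAlgebra.ι ℂ (bracket x y) +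
          sg (p * q) • (TensorAlgebra.ι ℂ y * TensorAlgebra.ι ℂ x))

/-- The universal enveloping superalgebra of a Lie superalgebra. -/
abbrev Env : Type _ := RingQuot (EnvRel g)

variable {g}

/-- The canonical map of a Lie superalgebra to its enveloping superalgebra. -/
def Env.ι : g →ₗ[ℂ] Env g := (RingQuot.mkAlgHom ℂ (EnvRel g)).toLinearMap ∘ₗ TensorAlgebra.ι ℂ

theorem Env.ι_mul_ι {p q : ZMod 2} {x y : g} (hx : IsHom p x) (hy : IsHom q y) :
    Env.ι x * Env.ι y = Env.ι (bracket x y) + sg (p * q) • (Env.ι y * Env.ι x) := by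
  have h := RingQuot.mkAlgHom_rel ℂ (EnvRel.comm hx hy)
  rw [map_mul, map_add, map_smul, map_mul] at h
  exact h

/-- The parity automorphism of the enveloping superalgebra. -/
def Env.parityHom : Env g →ₐ[ℂ] Env g :=
  RingQuot.liftAlgHom ℂ ⟨TensorAlgebra.lift ℂ (Env.ι ∘ₗ parity), by
    rintro _ _ ⟨hx, hy⟩
    rename_i p q x y
    have hb : parity (bracket x y) = sg (p + q) • bracket x y := bracket_hom hx hy
    have hx' : parity x = sg p • x := hx
    have hy' : parity y = sg q • y := hy
    simp only [map_mul, map_add, map_smul, TensorAlgebra.lift_ι_apply, LinearMap.comp_apply, hb,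
      hx', hy', smul_mul_smul_comm, sg_add]
    rw [Env.ι_mul_ι hx hy, smul_add, smul_smul, smul_smul, mul_comm (sg q) (sg p),
      mul_comm (sg (p * q))]⟩

theorem Env.parityHom_ι (x : g) : Env.parityHom (Env.ι x) = Env.ι (parity x) := by
  simp only [Env.parityHom, Env.ι, LinearMap.comp_apply, AlgHom.toLinearMap_apply]
  rw [RingQuot.liftAlgHom_mkAlgHom_apply, TensorAlgebra.lift_ι_apply]
  rfl

theorem Env.parityHom_parityHom (u : Env g) : Env.parityHom (Env.parityHom u) = u := by
  have h : (Env.parityHom (g := g)).comp Env.parityHom = AlgHom.id ℂ _ := by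
    apply RingQuot.ringQuot_ext'
    apply TensorAlgebra.hom_ext
    refine LinearMap.ext fun x => ?_
    change Env.parityHom (Env.parityHom (Env.ι x)) = Env.ι x
    rw [Env.parityHom_ι, Env.parityHom_ι, parity_parity]
  exact DFunLike.congr_fun h u

instance : SuperSpace (Env g) where
  parity := Env.parityHom.toLinearMap
  parity_parity := Env.parityHom_parityHom

theorem Env.parity_mul (u v : Env g) : parity (u * v) = parity u * parity v :=
  map_mul Env.parityHom u v

theorem Env.parity_ι (x : g) : parity (Env.ι x) = Env.ι (parity x) := Env.parityHom_ι x

end Enveloping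

section SubQuotient

variable {g : Type*} [AddCommGroup g] [Module ℂ g] [SuperSpace g] [LieSuperalgebra g]
  {V : Type*} [AddCommGroup V] [Module ℂ V] [SuperSpace V]

/-- The quotient of a superspace by a graded subspace. -/
@[reducible] def quotientSuper (N : Submodule ℂ V) (h : ∀ v ∈ N, parity v ∈ N) :
    SuperSpace (V ⧸ N) where
  parity := N.mapQ N parity h
  parity_parity := by
    intro v
    obtain ⟨w, rfl⟩ := N.mkQ_surjective v
    simp [parity_parity]

/-- The sum of all proper graded submodules. -/
def LieSuperModule.radical (φ : LieSuperModule g V) : Submodule ℂ V :=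
  sSup {N | IsGradedSub φ.act N ∧ N ≠ ⊤}

theorem LieSuperModule.radical_graded (φ : LieSuperModule g V) :
    IsGradedSub φ.act φ.radical := by
  constructor
  · have h : φ.radical ≤ φ.radical.comap parity := by
      refine sSup_le fun N hN v hv => ?_
      exact (le_sSup hN : N ≤ φ.radical) (hN.1.parity_mem v hv)
    exact fun v hv => h hv
  · intro x
    have h : φ.radical ≤ φ.radical.comap (φ.act x) := by
      refine sSup_le fun N hN v hv => ?_
      exact (le_sSup hN : N ≤ φ.radical) (hN.1.act_mem x v hv)
    exact fun v hv => h hv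

/-- The quotient of `V` by the sum of all proper graded submodules. When `V` has a unique maximal
graded submodule, which is then that sum, this is the unique simple top of `V`. -/
def LieSuperModule.Top (φ : LieSuperModule g V) : Type _ := V ⧸ φ.radical

instance (φ : LieSuperModule g V) : AddCommGroup φ.Top :=
  inferInstanceAs (AddCommGroup (V ⧸ φ.radical))

instance (φ : LieSuperModule g V) : Module ℂ φ.Top :=
  inferInstanceAs (Module ℂ (V ⧸ φ.radical))

instance (φ : LieSuperModule g V) : SuperSpace φ.Top :=
  quotientSuper φ.radical φ.radical_graded.parity_mem

/-- The projection to the top. -/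
def LieSuperModule.topMk (φ : LieSuperModule g V) : V →ₗ[ℂ] φ.Top := φ.radical.mkQ

theorem LieSuperModule.topMk_surjective (φ : LieSuperModule g V) :
    Function.Surjective φ.topMk := φ.radical.mkQ_surjective

theorem LieSuperModule.parity_topMk (φ : LieSuperModule g V) (v : V) :
    parity (φ.topMk v) = φ.topMk (parity v) := rfl

/-- The operators on the top. -/
def LieSuperModule.topOp (φ : LieSuperModule g V) (x : g) : Module.End ℂ φ.Top :=
  φ.radical.mapQ φ.radical (φ.act x) (φ.radical_graded.act_mem x)

theorem LieSuperModule.topOp_topMk (φ : LieSuperModule g V) (x : g) (v : V) :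
    φ.topOp x (φ.topMk v) = φ.topMk (φ.act x v) := rfl

/-- The quotient action on the top. -/
def LieSuperModule.top (φ : LieSuperModule g V) : LieSuperModule g φ.Top where
  act :=
    { toFun := φ.topOp
      map_add' := by
        intro x y
        refine LinearMap.ext fun v => ?_
        obtain ⟨w, rfl⟩ := φ.topMk_surjective v
        simp only [LinearMap.add_apply, topOp_topMk, map_add]
      map_smul' := by
        intro c x
        refine LinearMap.ext fun v => ?_
        obtain ⟨w, rfl⟩ := φ.topMk_surjective v
        simp only [LinearMap.smul_apply, topOp_topMk, map_smul, RingHom.id_apply] }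
  act_hom := by
    intro p x hx
    rw [isHom_end_iff]
    intro v
    obtain ⟨w, rfl⟩ := φ.topMk_surjective v
    change parity (φ.topOp x (φ.topMk w)) = sg p • φ.topOp x (parity (φ.topMk w))
    rw [topOp_topMk, parity_topMk, parity_topMk, topOp_topMk, isHom_end_iff.1 (φ.act_hom hx),
      map_smul]
  act_bracket := by
    intro p q x y hx hy
    refine LinearMap.ext fun v => ?_
    obtain ⟨w, rfl⟩ := φ.topMk_surjective v
    change φ.topOp (bracket x y) (φ.topMk w) = φ.topOp x (φ.topOp y (φ.topMk w)) -
      sg (p * q) • φ.topOp y (φ.topOp x (φ.topMk w))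
    simp only [topOp_topMk, φ.act_bracket hx hy, LinearMap.sub_apply, LinearMap.smul_apply,
      Module.End.mul_apply, map_sub, map_smul]

end SubQuotient

section Kac

variable {m n : ℕ} {V : Type*} [AddCommGroup V] [Module ℂ V]

/-- The even part `𝔤𝔩(m,n)₀ = 𝔤𝔩ₘ ⊕ 𝔤𝔩ₙ` of `𝔤𝔩(m,n)`. -/
abbrev GLEven (m n : ℕ) : Type := Matrix (Fin m) (Fin m) ℂ × Matrix (Fin n) (Fin n) ℂ

/-- The inclusion `𝔤𝔩(m,n)₀ ⊕ 𝔤𝔩(m,n)₁ → 𝔤𝔩(m,n)` as block upper triangular matrices. -/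
def upper (X : GLEven m n) (Z : Matrix (Fin m) (Fin n) ℂ) : GLSuper m n :=
  Matrix.fromBlocks X.1 Z 0 X.2

theorem parity_upper (X : GLEven m n) (Z : Matrix (Fin m) (Fin n) ℂ) :
    parity (upper X Z) = upper X (-Z) := by
  ext a b
  rw [parity_gl_apply]
  rcases a with a | a <;> rcases b with b | b <;>
    simp [upper, ip, sg, show (1 : ZMod 2) + 1 = 0 by decide]

/-- The relations `(u b) ⊗ v = u ⊗ (b v)` of the induced module, for `b` in
`𝔤𝔩(m,n)₀ ⊕ 𝔤𝔩(m,n)₁`, where `𝔤𝔩(m,n)₁` acts on `V` by zero. -/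
def kacRel (σ : GLEven m n →ₗ⁅ℂ⁆ Module.End ℂ V) :
    Submodule ℂ (Env (GLSuper m n) ⊗[ℂ] V) :=
  Submodule.span ℂ {x | ∃ (u : Env (GLSuper m n)) (X : GLEven m n)
    (Z : Matrix (Fin m) (Fin n) ℂ) (v : V),
    x = (u * Env.ι (upper X Z)) ⊗ₜ[ℂ] v - u ⊗ₜ[ℂ] (σ X v)}

/-- The Kac module `K(V)`: the `𝔤𝔩(m,n)`-module induced from the `𝔤𝔩(m,n)₀`-module `V`,
extended by zero to `𝔤𝔩(m,n)₀ ⊕ 𝔤𝔩(m,n)₁`. -/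
def Kac (σ : GLEven m n →ₗ⁅ℂ⁆ Module.End ℂ V) : Type _ :=
  (Env (GLSuper m n) ⊗[ℂ] V) ⧸ kacRel σ

variable (σ : GLEven m n →ₗ⁅ℂ⁆ Module.End ℂ V)

instance : AddCommGroup (Kac σ) :=
  inferInstanceAs (AddCommGroup ((Env (GLSuper m n) ⊗[ℂ] V) ⧸ kacRel σ))

instance : Module ℂ (Kac σ) :=
  inferInstanceAs (Module ℂ ((Env (GLSuper m n) ⊗[ℂ] V) ⧸ kacRel σ))

/-- The class of `u ⊗ v` in the Kac module. -/
def Kac.mk (u : Env (GLSuper m n)) (v : V) : Kac σ := (kacRel σ).mkQ (u ⊗ₜ v)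

@[elab_as_elim]
theorem Kac.induction {motive : Kac σ → Prop} (x : Kac σ) (zero : motive 0)
    (mk : ∀ u v, motive (Kac.mk σ u v)) (add : ∀ x y, motive x → motive y → motive (x + y)) :
    motive x := by
  obtain ⟨y, rfl⟩ := (kacRel σ).mkQ_surjective x
  induction y using TensorProduct.induction_on with
  | zero => rw [map_zero]; exact zero
  | tmul u v => exact mk u v
  | add y z hy hz => rw [map_add]; exact add _ _ hy hz

theorem kacRel_parity : kacRel σ ≤ (kacRel σ).comap (LinearMap.rTensor V parity) := by
  refine Submodule.span_le.2 ?_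
  rintro _ ⟨u, X, Z, v, rfl⟩
  refine Submodule.subset_span ⟨parity u, X, -Z, v, ?_⟩
  rw [map_sub, LinearMap.rTensor_tmul, LinearMap.rTensor_tmul, Env.parity_mul, Env.parity_ι,
    parity_upper]

theorem kacRel_act (x : GLSuper m n) : kacRel σ ≤
    (kacRel σ).comap (LinearMap.rTensor V (LinearMap.mulLeft ℂ (Env.ι x))) := by
  refine Submodule.span_le.2 ?_
  rintro _ ⟨u, X, Z, v, rfl⟩
  refine Submodule.subset_span ⟨Env.ι x * u, X, Z, v, ?_⟩
  rw [map_sub, LinearMap.rTensor_tmul, LinearMap.rTensor_tmul, LinearMap.mulLeft_apply,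
    LinearMap.mulLeft_apply, mul_assoc]

/-- The parity involution of the Kac module. -/
def Kac.par : Module.End ℂ (Kac σ) :=
  (kacRel σ).mapQ (kacRel σ) (LinearMap.rTensor V parity) (kacRel_parity σ)

theorem Kac.par_mk (u : Env (GLSuper m n)) (v : V) :
    Kac.par σ (Kac.mk σ u v) = Kac.mk σ (parity u) v := rfl

/-- The grading of the Kac module, in which `V` is even. -/
instance : SuperSpace (Kac σ) where
  parity := Kac.par σ
  parity_parity := by
    intro x
    induction x using Kac.induction with
    | zero => simp only [map_zero]
    | add x y hx hy => simp only [map_add, hx, hy]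
    | mk u v => rw [Kac.par_mk, Kac.par_mk, parity_parity]

theorem Kac.parity_mk (u : Env (GLSuper m n)) (v : V) :
    parity (Kac.mk σ u v) = Kac.mk σ (parity u) v := rfl

theorem Kac.mk_add (u u' : Env (GLSuper m n)) (v : V) :
    Kac.mk σ (u + u') v = Kac.mk σ u v + Kac.mk σ u' v := by
  simp only [Kac.mk, TensorProduct.add_tmul, map_add]
  rfl

theorem Kac.mk_smul (c : ℂ) (u : Env (GLSuper m n)) (v : V) :
    Kac.mk σ (c • u) v = c • Kac.mk σ u v := by
  simp only [Kac.mk, ← TensorProduct.smul_tmul', map_smul]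
  rfl

/-- Left multiplication by an element of `𝔤𝔩(m,n)` on the Kac module. -/
def Kac.op (x : GLSuper m n) : Module.End ℂ (Kac σ) :=
  (kacRel σ).mapQ (kacRel σ) (LinearMap.rTensor V (LinearMap.mulLeft ℂ (Env.ι x)))
    (kacRel_act σ x)

theorem Kac.op_mk (x : GLSuper m n) (u : Env (GLSuper m n)) (v : V) :
    Kac.op σ x (Kac.mk σ u v) = Kac.mk σ (Env.ι x * u) v := rfl

/-- The action of `𝔤𝔩(m,n)` on the Kac module. -/
def Kac.module : LieSuperModule (GLSuper m n) (Kac σ) where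
  act :=
    { toFun := Kac.op σ
      map_add' := by
        intro x y
        refine LinearMap.ext fun w => ?_
        induction w using Kac.induction with
        | zero => simp only [map_zero]
        | add w w' hw hw' => simp only [map_add, hw, hw']
        | mk u v => rw [LinearMap.add_apply, op_mk, op_mk, op_mk, map_add, add_mul, mk_add]
      map_smul' := by
        intro c x
        refine LinearMap.ext fun w => ?_
        induction w using Kac.induction with
        | zero => simp only [map_zero]
        | add w w' hw hw' => simp only [map_add, hw, hw']
        | mk u v =>
          rw [RingHom.id_apply, LinearMap.smul_apply, op_mk, op_mk, map_smul, smul_mul_assoc,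
            mk_smul] }
  act_hom := by
    intro p x hx
    rw [isHom_end_iff]
    intro w
    change parity (Kac.op σ x w) = sg p • Kac.op σ x (parity w)
    have hx' : parity x = sg p • x := hx
    induction w using Kac.induction with
    | zero => simp only [map_zero, smul_zero]
    | add w w' hw hw' => simp only [map_add, hw, hw', smul_add]
    | mk u v =>
      rw [op_mk, parity_mk, parity_mk, op_mk, Env.parity_mul, Env.parity_ι, hx', map_smul,
        smul_mul_assoc, mk_smul]
  act_bracket := by
    intro p q x y hx hy
    refine LinearMap.ext fun w => ?_
    change Kac.op σ (bracket x y) w = Kac.op σ x (Kac.op σ y w) -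
      sg (p * q) • Kac.op σ y (Kac.op σ x w)
    induction w using Kac.induction with
    | zero => simp only [map_zero, smul_zero, sub_zero]
    | add w w' hw hw' => simp only [map_add, hw, hw', smul_add]; abel
    | mk u v =>
      simp only [op_mk]
      rw [← mul_assoc, Env.ι_mul_ι hx hy, add_mul, mk_add, smul_mul_assoc, mk_smul, mul_assoc,
        add_sub_cancel_right]

/-- The module `L(V)`: the top of the Kac module. -/
abbrev LTop : Type _ := (Kac.module σ).Top

/-- The action of `𝔤𝔩(m,n)` on `L(V)`. -/
def LModule : LieSuperModule (GLSuper m n) (LTop σ) := (Kac.module σ).top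

end Kac

section Iso

variable {g : Type*} [AddCommGroup g] [Module ℂ g] [SuperSpace g] [LieSuperalgebra g]

/-- The parity change `Π(V)`: the same space with the opposite grading. -/
def ParityChange (V : Type*) : Type _ := V

instance (V : Type*) [AddCommGroup V] : AddCommGroup (ParityChange V) :=
  inferInstanceAs (AddCommGroup V)

instance (V : Type*) [AddCommGroup V] [Module ℂ V] : Module ℂ (ParityChange V) :=
  inferInstanceAs (Module ℂ V)

instance (V : Type*) [AddCommGroup V] [Module ℂ V] [h : SuperSpace V] :
    SuperSpace (ParityChange V) where
  parity := (-h.parity : V →ₗ[ℂ] V)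
  parity_parity := by
    intro v
    change -h.parity (-h.parity v) = v
    rw [map_neg, neg_neg]
    exact h.parity_parity v

/-- The parity change of a module. -/
def LieSuperModule.parityChange {V : Type*} [AddCommGroup V] [Module ℂ V] [h : SuperSpace V]
    (φ : LieSuperModule g V) : LieSuperModule g (ParityChange V) where
  act := (φ.act : g →ₗ[ℂ] Module.End ℂ V)
  act_hom := by
    intro p x hx
    rw [isHom_end_iff]
    intro v
    have := isHom_end_iff.1 (φ.act_hom hx) v
    change -h.parity (φ.act x v) = sg p • φ.act x (-h.parity v)
    rw [map_neg, smul_neg]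
    exact congrArg Neg.neg this
  act_bracket := φ.act_bracket

/-- Isomorphism of graded modules: an even linear bijection commuting with the action. -/
def LieSuperModule.Isomorphic {V V' : Type*} [AddCommGroup V] [Module ℂ V] [SuperSpace V]
    [AddCommGroup V'] [Module ℂ V'] [SuperSpace V'] (φ : LieSuperModule g V)
    (φ' : LieSuperModule g V') : Prop :=
  ∃ e : V ≃ₗ[ℂ] V', (∀ v, e (parity v) = parity (e v)) ∧ ∀ x v, e (φ.act x v) = φ'.act x (e v)

end Iso

section Classical

/-- The diagonal matrix units acting on an (ungraded) `𝔤𝔩_k`-module. -/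
def glCartan (k : ℕ) (V : Type*) [AddCommGroup V] [Module ℂ V]
    [LieRingModule (Matrix (Fin k) (Fin k) ℂ) V] [LieModule ℂ (Matrix (Fin k) (Fin k) ℂ) V]
    (i : Fin k) : Module.End ℂ V :=
  LieModule.toEnd ℂ (Matrix (Fin k) (Fin k) ℂ) V (Matrix.single i i 1)

/-- The outer tensor product `V₁ ⊗ V₂` of a `𝔤𝔩ₘ`-module and a `𝔤𝔩ₙ`-module, as a module over
`𝔤𝔩ₘ ⊕ 𝔤𝔩ₙ`. -/
def outerTensor (m n : ℕ) (V₁ V₂ : Type*) [AddCommGroup V₁] [Module ℂ V₁]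
    [LieRingModule (Matrix (Fin m) (Fin m) ℂ) V₁] [LieModule ℂ (Matrix (Fin m) (Fin m) ℂ) V₁]
    [AddCommGroup V₂] [Module ℂ V₂]
    [LieRingModule (Matrix (Fin n) (Fin n) ℂ) V₂] [LieModule ℂ (Matrix (Fin n) (Fin n) ℂ) V₂] :
    GLEven m n →ₗ⁅ℂ⁆ Module.End ℂ (V₁ ⊗[ℂ] V₂) where
  toFun X := LinearMap.rTensor V₂ (LieModule.toEnd ℂ (Matrix (Fin m) (Fin m) ℂ) V₁ X.1) +
    LinearMap.lTensor V₁ (LieModule.toEnd ℂ (Matrix (Fin n) (Fin n) ℂ) V₂ X.2)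
  map_add' := by
    intro X Y
    refine TensorProduct.ext' fun u v => ?_
    simp only [Prod.fst_add, Prod.snd_add, map_add, LinearMap.add_apply, LinearMap.rTensor_tmul,
      LinearMap.lTensor_tmul, TensorProduct.add_tmul, TensorProduct.tmul_add]
    abel
  map_smul' := by
    intro c X
    refine TensorProduct.ext' fun u v => ?_
    simp [TensorProduct.smul_tmul']
  map_lie' := by
    intro X Y
    have h1 := LieHom.map_lie (LieModule.toEnd ℂ (Matrix (Fin m) (Fin m) ℂ) V₁) X.1 Y.1
    have h2 := LieHom.map_lie (LieModule.toEnd ℂ (Matrix (Fin n) (Fin n) ℂ) V₂) X.2 Y.2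
    change LinearMap.rTensor V₂ (LieModule.toEnd ℂ (Matrix (Fin m) (Fin m) ℂ) V₁ ⁅X.1, Y.1⁆) +
      LinearMap.lTensor V₁ (LieModule.toEnd ℂ (Matrix (Fin n) (Fin n) ℂ) V₂ ⁅X.2, Y.2⁆) = _
    rw [h1, h2]
    refine TensorProduct.ext' fun u v => ?_
    simp only [LieRing.of_associative_ring_bracket, LinearMap.add_apply, LinearMap.sub_apply,
      Module.End.mul_apply, LinearMap.rTensor_tmul, LinearMap.lTensor_tmul, map_add,
      TensorProduct.sub_tmul, TensorProduct.tmul_sub]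
    abel

end Classical

end SuperLie

end

open SuperLie

/-!
Two facts about a simple weight module `P` over the Weyl superalgebra carry both directions. All
weights of `P` lie in one coset of the integer lattice, `P` being spanned by weight vectors
`e k`, with `k` an integer vector whose odd coordinates are in `{-1, 0, 1}`
(`WeylModule.exists_weight_span`); and a product of powers of two different even variables never
acts by zero on `P` (`WeylModule.var_pow_mul_ne_zero`).

Suppose that the weight spaces of `F(P, M)` have dimension at most `N`. A weight vector of `P`
embeds each weight space of `M` into one of `F(P, M)`, so those of `M` are bounded as well
(`rank_weightSpace_le`). For distinct even indices `i` and `i'` the operator `E i i'` of `M` is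
nilpotent: on a suitable `q` in `P` and a weight vector `x` of `M` with `E i i' ^ N x ≠ 0`, the
`N + 1` vectors `t_i ^ (N - k) t_i' ^ k q ⊗ E i i' ^ k x` are independent and have the same weight
(`act_unitMat_pow_eq_zero`). Since the matrix units in `𝔤𝔩(m, n)₁` anticommute, some homogeneous
weight vector `v` is annihilated by all of them (`exists_singular_vector`). The vectors of the same
parity as `v` that are annihilated by `𝔤𝔩(m, n)₁` and have the same eigenvalue under
`z = ∑ i, E i i`, `i` even, form a simple `𝔤𝔩(m, n)₀`-module `V` (`topRep_irreducible`), because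
the lowering filtration generated by a `𝔤𝔩(m, n)₀`-submodule of `V` is a graded submodule of `M`
that meets the eigenspace of `V` only in that submodule. Fixing the odd weight cuts out of `V` a
`𝔤𝔩ₘ`-submodule with finitely many weights: the differences of the coordinates of a weight are
integers of absolute value at most `N` by `𝔰𝔩₂`-theory (`finite_weights`), and their sum is the
eigenvalue of `z`. It is therefore finite-dimensional, contains a simple `V₁`, and
`V ≅ V₁ ⊗ Hom(V₁, V)` by Burnside's theorem (`exists_outerTensor`). The second factor is bounded as
`V` is. Finally, the inclusion of `V` into `M` extends to the Kac module, and `M` is identified with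
its simple quotient (`isomorphic_LModule`), up to the parity change when `v` is odd.

Conversely, `L(V₁ ⊗ V₂)` is obtained from `V₁ ⊗ V₂` by applying products of distinct elements of the
finite set of lowering matrix units, so it is a finite sum of images of `V₂` under linear maps that
translate weights (`isShiftSpanned_top`). In `F(P, M)` such an image tensored with `e k` contributes
to a given weight for only one choice of the even part of `k` and at most `3 ^ n` choices of the odd
part (`isBounded_tensorModule`).
-/

noncomputable section

namespace SuperLie

open SuperSpace SuperAlgebra LieSuperalgebra

/-! ### Weight spaces of commuting operators -/

section WeightLinearAlgebra

variable {ι V : Type*} [AddCommGroup V] [Module ℂ V] {h : ι → Module.End ℂ V}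

theorem mem_weightSpace {wt : ι → ℂ} {v : V} :
    v ∈ weightSpace h wt ↔ ∀ i, h i v = wt i • v := by
  simp [weightSpace]

/-- An invariant subspace containing a finite sum of weight vectors of distinct weights contains
every summand. -/
theorem mem_of_sum_weight_mem {N : Submodule ℂ V} (hN : ∀ i, ∀ v ∈ N, h i v ∈ N)
    (s : Finset (ι → ℂ)) (f : (ι → ℂ) → V) (hf : ∀ μ ∈ s, f μ ∈ weightSpace h μ)
    (hs : ∑ μ ∈ s, f μ ∈ N) : ∀ μ ∈ s, f μ ∈ N := by
  classical
  induction s using Finset.induction_on generalizing f with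
  | empty => simp
  | insert ν s hν ih =>
    have key : ∀ μ ∈ s, f μ ∈ N := by
      intro μ hμ
      have hne : μ ≠ ν := fun e => hν (e ▸ hμ)
      obtain ⟨i, hi⟩ := Function.ne_iff.1 hne
      -- applying `h i - ν i` removes the summand of weight `ν` and rescales the others
      have := ih (fun κ => (κ i - ν i) • f κ)
        (fun κ hκ => Submodule.smul_mem _ _ (hf κ (Finset.mem_insert_of_mem hκ))) (by
          have h1 := N.sub_mem (hN i _ hs) (N.smul_mem (ν i) hs)
          rw [map_sum, Finset.smul_sum, ← Finset.sum_sub_distrib, Finset.sum_insert hν,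
            mem_weightSpace.1 (hf ν (Finset.mem_insert_self _ _)) i, sub_self, zero_add] at h1
          convert h1 using 1
          refine Finset.sum_congr rfl fun κ hκ => ?_
          rw [mem_weightSpace.1 (hf κ (Finset.mem_insert_of_mem hκ)) i, sub_smul]) μ hμ
      exact (N.smul_mem_iff (sub_ne_zero.2 hi)).1 this
    intro μ hμ
    rcases Finset.mem_insert.1 hμ with rfl | hμ
    · rw [Finset.sum_insert hν] at hs
      exact (N.add_mem_iff_left (N.sum_mem key)).1 hs
    · exact key μ hμ

theorem exists_weight_sum (hw : IsWeight h) (v : V) :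
    ∃ (s : Finset (ι → ℂ)) (f : (ι → ℂ) → V), (∀ μ, f μ ∈ weightSpace h μ) ∧
      ∑ μ ∈ s, f μ = v := by
  have hv : v ∈ ⨆ wt, weightSpace h wt := by rw [hw]; trivial
  obtain ⟨f, hf, rfl⟩ := (Submodule.mem_iSup_iff_exists_finsupp _ _).1 hv
  exact ⟨f.support, f, hf, rfl⟩

/-- An invariant subspace of a weight module is spanned by its weight vectors. -/
theorem le_iSup_inf_weightSpace (hw : IsWeight h) {N : Submodule ℂ V}
    (hN : ∀ i, ∀ v ∈ N, h i v ∈ N) : N ≤ ⨆ μ, N ⊓ weightSpace h μ := by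
  intro v hv
  obtain ⟨s, f, hf, rfl⟩ := exists_weight_sum hw v
  have := mem_of_sum_weight_mem hN s f (fun μ _ => hf μ) hv
  exact Submodule.sum_mem _ fun μ hμ => Submodule.mem_iSup_of_mem μ ⟨this μ hμ, hf μ⟩

theorem disjoint_weightSpace (ν : ι → ℂ) :
    Disjoint (weightSpace h ν) (⨆ μ ≠ ν, weightSpace h μ) := by
  classical
  rw [Submodule.disjoint_def]
  intro v hv hv'
  rw [iSup_subtype'] at hv'
  obtain ⟨f, hf, hfv⟩ := (Submodule.mem_iSup_iff_exists_finsupp _ _).1 hv'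
  set g : (ι → ℂ) → V := fun μ => if hμ : μ ≠ ν then f ⟨μ, hμ⟩ else -v with hg
  have hgν : g ν = -v := by simp [hg]
  have hgμ : ∀ x : {μ // μ ≠ ν}, g x = f x := by rintro ⟨μ, hμ⟩; simp [hg, hμ]
  have hsum : ∑ μ ∈ insert ν (f.support.image Subtype.val), g μ = 0 := by
    rw [Finset.sum_insert (by simp), Finset.sum_image (fun _ _ _ _ e => Subtype.ext e), hgν]
    simp only [hgμ]
    rw [← hfv, Finsupp.sum, neg_add_cancel]
  have := mem_of_sum_weight_mem (h := h) (N := ⊥) (by simp)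
    (insert ν (f.support.image Subtype.val)) g (by
      intro μ _
      by_cases hμ : μ = ν
      · subst hμ; rw [hgν]; exact Submodule.neg_mem _ hv
      · rw [hgμ ⟨μ, hμ⟩]; exact hf ⟨μ, hμ⟩) (by rw [hsum]; simp) ν (Finset.mem_insert_self _ _)
  simpa [hgν] using this

/-- If a space is spanned by subspaces each lying in one weight space, a given weight space is
spanned by those of them that lie in it. -/
theorem weightSpace_le_iSup {T : Type*} {X : T → Submodule ℂ V} {wt : T → ι → ℂ}
    (hX : ∀ τ, X τ ≤ weightSpace h (wt τ)) (htop : ⨆ τ, X τ = ⊤) (ν : ι → ℂ) :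
    weightSpace h ν ≤ ⨆ (τ) (_ : wt τ = ν), X τ := by
  intro v hv
  have hle : ⨆ τ, X τ ≤ (⨆ (τ) (_ : wt τ = ν), X τ) ⊔ ⨆ μ ≠ ν, weightSpace h μ := by
    refine iSup_le fun τ => ?_
    by_cases hτ : wt τ = ν
    · exact le_sup_of_le_left (le_iSup₂_of_le τ hτ le_rfl)
    · exact le_sup_of_le_right ((hX τ).trans (le_iSup₂_of_le (wt τ) hτ le_rfl))
  have hv' := hle (htop ▸ Submodule.mem_top : v ∈ ⨆ τ, X τ)
  obtain ⟨a, ha, b, hb, rfl⟩ := Submodule.mem_sup.1 hv'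
  have haν : a ∈ weightSpace h ν := by
    refine (iSup₂_le fun τ hτ => ?_ : (⨆ (τ) (_ : wt τ = ν), X τ) ≤ weightSpace h ν) ha
    exact hτ ▸ hX τ
  have hbν : b ∈ weightSpace h ν := (Submodule.add_mem_iff_right _ haν).1 hv
  have : b = 0 := Submodule.disjoint_def.1 (disjoint_weightSpace ν) b hbν hb
  rwa [this, add_zero]

/-- A weight module stays one when fewer operators are considered. -/
theorem IsWeight.comp (hw : IsWeight h) {κ : Type*} (r : κ → ι) : IsWeight (fun k => h (r k)) := by
  rw [IsWeight, eq_top_iff, ← hw]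
  refine iSup_le fun μ => le_iSup_of_le (fun k => μ (r k)) ?_
  intro v hv
  exact mem_weightSpace.2 fun k => mem_weightSpace.1 hv (r k)

/-- A module that embeds into a weight module is a weight module. -/
theorem IsWeight.of_injective (hw : IsWeight h) {V' : Type*} [AddCommGroup V'] [Module ℂ V']
    {h' : ι → Module.End ℂ V'} (j : V' →ₗ[ℂ] V) (hj : Function.Injective j)
    (hc : ∀ i v, j (h' i v) = h i (j v)) : IsWeight h' := by
  rw [IsWeight, eq_top_iff]
  intro v _
  have h1 : j v ∈ ⨆ μ, LinearMap.range j ⊓ weightSpace h μ :=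
    le_iSup_inf_weightSpace hw (N := LinearMap.range j)
      (by rintro i _ ⟨w, rfl⟩; exact ⟨h' i w, hc i w⟩) ⟨v, rfl⟩
  have h2 : ⨆ μ, LinearMap.range j ⊓ weightSpace h μ ≤ (⨆ μ, weightSpace h' μ).map j := by
    refine iSup_le fun μ => ?_
    rintro _ ⟨⟨w, rfl⟩, hw⟩
    refine ⟨w, Submodule.mem_iSup_of_mem μ (mem_weightSpace.2 fun i => hj ?_), rfl⟩
    rw [hc, mem_weightSpace.1 hw i, map_smul]
  obtain ⟨w, hw', e⟩ := h2 h1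
  rwa [← hj e]

theorem exists_weight_vector [Nontrivial V] (hw : IsWeight h) :
    ∃ wt, ∃ v ∈ weightSpace h wt, v ≠ 0 := by
  by_contra! hcon
  have : ⨆ wt, weightSpace h wt = ⊥ := iSup_eq_bot.2 fun wt =>
    (Submodule.eq_bot_iff _).2 (hcon wt)
  exact top_ne_bot (hw.symm.trans this)

/-- Projection to an eigenspace preserves invariant subspaces. -/
theorem mem_of_add_mem_of_eigenspace {f : Module.End ℂ V} {N : Submodule ℂ V}
    (hN : ∀ v ∈ N, f v ∈ N) {c : ℂ} {x y : V} (hx : x ∈ f.eigenspace c)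
    (hy : y ∈ ⨆ μ ≠ c, f.eigenspace μ) (hxy : x + y ∈ N) : x ∈ N := by
  set g : Module.End ℂ (V ⧸ N) := N.mapQ N f hN with hg
  have hmap : ∀ μ, (f.eigenspace μ).map N.mkQ ≤ g.eigenspace μ := by
    rintro μ _ ⟨w, hw, rfl⟩
    rw [Module.End.mem_eigenspace_iff] at *
    change N.mkQ (f w) = _
    rw [Module.End.mem_eigenspace_iff.1 hw, map_smul]
  have hy' : N.mkQ y ∈ ⨆ μ ≠ c, g.eigenspace μ := by
    have := Submodule.mem_map_of_mem (f := N.mkQ) hy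
    simp only [Submodule.map_iSup] at this
    exact (iSup₂_mono fun μ _ => hmap μ) this
  have hx' : N.mkQ x ∈ g.eigenspace c := hmap c (Submodule.mem_map_of_mem hx)
  have hs : N.mkQ x + N.mkQ y = 0 := by
    rw [← map_add]; exact (Submodule.Quotient.mk_eq_zero _).2 hxy
  have hx'' : N.mkQ x ∈ ⨆ μ ≠ c, g.eigenspace μ := by
    rw [eq_neg_of_add_eq_zero_left hs]; exact Submodule.neg_mem _ hy'
  have := Submodule.disjoint_def.1 (g.eigenspaces_iSupIndep c) _ hx' hx''
  exact (Submodule.Quotient.mk_eq_zero _).1 this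

theorem rank_finset_sup_le {κ : Type*} (s : Finset κ) (X : κ → Submodule ℂ V) (N : ℕ)
    (hX : ∀ k ∈ s, Module.rank ℂ (X k) ≤ N) :
    Module.rank ℂ (s.sup X : Submodule ℂ V) ≤ (s.card * N : ℕ) := by
  classical
  induction s using Finset.induction_on with
  | empty => simp
  | insert a s ha ih =>
    rw [Finset.sup_insert, Finset.card_insert_of_notMem ha]
    refine (Submodule.rank_add_le_rank_add_rank _ _).trans ?_
    refine (add_le_add (hX a (Finset.mem_insert_self _ _))
      (ih fun k hk => hX k (Finset.mem_insert_of_mem hk))).trans ?_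
    rw [← Nat.cast_add]
    exact le_of_eq (by congr 1; ring)

end WeightLinearAlgebra

/-! ### Modules over `𝔤𝔩(m, n)` and their lowering filtration -/

section LowerSpan

variable {m n : ℕ} {M : Type*} [AddCommGroup M] [Module ℂ M] [SuperSpace M]
  (φ : LieSuperModule (GLSuper m n) M)

/-- The relation between two matrix units in a representation, solved for one of the products. -/
theorem act_unitMat_comm (b a d c : Fin m ⊕ Fin n) (x : M) :
    φ.act (unitMat b a) (φ.act (unitMat d c) x) =
      sg ((ip b + ip a) * (ip d + ip c)) • φ.act (unitMat d c) (φ.act (unitMat b a) x) +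
      ((if a = d then φ.act (unitMat b c) x else 0) -
        sg ((ip b + ip a) * (ip d + ip c)) • (if b = c then φ.act (unitMat d a) x else 0)) := by
  have h := LinearMap.congr_fun (φ.act_bracket (unitMat_hom b a) (unitMat_hom d c)) x
  rw [bracket_unitMat] at h
  simp only [map_sub, map_smul, LinearMap.sub_apply, LinearMap.smul_apply,
    Module.End.mul_apply] at h
  rw [eq_comm, sub_eq_iff_eq_add'] at h
  rw [h]
  congr 2
  · split_ifs <;> simp
  · congr 1
    split_ifs <;> simp

theorem cartan_act_unitMat (c a b : Fin m ⊕ Fin n) (x : M) :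
    φ.cartan c (φ.act (unitMat a b) x) = φ.act (unitMat a b) (φ.cartan c x) +
      ((if c = a then 1 else 0) - (if c = b then 1 else 0) : ℂ) • φ.act (unitMat a b) x := by
  have e : (ip c + ip c) * (ip a + ip b) = 0 := by rw [CharTwo.add_self_eq_zero, zero_mul]
  rw [LieSuperModule.cartan, act_unitMat_comm, e, sg_zero, one_smul, one_smul, sub_smul]
  congr 2
  · split_ifs with h
    · rw [h, one_smul]
    · rw [zero_smul]
  · split_ifs with h
    · rw [h, one_smul]
    · rw [zero_smul]

theorem act_eq_sum (X : GLSuper m n) (x : M) :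
    φ.act X x = ∑ a, ∑ b, X a b • φ.act (unitMat a b) x := by
  conv_lhs => rw [Matrix.matrix_eq_sum_single X]
  simp only [map_sum, LinearMap.sum_apply]
  refine Finset.sum_congr rfl fun a _ => Finset.sum_congr rfl fun b _ => ?_
  rw [← LinearMap.smul_apply, ← map_smul, unitMat, Matrix.smul_single, smul_eq_mul, mul_one]

theorem act_mem_of_unitMat {N : Submodule ℂ M}
    (h : ∀ a b, ∀ v ∈ N, φ.act (unitMat a b) v ∈ N) (X : GLSuper m n) {v : M} (hv : v ∈ N) :
    φ.act X v ∈ N := by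
  rw [act_eq_sum]
  exact N.sum_mem fun a _ => N.sum_mem fun b _ => N.smul_mem _ (h a b v hv)

/-- The element `∑ E_{i,i}` over the even indices. Its adjoint action has eigenvalue `0` on
`𝔤𝔩(m,n)₀` and `1`, `-1` on the block upper and lower triangular odd matrices. -/
def gradOp : Module.End ℂ M := ∑ i : Fin m, φ.cartan (Sum.inl i)

/-- The degree of an index, so that `E_{a,b}` has degree `deg a - deg b` for `gradOp`. -/
def deg {m n : ℕ} (a : Fin m ⊕ Fin n) : ℂ := Sum.elim (fun _ => 1) (fun _ => 0) a

theorem gradOp_act_unitMat (a b : Fin m ⊕ Fin n) (x : M) :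
    gradOp φ (φ.act (unitMat a b) x) = φ.act (unitMat a b) (gradOp φ x) +
      (deg a - deg b) • φ.act (unitMat a b) x := by
  have hd : ∀ a : Fin m ⊕ Fin n, (∑ i : Fin m, if Sum.inl i = a then (1 : ℂ) else 0) = deg a := by
    rintro (i | j) <;> simp [deg]
  simp only [gradOp, LinearMap.sum_apply, cartan_act_unitMat, map_sum, Finset.sum_add_distrib,
    ← Finset.sum_smul, Finset.sum_sub_distrib, hd]

theorem act_unitMat_mem_eigenspace {a b : Fin m ⊕ Fin n} {c : ℂ} {x : M}
    (hx : x ∈ (gradOp φ).eigenspace c) :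
    φ.act (unitMat a b) x ∈ (gradOp φ).eigenspace (c + (deg a - deg b)) := by
  rw [Module.End.mem_eigenspace_iff] at *
  rw [gradOp_act_unitMat, hx, map_smul, add_smul]

/-- A graded `𝔤𝔩(m,n)₀`-stable subspace that is killed by the block upper triangular odd matrices
and lies in one eigenspace of the grading element. -/
structure IsTopLayer (B : Submodule ℂ M) (c : ℂ) : Prop where
  parity_mem : ∀ v ∈ B, parity v ∈ B
  even_mem : ∀ a b : Fin m ⊕ Fin n, ip a = ip b → ∀ v ∈ B, φ.act (unitMat a b) v ∈ B
  raise : ∀ i j, ∀ v ∈ B, φ.act (unitMat (Sum.inl i) (Sum.inr j)) v = 0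
  grade : B ≤ (gradOp φ).eigenspace c

/-- The span of the images of `B` under all products of `k` matrix units of degree `-1`. -/
def lowerIter (B : Submodule ℂ M) : ℕ → Submodule ℂ M
  | 0 => B
  | k + 1 => ⨆ p : Fin n × Fin m,
      (lowerIter B k).map (φ.act (unitMat (Sum.inr p.1) (Sum.inl p.2)))

/-- The span of the images of `B` under all products of matrix units of degree `-1`. -/
def lowerSpan (B : Submodule ℂ M) : Submodule ℂ M := ⨆ k, lowerIter φ B k

variable {φ} {B : Submodule ℂ M} {c : ℂ}

theorem lower_mem_lowerIter {k : ℕ} {x : M} (hx : x ∈ lowerIter φ B k) (j : Fin n) (i : Fin m) :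
    φ.act (unitMat (Sum.inr j) (Sum.inl i)) x ∈ lowerIter φ B (k + 1) :=
  Submodule.mem_iSup_of_mem (j, i) (Submodule.mem_map_of_mem hx)

theorem lowerIter_succ_induction {k : ℕ} {N : Submodule ℂ M}
    (h : ∀ j i, ∀ x ∈ lowerIter φ B k, φ.act (unitMat (Sum.inr j) (Sum.inl i)) x ∈ N) :
    lowerIter φ B (k + 1) ≤ N :=
  iSup_le fun p => Submodule.map_le_iff_le_comap.2 fun x hx => h p.1 p.2 x hx

theorem lowerSpan_le {N : Submodule ℂ M} (hB : B ≤ N)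
    (h : ∀ j i, ∀ x ∈ N, φ.act (unitMat (Sum.inr j) (Sum.inl i)) x ∈ N) :
    lowerSpan φ B ≤ N := by
  refine iSup_le fun k => ?_
  induction k with
  | zero => exact hB
  | succ k ih => exact lowerIter_succ_induction fun j i x hx => h j i x (ih hx)

theorem le_lowerSpan : B ≤ lowerSpan φ B := le_iSup (lowerIter φ B) 0

namespace IsTopLayer

variable (hB : IsTopLayer φ B c)
include hB

theorem lowerIter_parity (k : ℕ) : lowerIter φ B k ≤ (lowerIter φ B k).comap parity := by
  induction k with
  | zero => exact fun v hv => hB.parity_mem v hv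
  | succ k ih =>
    refine lowerIter_succ_induction fun j i x hx => ?_
    rw [Submodule.mem_comap]
    rw [isHom_end_iff.1 (φ.act_hom (unitMat_hom _ _))]
    exact Submodule.smul_mem _ _ (lower_mem_lowerIter (ih hx) j i)

theorem lowerIter_even (k : ℕ) (a b : Fin m ⊕ Fin n) (hab : ip a = ip b) :
    lowerIter φ B k ≤ (lowerIter φ B k).comap (φ.act (unitMat a b)) := by
  induction k with
  | zero => exact fun v hv => hB.even_mem a b hab v hv
  | succ k ih =>
    refine lowerIter_succ_induction fun j i x hx => ?_
    rw [Submodule.mem_comap, act_unitMat_comm]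
    refine add_mem (Submodule.smul_mem _ _ (lower_mem_lowerIter (ih hx) j i)) (sub_mem ?_
      (Submodule.smul_mem _ _ ?_))
    · split_ifs with h
      · subst h
        rcases a with a | a
        · simp [ip] at hab
        · exact lower_mem_lowerIter hx a i
      · exact zero_mem _
    · split_ifs with h
      · subst h
        rcases b with b | b
        · exact lower_mem_lowerIter hx j b
        · simp [ip] at hab
      · exact zero_mem _

/-- A raising matrix unit undoes one lowering step, since its bracket with a lowering matrix unit is
even. -/
theorem lowerIter_raise (k : ℕ) (i' : Fin m) (j' : Fin n) : lowerIter φ B (k + 1) ≤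
    (lowerIter φ B k).comap (φ.act (unitMat (Sum.inl i') (Sum.inr j'))) := by
  have key : ∀ k j i, ∀ x ∈ lowerIter φ B k,
      φ.act (unitMat (Sum.inr j) (Sum.inl i)) (φ.act (unitMat (Sum.inl i') (Sum.inr j')) x) ∈
        lowerIter φ B k →
      φ.act (unitMat (Sum.inl i') (Sum.inr j')) (φ.act (unitMat (Sum.inr j) (Sum.inl i)) x) ∈
        lowerIter φ B k := by
    intro k j i x hx h
    rw [act_unitMat_comm]
    refine add_mem (Submodule.smul_mem _ _ h) (sub_mem ?_ (Submodule.smul_mem _ _ ?_))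
    · split_ifs
      · exact hB.lowerIter_even k (Sum.inl i') (Sum.inl i) rfl hx
      · exact zero_mem _
    · split_ifs
      · exact hB.lowerIter_even k (Sum.inr j) (Sum.inr j') rfl hx
      · exact zero_mem _
  induction k with
  | zero =>
    refine lowerIter_succ_induction fun j i x hx => key 0 j i x hx ?_
    rw [hB.raise i' j' x hx, map_zero]
    exact zero_mem _
  | succ k ih =>
    exact lowerIter_succ_induction fun j i x hx =>
      key (k + 1) j i x hx (lower_mem_lowerIter (ih hx) j i)

theorem lowerIter_grade (k : ℕ) : lowerIter φ B k ≤ (gradOp φ).eigenspace (c - k) := by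
  induction k with
  | zero => simpa [lowerIter] using hB.grade
  | succ k ih =>
    refine lowerIter_succ_induction fun j i x hx => ?_
    have := act_unitMat_mem_eigenspace φ (a := Sum.inr j) (b := Sum.inl i) (ih hx)
    convert this using 2
    simp [deg]
    ring

/-- The subspace generated by a top layer under the lowering operators is a graded submodule. -/
theorem isGradedSub : IsGradedSub φ.act (lowerSpan φ B) := by
  constructor
  · have : lowerSpan φ B ≤ (lowerSpan φ B).comap parity := iSup_le fun k =>
      (hB.lowerIter_parity k).trans (Submodule.comap_mono (le_iSup _ k))
    exact fun v hv => this hv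
  · intro X v hv
    refine act_mem_of_unitMat φ (fun a b => ?_) X hv
    have : lowerSpan φ B ≤ (lowerSpan φ B).comap (φ.act (unitMat a b)) := by
      refine iSup_le fun k => ?_
      rcases a with a | a <;> rcases b with b | b
      · exact (hB.lowerIter_even k (Sum.inl a) (Sum.inl b) rfl).trans
          (Submodule.comap_mono (le_iSup _ k))
      · cases k with
        | zero =>
          intro v hv
          rw [Submodule.mem_comap, hB.raise a b v hv]
          exact zero_mem _
        | succ k => exact (hB.lowerIter_raise k a b).trans (Submodule.comap_mono (le_iSup _ k))
      · exact fun v hv => Submodule.mem_iSup_of_mem (k + 1) (lower_mem_lowerIter hv a b)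
      · exact (hB.lowerIter_even k (Sum.inr a) (Sum.inr b) rfl).trans
          (Submodule.comap_mono (le_iSup _ k))
    exact fun v hv => this hv

/-- The layers `lowerIter φ B k` with `k > 0` have eigenvalues `c - k ≠ c`. -/
theorem lowerSpan_le_sup :
    lowerSpan φ B ≤ B ⊔ ⨆ μ ≠ c, (gradOp φ).eigenspace μ := by
  refine iSup_le fun k => ?_
  cases k with
  | zero => exact le_sup_left
  | succ k =>
    refine le_sup_of_le_right ((hB.lowerIter_grade (k + 1)).trans
      (le_iSup₂_of_le (c - (k + 1 : ℕ)) ?_ le_rfl))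
    intro h
    have : ((k + 1 : ℕ) : ℂ) = 0 := by linear_combination -h
    exact Nat.succ_ne_zero k (Nat.cast_eq_zero.1 this)

/-- The top layer is recovered as an eigenspace of the grading element. -/
theorem mem_of_mem_eigenspace {x : M} (hx : x ∈ lowerSpan φ B)
    (hc : x ∈ (gradOp φ).eigenspace c) : x ∈ B := by
  obtain ⟨b, hb, y, hy, rfl⟩ := Submodule.mem_sup.1 (hB.lowerSpan_le_sup hx)
  have hyc := (Submodule.add_mem_iff_right _ (hB.grade hb)).1 hc
  have := Submodule.disjoint_def.1 ((gradOp φ).eigenspaces_iSupIndep c) _ hyc hy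
  rwa [this, add_zero]

end IsTopLayer

end LowerSpan

/-! ### Kac modules and their simple quotients -/

section EnvelopingAction

variable {g : Type*} [AddCommGroup g] [Module ℂ g] [SuperSpace g] [LieSuperalgebra g]
  {M : Type*} [AddCommGroup M] [Module ℂ M] [SuperSpace M]

/-- The action of the enveloping superalgebra on a graded module. -/
def envAct (φ : LieSuperModule g M) : Env g →ₐ[ℂ] Module.End ℂ M :=
  RingQuot.liftAlgHom ℂ ⟨TensorAlgebra.lift ℂ φ.act, by
    rintro _ _ ⟨hx, hy⟩
    simp only [map_mul, map_add, map_smul, TensorAlgebra.lift_ι_apply, φ.act_bracket hx hy]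
    abel⟩

theorem envAct_ι (φ : LieSuperModule g M) (x : g) : envAct φ (Env.ι x) = φ.act x := by
  simp only [envAct, Env.ι, LinearMap.comp_apply, AlgHom.toLinearMap_apply]
  rw [RingQuot.liftAlgHom_mkAlgHom_apply, TensorAlgebra.lift_ι_apply]

theorem Env.induction {motive : Env g → Prop} (one : motive 1)
    (smul : ∀ (c : ℂ) u, motive u → motive (c • u))
    (add : ∀ u w, motive u → motive w → motive (u + w))
    (mul : ∀ x u, motive u → motive (Env.ι x * u)) (u : Env g) : motive u := by
  have key : ∀ (t : TensorAlgebra ℂ g) (u : Env g), motive u →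
      motive (RingQuot.mkAlgHom ℂ (EnvRel g) t * u) := by
    intro t
    induction t using TensorAlgebra.induction with
    | algebraMap r =>
      intro u hu
      rw [AlgHom.commutes, ← Algebra.smul_def]
      exact smul r u hu
    | ι x => exact fun u hu => mul x u hu
    | mul a b ha hb =>
      intro u hu
      rw [map_mul, mul_assoc]
      exact ha _ (hb u hu)
    | add a b ha hb =>
      intro u hu
      rw [map_add, add_mul]
      exact add _ _ (ha u hu) (hb u hu)
  obtain ⟨t, rfl⟩ := RingQuot.mkAlgHom_surjective ℂ (EnvRel g) u
  have := key t 1 one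
  rwa [mul_one] at this

theorem parity_envAct (φ : LieSuperModule g M) (u : Env g) (x : M) :
    parity (envAct φ u x) = envAct φ (parity u) (parity x) := by
  induction u using Env.induction generalizing x with
  | one =>
    have h : (parity (1 : Env g) : Env g) = 1 := map_one Env.parityHom
    rw [h, map_one, Module.End.one_apply, Module.End.one_apply]
  | smul c u hu => simp only [map_smul, LinearMap.smul_apply, hu]
  | add u w hu hw => simp only [map_add, LinearMap.add_apply, hu, hw]
  | mul y u hu =>
    rw [Env.parity_mul, Env.parity_ι, map_mul, map_mul, Module.End.mul_apply,
      Module.End.mul_apply, envAct_ι, envAct_ι, ← hu]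
    have h : ∀ p, parity (φ.act (part p y) (envAct φ u x)) =
        φ.act (parity (part p y)) (parity (envAct φ u x)) := by
      intro p
      rw [isHom_end_iff.1 (φ.act_hom (part_isHom p y)), show parity (part p y) = sg p • part p y
        from part_isHom p y, map_smul, LinearMap.smul_apply]
    have h01 := part_add_part y
    rw [← h01]
    simp only [map_add, LinearMap.add_apply, h]

end EnvelopingAction

section KacTop

variable {m n : ℕ} {U : Type*} [AddCommGroup U] [Module ℂ U]
  (σ : GLEven m n →ₗ⁅ℂ⁆ Module.End ℂ U)

theorem Kac.mk_mul_upper (u : Env (GLSuper m n)) (X : GLEven m n)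
    (Z : Matrix (Fin m) (Fin n) ℂ) (x : U) :
    Kac.mk σ (u * Env.ι (upper X Z)) x = Kac.mk σ u (σ X x) :=
  (Submodule.Quotient.eq (kacRel σ)).2 (Submodule.subset_span ⟨u, X, Z, x, rfl⟩)

/-- The inclusion of `U` as the top layer `1 ⊗ U` of the Kac module. -/
def Kac.top : U →ₗ[ℂ] Kac σ := (kacRel σ).mkQ ∘ₗ TensorProduct.mk ℂ _ _ 1

theorem Kac.top_apply (x : U) : Kac.top σ x = Kac.mk σ 1 x := rfl

theorem Kac.act_upper_top (X : GLEven m n) (Z : Matrix (Fin m) (Fin n) ℂ) (x : U) :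
    (Kac.module σ).act (upper X Z) (Kac.top σ x) = Kac.top σ (σ X x) := by
  rw [Kac.top_apply, Kac.top_apply, ← Kac.mk_mul_upper σ 1 X Z x, one_mul]
  change Kac.op σ _ _ = _
  rw [Kac.op_mk, mul_one]

/-- The Kac module is generated by its top layer. -/
theorem Kac.eq_top_of_le {N : Submodule ℂ (Kac σ)}
    (hN : ∀ x, ∀ v ∈ N, (Kac.module σ).act x v ∈ N) (h : LinearMap.range (Kac.top σ) ≤ N) :
    N = ⊤ := by
  rw [eq_top_iff]
  intro w hw
  clear hw
  induction w using Kac.induction with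
  | zero => exact N.zero_mem
  | add x y hx hy => exact N.add_mem hx hy
  | mk u x =>
    induction u using Env.induction with
    | one => exact h ⟨x, rfl⟩
    | smul c u hu => rw [Kac.mk_smul]; exact N.smul_mem _ hu
    | add u w hu hw => rw [Kac.mk_add]; exact N.add_mem hu hw
    | mul y u hu => exact hN y _ hu

theorem unitMat_inl (i i' : Fin m) :
    (unitMat (Sum.inl i) (Sum.inl i') : GLSuper m n) = upper (Matrix.single i i' 1, 0) 0 := by
  ext (a | a) (b | b) <;> simp [unitMat, upper, Matrix.single_apply]

theorem unitMat_inr (j j' : Fin n) :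
    (unitMat (Sum.inr j) (Sum.inr j') : GLSuper m n) = upper (0, Matrix.single j j' 1) 0 := by
  ext (a | a) (b | b) <;> simp [unitMat, upper, Matrix.single_apply]

theorem unitMat_raise (i : Fin m) (j : Fin n) :
    (unitMat (Sum.inl i) (Sum.inr j) : GLSuper m n) = upper 0 (Matrix.single i j 1) := by
  ext (a | a) (b | b) <;> simp [unitMat, upper, Matrix.single_apply]

theorem sum_unitMat_inl :
    ∑ i, (unitMat (Sum.inl i) (Sum.inl i) : GLSuper m n) = upper (1, 0) 0 := by
  simp only [unitMat]
  ext (a | a) (b | b) <;>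
    simp [upper, Matrix.single_apply, Matrix.sum_apply, Matrix.one_apply, ite_and]

theorem gradOp_eq {M : Type*} [AddCommGroup M] [Module ℂ M] [SuperSpace M]
    (φ : LieSuperModule (GLSuper m n) M) : gradOp φ = φ.act (upper (1, 0) 0) := by
  rw [← sum_unitMat_inl, map_sum]
  rfl

theorem Kac.isTopLayer {c : ℂ} (hc : ∀ x, σ (1, 0) x = c • x) :
    IsTopLayer (Kac.module σ) (LinearMap.range (Kac.top σ)) c where
  parity_mem := by
    rintro _ ⟨x, rfl⟩
    refine ⟨x, ?_⟩
    rw [Kac.top_apply, Kac.parity_mk]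
    congr 1
    exact (map_one Env.parityHom).symm
  even_mem := by
    rintro (a | a) (b | b) hab _ ⟨x, rfl⟩
    · rw [unitMat_inl, Kac.act_upper_top]; exact ⟨_, rfl⟩
    · simp [ip] at hab
    · simp [ip] at hab
    · rw [unitMat_inr, Kac.act_upper_top]; exact ⟨_, rfl⟩
  raise := by
    rintro i j _ ⟨x, rfl⟩
    rw [unitMat_raise, Kac.act_upper_top, map_zero, LinearMap.zero_apply, map_zero]
  grade := by
    rintro _ ⟨x, rfl⟩
    rw [Module.End.mem_eigenspace_iff, gradOp_eq, Kac.act_upper_top, hc, map_smul]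

theorem Kac.lowerSpan_eq_top {c : ℂ} (hc : ∀ x, σ (1, 0) x = c • x) :
    lowerSpan (Kac.module σ) (LinearMap.range (Kac.top σ)) = ⊤ :=
  Kac.eq_top_of_le σ (Kac.isTopLayer σ hc).isGradedSub.act_mem le_lowerSpan

variable {M : Type*} [AddCommGroup M] [Module ℂ M] [SuperSpace M]
  (φ : LieSuperModule (GLSuper m n) M)

/-- The homomorphism from the Kac module induced by a map `j : U → M` that is equivariant for
`𝔤𝔩(m,n)₀ ⊕ 𝔤𝔩(m,n)₁`. -/
def Kac.lift (j : U →ₗ[ℂ] M) (hj : ∀ X Z x, φ.act (upper X Z) (j x) = j (σ X x)) :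
    Kac σ →ₗ[ℂ] M :=
  (kacRel σ).liftQ (TensorProduct.lift ((envAct φ).toLinearMap.compl₂ j)) (by
    refine Submodule.span_le.2 ?_
    rintro _ ⟨u, X, Z, x, rfl⟩
    change TensorProduct.lift _ _ = 0
    rw [map_sub, TensorProduct.lift.tmul, TensorProduct.lift.tmul]
    change envAct φ (u * Env.ι (upper X Z)) (j x) - envAct φ u (j (σ X x)) = 0
    rw [map_mul, Module.End.mul_apply, envAct_ι, hj, sub_self])

variable {φ} {j : U →ₗ[ℂ] M} (hj : ∀ X Z x, φ.act (upper X Z) (j x) = j (σ X x))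

theorem Kac.lift_mk (u : Env (GLSuper m n)) (x : U) :
    Kac.lift σ φ j hj (Kac.mk σ u x) = envAct φ u (j x) := rfl

theorem Kac.lift_top (x : U) : Kac.lift σ φ j hj (Kac.top σ x) = j x := by
  rw [Kac.top_apply, Kac.lift_mk, map_one, Module.End.one_apply]

theorem Kac.lift_act (y : GLSuper m n) (w : Kac σ) :
    Kac.lift σ φ j hj ((Kac.module σ).act y w) = φ.act y (Kac.lift σ φ j hj w) := by
  induction w using Kac.induction with
  | zero => simp only [map_zero]
  | add w w' hw hw' => simp only [map_add, hw, hw']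
  | mk u x =>
    change Kac.lift σ φ j hj (Kac.op σ y _) = _
    rw [Kac.op_mk, Kac.lift_mk, Kac.lift_mk, map_mul, envAct_ι, Module.End.mul_apply]

theorem Kac.lift_parity (hpar : ∀ x, parity (j x) = j x) (w : Kac σ) :
    Kac.lift σ φ j hj (parity w) = parity (Kac.lift σ φ j hj w) := by
  induction w using Kac.induction with
  | zero => simp only [map_zero]
  | add w w' hw hw' => simp only [map_add, hw, hw']
  | mk u x => rw [Kac.parity_mk, Kac.lift_mk, Kac.lift_mk, parity_envAct, hpar]

/-- A simple module with an even, injectively embedded copy of `U` that is killed by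
`𝔤𝔩(m,n)₁` and on which the grading element acts by a scalar is the simple top of the Kac module
of `U`. -/
theorem isomorphic_LModule [Nontrivial U] (hsimple : IsGradedSimple φ.act)
    (hinj : Function.Injective j) (hj : ∀ X Z x, φ.act (upper X Z) (j x) = j (σ X x))
    (hpar : ∀ x, parity (j x) = j x) {c : ℂ} (hc : ∀ x, gradOp φ (j x) = c • j x) :
    φ.Isomorphic (LModule σ) := by
  have hc' : ∀ x, σ (1, 0) x = c • x := fun x => hinj (by
    rw [← hj _ 0, ← gradOp_eq, hc, map_smul])
  have hB := Kac.isTopLayer σ hc'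
  set π := Kac.lift σ φ j hj with hπ
  obtain ⟨x₀, hx₀⟩ := exists_ne (0 : U)
  have hjx₀ : j x₀ ≠ 0 := fun h => hx₀ (hinj (by rw [h, map_zero]))
  -- images of graded submodules under `π` are graded submodules, so `π` is surjective on each
  -- graded submodule that it does not kill
  have himg : ∀ N : Submodule ℂ (Kac σ), IsGradedSub (Kac.module σ).act N → ¬ N ≤ LinearMap.ker π →
      N.map π = ⊤ := by
    intro N hN hne
    refine (hsimple.2 (N.map π) ⟨?_, ?_⟩).resolve_left fun h => hne ?_
    · rintro _ ⟨w, hw, rfl⟩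
      exact ⟨parity w, hN.parity_mem w hw, Kac.lift_parity σ hj hpar w⟩
    · rintro y _ ⟨w, hw, rfl⟩
      exact ⟨_, hN.act_mem y w hw, Kac.lift_act σ hj y w⟩
    · exact LinearMap.le_ker_iff_map.2 h
  have hker : IsGradedSub (Kac.module σ).act (LinearMap.ker π) := by
    constructor
    · intro w hw
      rw [LinearMap.mem_ker] at *
      rw [hπ, Kac.lift_parity σ hj hpar, ← hπ, hw, map_zero]
    · intro y w hw
      rw [LinearMap.mem_ker] at *
      rw [hπ, Kac.lift_act, ← hπ, hw, map_zero]
  have hnotker : ¬ (⊤ : Submodule ℂ (Kac σ)) ≤ LinearMap.ker π := fun h =>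
    hjx₀ (by rw [← Kac.lift_top σ hj]; exact h trivial)
  have hsurj : Function.Surjective π := by
    rw [← LinearMap.range_eq_top, LinearMap.range_eq_map]
    exact himg ⊤ ⟨fun _ _ => trivial, fun _ _ _ => trivial⟩ hnotker
  have hrad : (Kac.module σ).radical = LinearMap.ker π := by
    refine le_antisymm (sSup_le ?_) (le_sSup ⟨hker, fun h => hnotker h.ge⟩)
    rintro N ⟨hN, hNtop⟩
    by_contra hle
    refine hNtop (Kac.eq_top_of_le σ hN.act_mem ?_)
    rintro _ ⟨x, rfl⟩
    obtain ⟨y, hy, hyx⟩ : j x ∈ N.map π := by rw [himg N hN hle]; trivial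
    -- the component of `y` in the top layer lies in `N` and is mapped to `j x`
    obtain ⟨b, ⟨x', rfl⟩, r, hr, rfl⟩ := Submodule.mem_sup.1
      (hB.lowerSpan_le_sup ((Kac.lowerSpan_eq_top σ hc').ge (Submodule.mem_top (x := y))))
    have hgN : ∀ v ∈ N, gradOp (Kac.module σ) v ∈ N := fun v hv => by
      rw [gradOp_eq]; exact hN.act_mem _ v hv
    have hbN := mem_of_add_mem_of_eigenspace hgN (hB.grade ⟨x', rfl⟩) hr hy
    have hmap : ∀ μ, ((gradOp (Kac.module σ)).eigenspace μ).map π ≤ (gradOp φ).eigenspace μ := by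
      rintro μ _ ⟨w, hw, rfl⟩
      rw [SetLike.mem_coe, Module.End.mem_eigenspace_iff] at hw
      rw [Module.End.mem_eigenspace_iff, gradOp_eq, hπ, ← Kac.lift_act, ← gradOp_eq, hw, map_smul]
    have hr' : π r ∈ ⨆ μ ≠ c, (gradOp φ).eigenspace μ := by
      have := Submodule.mem_map_of_mem (f := π) hr
      simp only [Submodule.map_iSup] at this
      exact (iSup₂_mono fun μ _ => hmap μ) this
    rw [map_add, hπ, Kac.lift_top, ← hπ] at hyx
    have hr'' : π r = j (x - x') := by rw [map_sub, ← hyx, add_sub_cancel_left]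
    have hxx : j (x - x') = 0 := Submodule.disjoint_def.1 ((gradOp φ).eigenspaces_iSupIndep c) _
      (Module.End.mem_eigenspace_iff.2 (hc _)) (hr'' ▸ hr')
    have : x = x' := sub_eq_zero.1 (hinj (by rw [hxx, map_zero]))
    rw [this]
    exact hbN
  let e : LTop σ ≃ₗ[ℂ] M :=
    (Submodule.quotEquivOfEq _ _ hrad).trans (π.quotKerEquivOfSurjective hsurj)
  have he : ∀ w, e ((Kac.module σ).topMk w) = π w := fun w => rfl
  refine ⟨e.symm, fun v => ?_, fun y v => ?_⟩
  · obtain ⟨w, rfl⟩ := hsurj v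
    rw [e.symm_apply_eq, ← he w, e.symm_apply_apply, LieSuperModule.parity_topMk, he, he, hπ,
      Kac.lift_parity σ hj hpar]
  · obtain ⟨w, rfl⟩ := hsurj v
    rw [e.symm_apply_eq, ← he w, e.symm_apply_apply]
    change φ.act y _ = e ((Kac.module σ).topOp y _)
    rw [LieSuperModule.topOp_topMk, he, he, hπ, Kac.lift_act]

end KacTop

/-! ### Simple modules over a product of two Lie algebras -/

section Burnside

variable {W : Type*} [AddCommGroup W] [Module ℂ W] [FiniteDimensional ℂ W]

/-- **Burnside's theorem**: an irreducible set of operators on a finite-dimensional complex vector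
space generates the whole endomorphism algebra. -/
theorem adjoin_eq_top_of_irreducible [Nontrivial W] (S : Set (Module.End ℂ W))
    (hS : ∀ N : Submodule ℂ W, (∀ s ∈ S, ∀ v ∈ N, s v ∈ N) → N = ⊥ ∨ N = ⊤) :
    Algebra.adjoin ℂ S = ⊤ := by
  set R := Algebra.adjoin ℂ S with hR
  have : IsSimpleModule R W := by
    rw [isSimpleModule_iff]
    refine IsSimpleOrder.of_forall_eq_top fun N hN => ?_
    have h := hS (N.restrictScalars ℂ) fun s hs v hv =>
      N.smul_mem (⟨s, Algebra.subset_adjoin hs⟩ : R) hv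
    refine (Submodule.restrictScalars_eq_top_iff ℂ R W).1 (h.resolve_left fun h => hN ?_)
    exact (Submodule.restrictScalars_eq_bot_iff ℂ R W).1 h
  rw [eq_top_iff]
  intro f _
  -- by Schur's lemma every endomorphism of the simple module is a scalar, so `f` commutes with it
  let f' : Module.End (Module.End R W) W :=
    { toFun := f
      map_add' := map_add f
      map_smul' := by
        intro e w
        obtain ⟨c, rfl⟩ := (IsSimpleModule.algebraMap_end_bijective_of_isAlgClosed (A := R)
          (V := W) ℂ).2 e
        exact map_smul f c w }
  obtain ⟨s, hs⟩ := (Module.Finite.fg_top : (⊤ : Submodule ℂ W).FG)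
  obtain ⟨r, hr⟩ := jacobson_density (R := R) f' s
  have : f = r := by
    refine LinearMap.ext_on_range (v := fun x : s => (x : W)) ?_ fun x => hr x x.2
    simpa using hs
  rw [this]
  exact r.2

end Burnside

section Outer

/-- The restriction of a representation to an invariant subspace. -/
def restrictLie {L V : Type*} [LieRing L] [LieAlgebra ℂ L] [AddCommGroup V] [Module ℂ V]
    (a : L →ₗ⁅ℂ⁆ Module.End ℂ V) (N : Submodule ℂ V) (h : ∀ x, ∀ v ∈ N, a x v ∈ N) :
    L →ₗ⁅ℂ⁆ Module.End ℂ N where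
  toFun x := (a x).restrict (h x)
  map_add' x y := by ext v; simp
  map_smul' c x := by ext v; simp
  map_lie' {x y} := by ext v; simp [LieRing.of_associative_ring_bracket]

/-- Composition with a representation on the target, as a representation on a space of linear
maps. -/
def postLie {L V₁ V : Type*} [LieRing L] [LieAlgebra ℂ L] [AddCommGroup V] [Module ℂ V]
    [AddCommGroup V₁] [Module ℂ V₁] (a : L →ₗ⁅ℂ⁆ Module.End ℂ V) :
    L →ₗ⁅ℂ⁆ Module.End ℂ (V₁ →ₗ[ℂ] V) where
  toFun x := LinearMap.llcomp ℂ V₁ V V (a x)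
  map_add' x y := by ext f v; simp
  map_smul' c x := by ext f v; simp
  map_lie' {x y} := by ext f v; simp [LieRing.of_associative_ring_bracket]

theorem exists_minimal_invariant {V κ : Type*} [AddCommGroup V] [Module ℂ V]
    (T : κ → Module.End ℂ V) (Y : Submodule ℂ V) [FiniteDimensional ℂ Y] (hY : Y ≠ ⊥)
    (hinv : ∀ k, ∀ v ∈ Y, T k v ∈ Y) :
    ∃ N : Submodule ℂ V, FiniteDimensional ℂ N ∧ N ≠ ⊥ ∧ (∀ k, ∀ v ∈ N, T k v ∈ N) ∧
      ∀ N' ≤ N, (∀ k, ∀ v ∈ N', T k v ∈ N') → N' = ⊥ ∨ N' = N := by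
  have hwf : ∃ d, ∃ N : Submodule ℂ V, FiniteDimensional ℂ N ∧ N ≠ ⊥ ∧
      (∀ k, ∀ v ∈ N, T k v ∈ N) ∧ Module.finrank ℂ N = d := ⟨_, Y, inferInstance, hY, hinv, rfl⟩
  classical
  obtain ⟨N, hfd, hN, hNinv, hd⟩ := Nat.find_spec hwf
  refine ⟨N, hfd, hN, hNinv, fun N' hle hinv' => ?_⟩
  by_contra! hcon
  have : FiniteDimensional ℂ N' := Submodule.finiteDimensional_of_le hle
  have h1 : Module.finrank ℂ N' < Module.finrank ℂ N :=
    Submodule.finrank_lt_finrank_of_lt (lt_of_le_of_ne hle hcon.2)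
  exact Nat.find_min hwf (hd ▸ h1) ⟨N', this, hcon.1, hinv', rfl⟩

variable {m n : ℕ} {V : Type v} [AddCommGroup V] [Module ℂ V]

/-- A simple `𝔤𝔩ₘ ⊕ 𝔤𝔩ₙ`-module with a nonzero finite-dimensional `𝔤𝔩ₘ`-stable subspace is the outer
tensor product of a finite-dimensional simple `𝔤𝔩ₘ`-module `V₁` and a simple `𝔤𝔩ₙ`-module. The
second factor is the space of `𝔤𝔩ₘ`-homomorphisms from `V₁`, and the evaluation map is injective by
Burnside's theorem. -/
theorem exists_outerTensor (σ : GLEven m n →ₗ⁅ℂ⁆ Module.End ℂ V)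
    (hirr : ∀ N : Submodule ℂ V, (∀ X, ∀ v ∈ N, σ X v ∈ N) → N = ⊥ ∨ N = ⊤)
    (Y : Submodule ℂ V) [FiniteDimensional ℂ Y] (hY : Y ≠ ⊥)
    (hYinv : ∀ x, ∀ v ∈ Y, σ (x, 0) v ∈ Y) :
    ∃ (V₁ V₂ : Type v)
      (_ : AddCommGroup V₁) (_ : Module ℂ V₁) (_ : LieRingModule (Matrix (Fin m) (Fin m) ℂ) V₁)
      (_ : LieModule ℂ (Matrix (Fin m) (Fin m) ℂ) V₁)
      (_ : AddCommGroup V₂) (_ : Module ℂ V₂) (_ : LieRingModule (Matrix (Fin n) (Fin n) ℂ) V₂)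
      (_ : LieModule ℂ (Matrix (Fin n) (Fin n) ℂ) V₂),
      FiniteDimensional ℂ V₁ ∧ LieModule.IsIrreducible ℂ (Matrix (Fin m) (Fin m) ℂ) V₁ ∧
      LieModule.IsIrreducible ℂ (Matrix (Fin n) (Fin n) ℂ) V₂ ∧
      ∃ e : (V₁ ⊗[ℂ] V₂) ≃ₗ[ℂ] V, ∀ X t, e (outerTensor m n V₁ V₂ X t) = σ X (e t) := by
  let σ₁ : Matrix (Fin m) (Fin m) ℂ →ₗ⁅ℂ⁆ Module.End ℂ V := σ.comp (LieHom.inl ℂ _ _)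
  let σ₂ : Matrix (Fin n) (Fin n) ℂ →ₗ⁅ℂ⁆ Module.End ℂ V := σ.comp (LieHom.inr ℂ _ _)
  have hσ : ∀ X v, σ X v = σ₁ X.1 v + σ₂ X.2 v := by
    intro X v
    rw [← LinearMap.add_apply]
    change _ = (σ (X.1, 0) + σ (0, X.2)) v
    rw [← map_add]
    simp
  have hcomm : ∀ x y v, σ₁ x (σ₂ y v) = σ₂ y (σ₁ x v) := by
    intro x y v
    have h : ⁅σ (x, 0), σ (0, y)⁆ = 0 := by
      rw [← LieHom.map_lie]
      have : ⁅((x, 0) : GLEven m n), ((0, y) : GLEven m n)⁆ = 0 :=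
        Prod.ext (lie_zero x) (zero_lie y)
      rw [this, map_zero]
    have := LinearMap.congr_fun h v
    exact sub_eq_zero.1 this
  obtain ⟨V₁, hfd, hV₁, hV₁inv, hV₁min⟩ := exists_minimal_invariant (fun x => σ₁ x) Y hY hYinv
  have hnt : Nontrivial V₁ := Submodule.nontrivial_iff_ne_bot.2 hV₁
  let a := restrictLie σ₁ V₁ hV₁inv
  have ha : ∀ x (v : V₁), (a x v : V) = σ₁ x v := fun x v => rfl
  have hairr : ∀ N : Submodule ℂ V₁, (∀ x, ∀ v ∈ N, a x v ∈ N) → N = ⊥ ∨ N = ⊤ := by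
    intro N hN
    rcases hV₁min (N.map V₁.subtype) (Submodule.map_subtype_le _ _) (by
      rintro x _ ⟨v, hv, rfl⟩; exact ⟨a x v, hN x v hv, rfl⟩) with h | h
    · left
      exact (Submodule.map_injective_of_injective V₁.injective_subtype)
        (by rw [h, Submodule.map_bot])
    · right
      refine Submodule.map_injective_of_injective V₁.injective_subtype ?_
      rw [h, Submodule.map_top, Submodule.range_subtype]
  have hburn := adjoin_eq_top_of_irreducible (Set.range a) (by
    intro N hN
    exact hairr N fun x v hv => hN _ ⟨x, rfl⟩ v hv)
  -- the multiplicity space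
  let V₂ : Submodule ℂ (V₁ →ₗ[ℂ] V) :=
    { carrier := {f | ∀ x v, f (a x v) = σ₁ x (f v)}
      zero_mem' := by intro x v; simp
      add_mem' := by intro f g hf hg x v; simp [hf x v, hg x v]
      smul_mem' := by intro c f hf x v; simp [hf x v] }
  have hV₂ : ∀ f : V₂, ∀ x v, f.1 (a x v) = σ₁ x (f.1 v) := fun f => f.2
  let b := restrictLie (postLie (V₁ := V₁) σ₂) V₂ (by
    intro y f hf x v
    change σ₂ y (f (a x v)) = σ₁ x (σ₂ y (f v))
    rw [hf x v, hcomm])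
  have hb : ∀ y (f : V₂) v, (b y f).1 v = σ₂ y (f.1 v) := fun y f v => rfl
  let ev : V₁ ⊗[ℂ] V₂ →ₗ[ℂ] V := TensorProduct.lift (LinearMap.flip V₂.subtype)
  have hev : ∀ v (f : V₂), ev (v ⊗ₜ f) = f.1 v := fun v f => rfl
  have hev₁ : ∀ x t, ev (LinearMap.rTensor V₂ (a x) t) = σ₁ x (ev t) := by
    intro x t
    induction t using TensorProduct.induction_on with
    | zero => simp
    | add s t hs ht => simp only [map_add, hs, ht]
    | tmul v f => rw [LinearMap.rTensor_tmul, hev, hev, hV₂]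
  have hev₂ : ∀ y t, ev (LinearMap.lTensor V₁ (b y) t) = σ₂ y (ev t) := by
    intro y t
    induction t using TensorProduct.induction_on with
    | zero => simp
    | add s t hs ht => simp only [map_add, hs, ht]
    | tmul v f => rw [LinearMap.lTensor_tmul, hev, hev, hb]
  have hinj : Function.Injective ev := by
    rw [← LinearMap.ker_eq_bot, Submodule.eq_bot_iff]
    have hker : ∀ (r : Module.End ℂ V₁) (t : V₁ ⊗[ℂ] V₂), ev t = 0 →
        ev (LinearMap.rTensor V₂ r t) = 0 := by
      intro r
      have hr : r ∈ Algebra.adjoin ℂ (Set.range a) := by rw [hburn]; trivial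
      induction hr using Algebra.adjoin_induction with
      | mem r h => obtain ⟨x, rfl⟩ := h; intro t ht; rw [hev₁, ht, map_zero]
      | algebraMap c =>
        intro t ht
        rw [Algebra.algebraMap_eq_smul_one, LinearMap.rTensor_smul, LinearMap.smul_apply,
          Module.End.one_eq_id, LinearMap.rTensor_id, LinearMap.id_apply, map_smul, ht, smul_zero]
      | add r s _ _ hr hs =>
        intro t ht
        rw [LinearMap.rTensor_add, LinearMap.add_apply, map_add, hr t ht, hs t ht, add_zero]
      | mul r s _ _ hr hs =>
        intro t ht
        rw [LinearMap.rTensor_mul, Module.End.mul_apply]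
        exact hr _ (hs t ht)
    intro t ht
    let B := Module.finBasis ℂ V₁
    obtain ⟨f, rfl⟩ := TensorProduct.eq_repr_basis_left B t
    have hf : ∀ i, f i = 0 := by
      intro i
      refine Subtype.ext (LinearMap.ext fun w => ?_)
      -- a rank one operator isolates the summand with index `i`
      have h := hker ((B.coord i).smulRight w) _ ht
      rw [Finsupp.sum, map_sum, map_sum, Finset.sum_eq_single i] at h
      · simpa [hev] using h
      · intro k _ hk
        simp [Finsupp.single_eq_of_ne hk.symm]
      · intro hi
        rw [Finsupp.notMem_support_iff.1 hi]
        simp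
    rw [Finsupp.sum]
    exact Finset.sum_eq_zero fun i _ => by rw [hf i, TensorProduct.tmul_zero]
  have hrange : ∀ N : Submodule ℂ V₂, (∀ y, ∀ f ∈ N, b y f ∈ N) → N ≠ ⊥ →
      LinearMap.range (ev ∘ₗ LinearMap.lTensor V₁ N.subtype) = ⊤ := by
    intro N hN hne
    refine (hirr _ ?_).resolve_left fun h => hne ?_
    · rintro X _ ⟨t, rfl⟩
      induction t using TensorProduct.induction_on with
      | zero => rw [map_zero, map_zero]; exact zero_mem _
      | add s t hs ht => rw [map_add, map_add]; exact add_mem hs ht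
      | tmul v f =>
        rw [hσ]
        refine add_mem ⟨a X.1 v ⊗ₜ f, ?_⟩ ⟨v ⊗ₜ ⟨b X.2 f, hN _ _ f.2⟩, ?_⟩
        · exact hV₂ _ _ _
        · rfl
    · rw [LinearMap.range_eq_bot] at h
      rw [Submodule.eq_bot_iff]
      intro f hf
      refine Subtype.ext (LinearMap.ext fun v => ?_)
      exact LinearMap.congr_fun h (v ⊗ₜ ⟨f, hf⟩)
  have hV₂nt : (⊤ : Submodule ℂ V₂) ≠ ⊥ := by
    intro h
    obtain ⟨v, hv⟩ := exists_ne (0 : V₁)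
    have hmem : V₁.subtype ∈ V₂ := fun x v => rfl
    have : (⟨V₁.subtype, hmem⟩ : V₂) = 0 := (Submodule.mem_bot ℂ).1 (h ▸ Submodule.mem_top)
    exact hv (Subtype.ext (LinearMap.congr_fun (congrArg Subtype.val this) v))
  have hsurj : Function.Surjective ev := by
    rw [← LinearMap.range_eq_top, eq_top_iff, ← hrange ⊤ (fun _ _ _ => trivial) hV₂nt]
    exact LinearMap.range_comp_le_range _ _
  let i1 : LieRingModule (Matrix (Fin m) (Fin m) ℂ) V₁ := LieRingModule.compLieHom V₁ a
  let i2 : LieModule ℂ (Matrix (Fin m) (Fin m) ℂ) V₁ := LieModule.compLieHom V₁ a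
  let i3 : LieRingModule (Matrix (Fin n) (Fin n) ℂ) V₂ := LieRingModule.compLieHom V₂ b
  let i4 : LieModule ℂ (Matrix (Fin n) (Fin n) ℂ) V₂ := LieModule.compLieHom V₂ b
  refine ⟨V₁, V₂, inferInstance, inferInstance, i1, i2, inferInstance, inferInstance, i3, i4,
    hfd, ?_, ?_, LinearEquiv.ofBijective ev ⟨hinj, hsurj⟩, ?_⟩
  · refine LieModule.IsIrreducible.mk fun N hN => ?_
    have := (hairr N.toSubmodule fun x v hv => N.lie_mem (x := x) hv).resolve_left
      fun h => hN ((LieSubmodule.toSubmodule_eq_bot N).1 h)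
    exact (LieSubmodule.toSubmodule_eq_top N).1 this
  · have : Nontrivial V₂ := (Submodule.nontrivial_iff ℂ).1 ⟨⊤, ⊥, hV₂nt⟩
    refine LieModule.IsIrreducible.mk fun N hN => ?_
    have h := hrange N.toSubmodule (fun y f hf => N.lie_mem (x := y) hf)
      fun h => hN ((LieSubmodule.toSubmodule_eq_bot N).1 h)
    have h' : Function.Surjective (LinearMap.lTensor V₁ N.toSubmodule.subtype) := by
      intro t
      obtain ⟨s, hs⟩ := LinearMap.range_eq_top.1 h (ev t)
      exact ⟨s, hinj hs⟩
    rw [Module.FaithfullyFlat.lTensor_surjective_iff_surjective] at h'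
    refine (LieSubmodule.toSubmodule_eq_top N).1 ?_
    rw [← Submodule.range_subtype N.toSubmodule]
    exact LinearMap.range_eq_top.2 h'
  · intro X t
    change ev (LinearMap.rTensor V₂ (a X.1) t + LinearMap.lTensor V₁ (b X.2) t) = σ X (ev t)
    rw [map_add, hev₁, hev₂, hσ]

end Outer

/-! ### Weights of finite-dimensional `𝔤𝔩ₖ`-modules -/

section FiniteDimensionalWeights

theorem exists_common_eigenvector {ι W : Type*} [AddCommGroup W] [Module ℂ W]
    [FiniteDimensional ℂ W] [Nontrivial W] (h : ι → Module.End ℂ W)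
    (hcomm : ∀ i k v, h i (h k v) = h k (h i v)) (s : Finset ι) :
    ∃ (μ : ι → ℂ) (v : W), v ≠ 0 ∧ ∀ i ∈ s, h i v = μ i • v := by
  classical
  induction s using Finset.induction_on with
  | empty =>
    obtain ⟨v, hv⟩ := exists_ne (0 : W)
    exact ⟨0, v, hv, by simp⟩
  | insert a s ha ih =>
    obtain ⟨μ, v, hv, hμ⟩ := ih
    let N : Submodule ℂ W := ⨅ i ∈ s, (h i).eigenspace (μ i)
    have hN : ∀ w, w ∈ N ↔ ∀ i ∈ s, h i w = μ i • w := by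
      intro w; simp [N]
    have hinv : ∀ w ∈ N, h a w ∈ N := by
      intro w hw
      rw [hN] at *
      intro i hi
      rw [hcomm, hw i hi, map_smul]
    have : Nontrivial N := ⟨⟨v, (hN v).2 hμ⟩, 0, fun e => hv (congrArg Subtype.val e)⟩
    obtain ⟨c, hc⟩ := Module.End.exists_eigenvalue ((h a).restrict hinv)
    obtain ⟨w, hw⟩ := hc.exists_hasEigenvector
    refine ⟨Function.update μ a c, w, fun e => hw.2 (Subtype.ext e), fun i hi => ?_⟩
    rcases Finset.mem_insert.1 hi with rfl | hi
    · rw [Function.update_self]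
      exact congrArg Subtype.val hw.apply_eq_smul
    · rw [Function.update_of_ne (fun e : i = a => ha (e ▸ hi))]
      exact (hN w).1 w.2 i hi

variable {k : ℕ} {V : Type*} [AddCommGroup V] [Module ℂ V]
  [LieRingModule (Matrix (Fin k) (Fin k) ℂ) V] [LieModule ℂ (Matrix (Fin k) (Fin k) ℂ) V]

theorem glCartan_apply (i : Fin k) (v : V) :
    glCartan k V i v = ⁅(Matrix.single i i 1 : Matrix (Fin k) (Fin k) ℂ), v⁆ := rfl

theorem glCartan_lie_single (l i j : Fin k) (v : V) :
    glCartan k V l ⁅(Matrix.single i j 1 : Matrix (Fin k) (Fin k) ℂ), v⁆ =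
      ⁅(Matrix.single i j 1 : Matrix (Fin k) (Fin k) ℂ), glCartan k V l v⁆ +
      ((if l = i then 1 else 0) - (if l = j then 1 else 0) : ℂ) •
        ⁅(Matrix.single i j 1 : Matrix (Fin k) (Fin k) ℂ), v⁆ := by
  rw [glCartan_apply, glCartan_apply, leibniz_lie, add_comm, ← smul_lie]
  congr 2
  rw [LieRing.of_associative_ring_bracket, sub_smul]
  congr 1
  · split_ifs with h
    · subst h; simp
    · simp [h]
  · split_ifs with h
    · subst h; simp
    · simp [Ne.symm h]

/-- A finite-dimensional simple `𝔤𝔩_k`-module is a weight module. -/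
theorem isWeight_glCartan [FiniteDimensional ℂ V]
    [hirr : LieModule.IsIrreducible ℂ (Matrix (Fin k) (Fin k) ℂ) V] :
    IsWeight (glCartan k V) := by
  have : Nontrivial V := LieModule.nontrivial_of_isIrreducible ℂ (Matrix (Fin k) (Fin k) ℂ) V
  have hcomm : ∀ i l v, glCartan k V i (glCartan k V l v) = glCartan k V l (glCartan k V i v) := by
    intro i l v
    have h := glCartan_lie_single (V := V) i l l v
    rw [sub_self, zero_smul, add_zero] at h
    exact h
  obtain ⟨μ, v, hv, hμ⟩ := exists_common_eigenvector (glCartan k V) hcomm Finset.univ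
  set S : Submodule ℂ V := ⨆ wt, weightSpace (glCartan k V) wt with hS
  have hstab : ∀ i j, S ≤ S.comap
      (LieModule.toEnd ℂ (Matrix (Fin k) (Fin k) ℂ) V (Matrix.single i j 1)) := by
    refine fun i j => iSup_le fun wt w hw => ?_
    refine Submodule.mem_iSup_of_mem
      (fun l => wt l + ((if l = i then 1 else 0) - (if l = j then 1 else 0)))
      (mem_weightSpace.2 fun l => ?_)
    rw [LieModule.toEnd_apply_apply, glCartan_lie_single, mem_weightSpace.1 hw l, lie_smul,
      add_smul]
  let N : LieSubmodule ℂ (Matrix (Fin k) (Fin k) ℂ) V :=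
    { S with
      lie_mem := by
        intro x w hw
        change ⁅x, w⁆ ∈ S
        rw [Matrix.matrix_eq_sum_single x, sum_lie]
        refine S.sum_mem fun i _ => ?_
        rw [sum_lie]
        refine S.sum_mem fun j _ => ?_
        have : Matrix.single i j (x i j) = x i j • (Matrix.single i j 1 : Matrix _ _ ℂ) := by
          rw [Matrix.smul_single, smul_eq_mul, mul_one]
        rw [this, smul_lie]
        exact S.smul_mem _ (hstab i j hw) }
  have hN : N = ⊤ := (hirr.eq_bot_or_eq_top N).resolve_left fun h => hv (by
    have : v ∈ N := Submodule.mem_iSup_of_mem μ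
      (mem_weightSpace.2 fun i => hμ i (Finset.mem_univ i))
    rw [h] at this
    exact (LieSubmodule.mem_bot v).1 this)
  rw [IsWeight, ← hS]
  exact (LieSubmodule.toSubmodule_eq_top N).2 hN

theorem rank_le_natCast_of_injective {W : Type*} [AddCommGroup W] [Module ℂ W] {U : Type*}
    [AddCommGroup U] [Module ℂ U] (f : U →ₗ[ℂ] W) (hf : Function.Injective f) {N : ℕ}
    (hW : Module.rank ℂ W ≤ N) : Module.rank ℂ U ≤ N := by
  have h := LinearMap.lift_rank_le_of_injective f hf
  have h' := h.trans (Cardinal.lift_le.2 hW)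
  rw [Cardinal.lift_natCast] at h'
  exact Cardinal.lift_le_nat_iff.1 h'

theorem rank_map_le_natCast {W : Type*} [AddCommGroup W] [Module ℂ W] {U : Type*}
    [AddCommGroup U] [Module ℂ U] (f : U →ₗ[ℂ] W) (X : Submodule ℂ U) {N : ℕ}
    (hX : Module.rank ℂ X ≤ N) : Module.rank ℂ (X.map f) ≤ N := by
  have h := lift_rank_map_le f X
  have h' := h.trans (Cardinal.lift_le.2 hX)
  rw [Cardinal.lift_natCast] at h'
  exact Cardinal.lift_le_nat_iff.1 h'

end FiniteDimensionalWeights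

/-! ### Simple weight modules over the Weyl superalgebra -/

theorem exists_homogeneous_weight_vector {ι V : Type*} [AddCommGroup V] [Module ℂ V] [SuperSpace V]
    [Nontrivial V] {h : ι → Module.End ℂ V} (hh : ∀ i, IsHom 0 (h i)) (hw : IsWeight h) :
    ∃ (p : ZMod 2) (wt : ι → ℂ) (v : V), v ≠ 0 ∧ v ∈ weightSpace h wt ∧ IsHom p v := by
  obtain ⟨wt, v, hv, hv0⟩ := exists_weight_vector hw
  have hpart : ∀ p, part p v ∈ weightSpace h wt := by
    intro p
    refine mem_weightSpace.2 fun i => ?_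
    have e := isHom_end_iff.1 (hh i) v
    rw [sg_zero, one_smul] at e
    rw [part_apply, map_smul, map_add, map_smul, ← e, mem_weightSpace.1 hv i, map_smul, smul_comm,
      ← smul_add, smul_comm]
  by_cases h0 : part 0 v = 0
  · refine ⟨1, wt, part 1 v, fun h1 => hv0 ?_, hpart 1, part_isHom 1 v⟩
    rw [← part_add_part v, h0, h1, add_zero]
  · exact ⟨0, wt, part 0 v, h0, hpart 0, part_isHom 0 v⟩

section Weyl

variable {m n : ℕ} {P : Type*} [AddCommGroup P] [Module ℂ P] [SuperSpace P] (ρ : WeylModule m n P)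

/-- The action of the variable `x_a`. -/
def WeylModule.var (a : Fin m ⊕ Fin n) : Module.End ℂ P := ρ.act (wmul (gen a))

/-- The action of the partial derivative `∂_a`. -/
def WeylModule.der (a : Fin m ⊕ Fin n) : Module.End ℂ P := ρ.act (wpd a)

namespace WeylModule

theorem cartan_eq (a : Fin m ⊕ Fin n) : ρ.cartan a = ρ.var a * ρ.der a := by
  rw [cartan, map_mul]; rfl

theorem var_hom (a : Fin m ⊕ Fin n) : IsHom (ip a) (ρ.var a) := ρ.act_hom (mulA_hom (gen_hom a))

theorem der_hom (a : Fin m ⊕ Fin n) : IsHom (ip a) (ρ.der a) := ρ.act_hom (pd_hom a)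

theorem cartan_hom (a : Fin m ⊕ Fin n) : IsHom 0 (ρ.cartan a) := by
  rw [cartan_eq, ← CharTwo.add_self_eq_zero (ip a)]
  exact (ρ.var_hom a).mul (ρ.der_hom a)

theorem var_mul_var (a b : Fin m ⊕ Fin n) :
    ρ.var a * ρ.var b = sg (ip a * ip b) • (ρ.var b * ρ.var a) := by
  simp only [var, ← map_mul, ← map_smul]
  rw [A_swap (gen_hom a) (gen_hom b)]

theorem der_mul_der (a b : Fin m ⊕ Fin n) :
    ρ.der a * ρ.der b = sg (ip a * ip b) • (ρ.der b * ρ.der a) := by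
  simp only [der, ← map_mul, ← map_smul]
  congr 1
  exact Subtype.ext (LinearMap.ext fun f => pd_comm a b f)

theorem der_mul_var (a b : Fin m ⊕ Fin n) :
    ρ.der a * ρ.var b = sg (ip a * ip b) • (ρ.var b * ρ.der a) + if a = b then 1 else 0 := by
  have h : (wpd a * wmul (gen b) : weyl m n) =
      sg (ip a * ip b) • (wmul (gen b) * wpd a) + if a = b then 1 else 0 := by
    refine Subtype.ext (LinearMap.ext fun f => ?_)
    have h1 := pd_leibniz a (gen b) f
    rw [twist_hom (gen_hom b), pd_gen, smul_mul_assoc] at h1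
    refine h1.trans ?_
    rw [add_comm]
    split_ifs <;> simp [wmul_coe, mulA_apply] <;> rfl
  simp only [der, var, ← map_mul]
  rw [h, map_add, map_smul]
  congr 1
  split_ifs <;> simp

theorem cartan_var (b a : Fin m ⊕ Fin n) (v : P) :
    ρ.cartan b (ρ.var a v) = ρ.var a (ρ.cartan b v) + if b = a then ρ.var a v else 0 := by
  have h : ρ.cartan b * ρ.var a = ρ.var a * ρ.cartan b + if b = a then ρ.var a else 0 := by
    rw [cartan_eq, mul_assoc, der_mul_var, mul_add, mul_smul_comm, ← mul_assoc, var_mul_var,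
      smul_mul_assoc, smul_smul, mul_comm (ip b), sg_mul_self, one_smul, mul_assoc]
    congr 1
    split_ifs with h <;> simp [h]
  have := LinearMap.congr_fun h v
  rw [Module.End.mul_apply, LinearMap.add_apply, Module.End.mul_apply] at this
  rw [this]
  split_ifs <;> simp

theorem cartan_der (b a : Fin m ⊕ Fin n) (v : P) :
    ρ.cartan b (ρ.der a v) = ρ.der a (ρ.cartan b v) - if b = a then ρ.der a v else 0 := by
  have h : ρ.der a * ρ.cartan b = ρ.cartan b * ρ.der a + if b = a then ρ.der a else 0 := by
    rw [cartan_eq, ← mul_assoc, der_mul_var, add_mul, smul_mul_assoc, mul_assoc, der_mul_der,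
      mul_smul_comm, smul_smul, sg_mul_self, one_smul, ← mul_assoc]
    congr 1
    by_cases h : a = b
    · simp [h]
    · simp [h, Ne.symm h]
  have := LinearMap.congr_fun h v
  rw [Module.End.mul_apply, LinearMap.add_apply, Module.End.mul_apply] at this
  rw [this]
  split_ifs <;> simp

theorem var_mem_weightSpace {μ : Fin m ⊕ Fin n → ℂ} {v : P} (hv : v ∈ weightSpace ρ.cartan μ)
    (a : Fin m ⊕ Fin n) : ρ.var a v ∈ weightSpace ρ.cartan (μ + Pi.single a 1) := by
  refine mem_weightSpace.2 fun b => ?_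
  rw [cartan_var, mem_weightSpace.1 hv b, map_smul, Pi.add_apply, add_smul, Pi.single_apply]
  split_ifs <;> simp

theorem der_mem_weightSpace {μ : Fin m ⊕ Fin n → ℂ} {v : P} (hv : v ∈ weightSpace ρ.cartan μ)
    (a : Fin m ⊕ Fin n) : ρ.der a v ∈ weightSpace ρ.cartan (μ - Pi.single a 1) := by
  refine mem_weightSpace.2 fun b => ?_
  rw [cartan_der, mem_weightSpace.1 hv b, map_smul, Pi.sub_apply, sub_smul, Pi.single_apply]
  split_ifs <;> simp

theorem var_pow_mem_weightSpace {μ : Fin m ⊕ Fin n → ℂ} {v : P} (hv : v ∈ weightSpace ρ.cartan μ)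
    (a : Fin m ⊕ Fin n) (r : ℕ) :
    (ρ.var a ^ r) v ∈ weightSpace ρ.cartan (μ + Pi.single a (r : ℂ)) := by
  induction r with
  | zero => simpa using hv
  | succ r ih =>
    rw [pow_succ', Module.End.mul_apply]
    have := ρ.var_mem_weightSpace ih a
    rwa [add_assoc, ← Pi.single_add, ← Nat.cast_add_one] at this

theorem der_pow_mem_weightSpace {μ : Fin m ⊕ Fin n → ℂ} {v : P} (hv : v ∈ weightSpace ρ.cartan μ)
    (a : Fin m ⊕ Fin n) (r : ℕ) :
    (ρ.der a ^ r) v ∈ weightSpace ρ.cartan (μ - Pi.single a (r : ℂ)) := by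
  induction r with
  | zero => simpa using hv
  | succ r ih =>
    rw [pow_succ', Module.End.mul_apply]
    have := ρ.der_mem_weightSpace ih a
    rwa [sub_sub, ← Pi.single_add, ← Nat.cast_add_one] at this

/-- The `k`-th power of `x_a`, where negative powers stand for powers of `∂_a`. -/
def zpow (a : Fin m ⊕ Fin n) : ℤ → Module.End ℂ P
  | Int.ofNat r => ρ.var a ^ r
  | Int.negSucc r => ρ.der a ^ (r + 1)

theorem zpow_mem_weightSpace {μ : Fin m ⊕ Fin n → ℂ} {v : P} (hv : v ∈ weightSpace ρ.cartan μ)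
    (a : Fin m ⊕ Fin n) (k : ℤ) :
    ρ.zpow a k v ∈ weightSpace ρ.cartan (μ + Pi.single a (k : ℂ)) := by
  cases k with
  | ofNat r => exact ρ.var_pow_mem_weightSpace hv a r
  | negSucc r =>
    have := ρ.der_pow_mem_weightSpace hv a (r + 1)
    rw [sub_eq_add_neg, ← Pi.single_neg] at this
    simpa [zpow, Int.cast_negSucc] using this

/-- On a weight vector `x_a ∂_a` acts by a scalar, so multiplication by `x_a` raises the exponent of
`x_a` by one up to a scalar, also when the exponent is negative. -/
theorem var_zpow {μ : Fin m ⊕ Fin n → ℂ} {v : P} (hv : v ∈ weightSpace ρ.cartan μ)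
    (a : Fin m ⊕ Fin n) (k : ℤ) : ∃ c : ℂ, ρ.var a (ρ.zpow a k v) = c • ρ.zpow a (k + 1) v := by
  cases k with
  | ofNat r => exact ⟨1, by rw [one_smul]; exact (congrArg (· v) (pow_succ' (ρ.var a) r)).symm⟩
  | negSucc r =>
    have h := mem_weightSpace.1 (ρ.der_pow_mem_weightSpace hv a r) a
    refine ⟨(μ - Pi.single a (r : ℂ) : Fin m ⊕ Fin n → ℂ) a, Eq.trans ?_ (h.trans ?_)⟩
    · rw [cartan_eq, zpow, pow_succ']; rfl
    · congr 1
      cases r with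
      | zero => rfl
      | succ r => rfl

theorem der_zpow {μ : Fin m ⊕ Fin n → ℂ} {v : P} (hv : v ∈ weightSpace ρ.cartan μ)
    (a : Fin m ⊕ Fin n) (k : ℤ) : ∃ c : ℂ, ρ.der a (ρ.zpow a k v) = c • ρ.zpow a (k - 1) v := by
  cases k with
  | ofNat r =>
    cases r with
    | zero =>
      refine ⟨1, ?_⟩
      rw [one_smul]
      exact (congrArg (· v) (pow_one (ρ.der a))).symm
    | succ r =>
      have h := mem_weightSpace.1 (ρ.var_pow_mem_weightSpace hv a r) a
      have hd := LinearMap.congr_fun (ρ.der_mul_var a a) ((ρ.var a ^ r) v)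
      rw [if_pos rfl, ← cartan_eq, LinearMap.add_apply, LinearMap.smul_apply, h, smul_smul,
        Module.End.one_apply] at hd
      refine ⟨sg (ip a * ip a) * (μ + Pi.single a (r : ℂ) : Fin m ⊕ Fin n → ℂ) a + 1, ?_⟩
      rw [add_smul, one_smul, show (Int.ofNat (r + 1) : ℤ) - 1 = Int.ofNat r by simp]
      refine Eq.trans ?_ hd
      rw [zpow, pow_succ']
      rfl
  | negSucc r =>
    refine ⟨1, ?_⟩
    rw [one_smul, show Int.negSucc r - 1 = Int.negSucc (r + 1) by omega]
    exact (congrArg (· v) (pow_succ' (ρ.der a) (r + 1))).symm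

/-- Operators belonging to different variables commute up to a scalar. -/
theorem zpow_comm {y : Module.End ℂ P} {a b : Fin m ⊕ Fin n} (hab : b ≠ a)
    (hy : y = ρ.var b ∨ y = ρ.der b) (k : ℤ) :
    ∃ c : ℂ, y * ρ.zpow a k = c • (ρ.zpow a k * y) := by
  have hpow : ∀ (z : Module.End ℂ P) (c : ℂ), y * z = c • (z * y) →
      ∀ r : ℕ, y * z ^ r = c ^ r • (z ^ r * y) := by
    intro z c hz r
    induction r with
    | zero => simp
    | succ r ih =>
      rw [pow_succ, ← mul_assoc, ih, smul_mul_assoc, mul_assoc, hz, mul_smul_comm, smul_smul,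
        ← pow_succ, ← mul_assoc]
  have h2 : sg (ip b * ip a) * sg (ip a * ip b) = 1 := by rw [mul_comm (ip b), sg_mul_self]
  cases k with
  | ofNat r =>
    refine ⟨_, hpow (ρ.var a) (sg (ip b * ip a)) ?_ r⟩
    rcases hy with rfl | rfl
    · exact ρ.var_mul_var b a
    · rw [der_mul_var, if_neg hab, add_zero]
  | negSucc r =>
    refine ⟨_, hpow (ρ.der a) (sg (ip b * ip a)) ?_ (r + 1)⟩
    rcases hy with rfl | rfl
    · rw [der_mul_var, if_neg hab.symm, add_zero, smul_smul, h2, one_smul]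
    · exact ρ.der_mul_der b a

theorem var_sq_odd (j : Fin n) : ρ.var (Sum.inr j) * ρ.var (Sum.inr j) = 0 := by
  have h := ρ.var_mul_var (Sum.inr j) (Sum.inr j)
  simp only [ip, Sum.elim_inr, mul_one, sg_one, neg_smul, one_smul] at h
  rw [eq_neg_iff_add_eq_zero, ← two_smul ℂ] at h
  exact (smul_eq_zero.1 h).resolve_left two_ne_zero

theorem der_sq_odd (j : Fin n) : ρ.der (Sum.inr j) * ρ.der (Sum.inr j) = 0 := by
  have h := ρ.der_mul_der (Sum.inr j) (Sum.inr j)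
  simp only [ip, Sum.elim_inr, mul_one, sg_one, neg_smul, one_smul] at h
  rw [eq_neg_iff_add_eq_zero, ← two_smul ℂ] at h
  exact (smul_eq_zero.1 h).resolve_left two_ne_zero

theorem zpow_odd (j : Fin n) {k : ℤ} (hk : 2 ≤ |k|) : ρ.zpow (Sum.inr j) k = 0 := by
  cases k with
  | ofNat r =>
    obtain ⟨s, rfl⟩ : ∃ s, r = s + 2 := ⟨r - 2, by simp at hk; omega⟩
    rw [zpow, pow_add, sq, var_sq_odd, mul_zero]
  | negSucc r =>
    obtain ⟨s, rfl⟩ : ∃ s, r = s + 1 := ⟨r - 1, by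
      rw [abs_of_neg (Int.negSucc_lt_zero r)] at hk; omega⟩
    rw [zpow, show s + 1 + 1 = s + 2 from rfl, pow_add, sq, der_sq_odd, mul_zero]

/-- The monomial `∏ x_a^{k a}`, in the order of the list `l`, applied to `v`. -/
def monomial (v : P) : List (Fin m ⊕ Fin n) → (Fin m ⊕ Fin n → ℤ) → P
  | [], _ => v
  | a :: l, k => ρ.zpow a (k a) (monomial v l k)

theorem monomial_congr (v : P) {l : List (Fin m ⊕ Fin n)} {k k' : Fin m ⊕ Fin n → ℤ}
    (h : ∀ a ∈ l, k a = k' a) : ρ.monomial v l k = ρ.monomial v l k' := by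
  induction l with
  | nil => rfl
  | cons a l ih =>
    rw [monomial, monomial, ih fun b hb => h b (List.mem_cons_of_mem a hb), h a List.mem_cons_self]

open Classical in
theorem monomial_mem_weightSpace {μ : Fin m ⊕ Fin n → ℂ} {v : P}
    (hv : v ∈ weightSpace ρ.cartan μ) {l : List (Fin m ⊕ Fin n)} (hl : l.Nodup)
    (k : Fin m ⊕ Fin n → ℤ) :
    ρ.monomial v l k ∈ weightSpace ρ.cartan (fun a => μ a + if a ∈ l then (k a : ℂ) else 0) := by
  induction l with
  | nil => simpa [monomial] using hv
  | cons a l ih =>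
    rw [List.nodup_cons] at hl
    rw [monomial]
    convert ρ.zpow_mem_weightSpace (ih hl.2) a (k a) using 2
    funext b
    rw [Pi.add_apply]
    by_cases hb : b = a
    · subst hb; simp [hl.1]
    · simp [hb]

theorem monomial_step {μ : Fin m ⊕ Fin n → ℂ} {v : P} (hv : v ∈ weightSpace ρ.cartan μ)
    {l : List (Fin m ⊕ Fin n)} (hl : l.Nodup) (k : Fin m ⊕ Fin n → ℤ) {b : Fin m ⊕ Fin n}
    (hb : b ∈ l) {y : Module.End ℂ P} (hy : y = ρ.var b ∨ y = ρ.der b) :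
    ∃ (c : ℂ) (k' : Fin m ⊕ Fin n → ℤ), (∀ a, a ≠ b → k' a = k a) ∧
      y (ρ.monomial v l k) = c • ρ.monomial v l k' := by
  induction l with
  | nil => simp at hb
  | cons a l ih =>
    rw [List.nodup_cons] at hl
    by_cases hab : b = a
    · subst hab
      have hw := ρ.monomial_mem_weightSpace hv hl.2 k
      have hcongr : ∀ t, ρ.monomial v l (Function.update k b t) = ρ.monomial v l k := fun t =>
        ρ.monomial_congr v fun a ha => Function.update_of_ne (fun e : a = b => hl.1 (e ▸ ha)) _ _
      rcases hy with rfl | rfl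
      · obtain ⟨c, hc⟩ := ρ.var_zpow hw b (k b)
        refine ⟨c, Function.update k b (k b + 1), fun a ha => Function.update_of_ne ha _ _, ?_⟩
        rw [monomial, monomial, hc, Function.update_self, hcongr]
      · obtain ⟨c, hc⟩ := ρ.der_zpow hw b (k b)
        refine ⟨c, Function.update k b (k b - 1), fun a ha => Function.update_of_ne ha _ _, ?_⟩
        rw [monomial, monomial, hc, Function.update_self, hcongr]
    · obtain ⟨c, k', hk', hc⟩ := ih hl.2 ((List.mem_cons.1 hb).resolve_left hab)
      obtain ⟨c', hc'⟩ := ρ.zpow_comm hab hy (k a)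
      refine ⟨c' * c, k', hk', ?_⟩
      have := LinearMap.congr_fun hc' (ρ.monomial v l k)
      rw [monomial, monomial, ← Module.End.mul_apply, this, LinearMap.smul_apply,
        Module.End.mul_apply, hc, map_smul, smul_smul, hk' a (Ne.symm hab)]

theorem zpow_hom (a : Fin m ⊕ Fin n) (k : ℤ) : ∃ p, IsHom p (ρ.zpow a k) := by
  have hpow : ∀ (z : Module.End ℂ P) (q : ZMod 2), IsHom q z → ∀ r : ℕ, ∃ p, IsHom p (z ^ r) := by
    intro z q hz r
    induction r with
    | zero => exact ⟨0, by rw [pow_zero]; exact isHom_one⟩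
    | succ r ih =>
      obtain ⟨p, hp⟩ := ih
      exact ⟨p + q, by rw [pow_succ]; exact hp.mul hz⟩
  cases k with
  | ofNat r => exact hpow _ _ (ρ.var_hom a) r
  | negSucc r => exact hpow _ _ (ρ.der_hom a) (r + 1)

theorem monomial_hom {v : P} {q : ZMod 2} (hv : IsHom q v) (l : List (Fin m ⊕ Fin n))
    (k : Fin m ⊕ Fin n → ℤ) : ∃ p, IsHom p (ρ.monomial v l k) := by
  induction l with
  | nil => exact ⟨q, hv⟩
  | cons a l ih =>
    obtain ⟨p, hp⟩ := ih
    obtain ⟨r, hr⟩ := ρ.zpow_hom a (k a)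
    exact ⟨_, hr.apply hp⟩

theorem monomial_eq_zero (v : P) {l : List (Fin m ⊕ Fin n)} (k : Fin m ⊕ Fin n → ℤ) {j : Fin n}
    (hj : Sum.inr j ∈ l) (hk : 2 ≤ |k (Sum.inr j)|) : ρ.monomial v l k = 0 := by
  induction l with
  | nil => simp at hj
  | cons a l ih =>
    rcases List.mem_cons.1 hj with rfl | hj
    · rw [monomial, zpow_odd ρ j hk, LinearMap.zero_apply]
    · rw [monomial, ih hj, map_zero]

theorem act_mem_of_generators {S : Submodule ℂ P} (hx : ∀ a, ∀ v ∈ S, ρ.var a v ∈ S)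
    (hd : ∀ a, ∀ v ∈ S, ρ.der a v ∈ S) (w : weyl m n) {v : P} (hv : v ∈ S) : ρ.act w v ∈ S := by
  have hmul : ∀ f : A m n, ∀ v ∈ S, ρ.act (wmul f) v ∈ S := by
    intro f
    have hf : f ∈ Algebra.adjoin ℂ (Set.range (gen : Fin m ⊕ Fin n → A m n)) := by
      rw [adjoin_gen]; trivial
    induction hf using Algebra.adjoin_induction with
    | mem f hf => obtain ⟨a, rfl⟩ := hf; exact hx a
    | algebraMap r =>
      intro v hv
      rw [AlgHom.commutes, AlgHom.commutes]
      exact S.smul_mem r hv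
    | add f g _ _ hf hg =>
      intro v hv
      rw [map_add, map_add]
      exact S.add_mem (hf v hv) (hg v hv)
    | mul f g _ _ hf hg =>
      intro v hv
      rw [map_mul, map_mul]
      exact hf _ (hg v hv)
  obtain ⟨w, hw⟩ := w
  have key : ∀ v ∈ S, ρ.act ⟨w, hw⟩ v ∈ S := by
    induction hw using Algebra.adjoin_induction with
    | mem w h =>
      rcases h with ⟨f, rfl⟩ | ⟨a, rfl⟩
      · exact hmul f
      · exact hd a
    | algebraMap r =>
      intro v hv
      have h := AlgHom.commutes ρ.act r
      change ρ.act (algebraMap ℂ (weyl m n) r) v ∈ S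
      rw [h]
      exact S.smul_mem r hv
    | add x y hx' hy' hx hy =>
      intro v hv
      have h := map_add ρ.act ⟨x, hx'⟩ ⟨y, hy'⟩
      change ρ.act (⟨x, hx'⟩ + ⟨y, hy'⟩) v ∈ S
      rw [h]
      exact S.add_mem (hx v hv) (hy v hv)
    | mul x y hx' hy' hx hy =>
      intro v hv
      have h := map_mul ρ.act ⟨x, hx'⟩ ⟨y, hy'⟩
      change ρ.act (⟨x, hx'⟩ * ⟨y, hy'⟩) v ∈ S
      rw [h]
      exact hx _ (hy v hv)
  exact key v hv

/-- A simple weight module over the Weyl superalgebra is spanned by vectors `e k`, `k` integral,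
where `e k` is zero or has weight `μ + k`, and is zero unless the odd coordinates of `k` lie in
`{-1, 0, 1}`: the monomials applied to one homogeneous weight vector. -/
theorem exists_weight_span (hsimple : IsGradedSimple ρ.act) (hw : IsWeight ρ.cartan) :
    ∃ (μ : Fin m ⊕ Fin n → ℂ) (e : (Fin m ⊕ Fin n → ℤ) → P),
      (∀ k, e k ∈ weightSpace ρ.cartan (fun a => μ a + k a)) ∧
      (∀ k j, 2 ≤ |k (Sum.inr j)| → e k = 0) ∧ Submodule.span ℂ (Set.range e) = ⊤ := by
  have := hsimple.1
  obtain ⟨p, μ, v, hv0, hv, hvp⟩ := exists_homogeneous_weight_vector ρ.cartan_hom hw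
  set l : List (Fin m ⊕ Fin n) := Finset.univ.toList with hl
  have hmem : ∀ a, a ∈ l := fun a => Finset.mem_toList.2 (Finset.mem_univ a)
  have hnd : l.Nodup := Finset.nodup_toList _
  refine ⟨μ, ρ.monomial v l, fun k => ?_, fun k j => ρ.monomial_eq_zero v k (hmem _), ?_⟩
  · have := ρ.monomial_mem_weightSpace hv hnd k
    simpa [hmem] using this
  set S := Submodule.span ℂ (Set.range (ρ.monomial v l)) with hS
  have hstep : ∀ b (y : Module.End ℂ P), (y = ρ.var b ∨ y = ρ.der b) → ∀ w ∈ S, y w ∈ S := by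
    intro b y hy
    have : S ≤ S.comap y := by
      refine Submodule.span_le.2 ?_
      rintro _ ⟨k, rfl⟩
      obtain ⟨c, k', -, hc⟩ := ρ.monomial_step hv hnd k (hmem b) hy
      rw [SetLike.mem_coe, Submodule.mem_comap, hc]
      exact S.smul_mem c (Submodule.subset_span ⟨k', rfl⟩)
    exact fun w hw => this hw
  have hgr : IsGradedSub ρ.act S := by
    constructor
    · have : S ≤ S.comap parity := by
        refine Submodule.span_le.2 ?_
        rintro _ ⟨k, rfl⟩
        obtain ⟨q, hq⟩ := ρ.monomial_hom hvp l k
        rw [SetLike.mem_coe, Submodule.mem_comap, hq]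
        exact S.smul_mem _ (Submodule.subset_span ⟨k, rfl⟩)
      exact fun w hw => this hw
    · exact fun w u hu => ρ.act_mem_of_generators (fun a => hstep a _ (Or.inl rfl))
        (fun a => hstep a _ (Or.inr rfl)) w hu
  refine (hsimple.2 S hgr).resolve_left fun h => hv0 ?_
  have h0 : ρ.monomial v l 0 = v := by
    clear_value l
    clear * -
    induction l with
    | nil => rfl
    | cons a l ih =>
      rw [monomial, ih]
      rfl
  have : v ∈ S := Submodule.subset_span ⟨0, h0⟩
  rw [h] at this
  exact (Submodule.mem_bot ℂ).1 this

/-- An operator `y` that commutes with the derivative in an even variable vanishes if its product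
with a power of that variable does: the commutator of `∂` with `x ^ (r + 1)` is `(r + 1) x ^ r`. -/
theorem var_even_injective_step {i : Fin m} {y : Module.End ℂ P}
    (hy : ρ.der (Sum.inl i) * y = y * ρ.der (Sum.inl i)) {r : ℕ}
    (h : ρ.var (Sum.inl i) ^ r * y = 0) : y = 0 := by
  have hd : ∀ r : ℕ, ρ.der (Sum.inl i) * ρ.var (Sum.inl i) ^ (r + 1) =
      ρ.var (Sum.inl i) ^ (r + 1) * ρ.der (Sum.inl i) + ((r + 1 : ℕ) : ℂ) •
        ρ.var (Sum.inl i) ^ r := by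
    have h1 := ρ.der_mul_var (Sum.inl i) (Sum.inl i)
    simp only [ip, Sum.elim_inl, mul_zero, sg_zero, one_smul, if_true] at h1
    intro r
    induction r with
    | zero => simpa using h1
    | succ r ih =>
      rw [pow_succ _ (r + 1), ← mul_assoc, ih, add_mul, mul_assoc, h1, mul_add, mul_one,
        smul_mul_assoc, ← pow_succ, mul_assoc, add_assoc]
      congr 1
      push_cast
      module
  induction r with
  | zero => simpa using h
  | succ r ih =>
    refine ih ?_
    have h2 : ρ.der (Sum.inl i) * (ρ.var (Sum.inl i) ^ (r + 1) * y) = 0 := by rw [h, mul_zero]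
    rw [← mul_assoc, hd, add_mul, mul_assoc, hy, ← mul_assoc, h, zero_mul, zero_add,
      smul_mul_assoc] at h2
    exact (smul_eq_zero.1 h2).resolve_left (Nat.cast_ne_zero.2 (Nat.succ_ne_zero r))

/-- Monomials in two different even variables act by nonzero operators: repeated commutators with
the partial derivatives reduce them to a nonzero scalar. -/
theorem var_pow_mul_ne_zero [Nontrivial P] {i i' : Fin m} (h : i ≠ i') (r s : ℕ) :
    ρ.var (Sum.inl i) ^ r * ρ.var (Sum.inl i') ^ s ≠ 0 := by
  intro h0
  have h1 : ρ.var (Sum.inl i') ^ s = 0 := by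
    refine ρ.var_even_injective_step ?_ h0
    have hc : Commute (ρ.der (Sum.inl i)) (ρ.var (Sum.inl i')) := by
      have := ρ.der_mul_var (Sum.inl i) (Sum.inl i')
      rw [if_neg fun e => h (Sum.inl.inj e), add_zero] at this
      simp only [ip, Sum.elim_inl, mul_zero, sg_zero, one_smul] at this
      exact this
    exact hc.pow_right s
  have h2 : (1 : Module.End ℂ P) = 0 := by
    refine ρ.var_even_injective_step (i := i') (r := s) ?_ (by rw [mul_one, h1])
    rw [mul_one, one_mul]
  exact one_ne_zero h2

end WeylModule

end Weyl

/-! ### Weights of `F(P, M)`, and the top layer of `M` -/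

section TensorWeights

variable {m n : ℕ} {P M : Type*} [AddCommGroup P] [Module ℂ P] [SuperSpace P]
  [AddCommGroup M] [Module ℂ M] [SuperSpace M]
  (ρ : WeylModule m n P) (φ : LieSuperModule (GLSuper m n) M)

theorem wder_fieldOf_gen (a : Fin m ⊕ Fin n) : wder (fieldOf (gen a) a) = wmul (gen a) * wpd a :=
  rfl

theorem rightPd_fieldOf_gen (a b c : Fin m ⊕ Fin n) :
    rightPd b ((fieldOf (gen a) a).toEnd (gen c)) = if a = c ∧ b = a then (1 : A m n) else 0 := by
  have h : (fieldOf (gen a) a).toEnd (gen c) = gen a * (if a = c then (1 : A m n) else 0) := by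
    rw [← pd_gen]; rfl
  rw [h]
  by_cases hac : a = c
  · rw [if_pos hac, mul_one, rightPd_apply, pd_gen]
    by_cases hba : b = a
    · rw [if_pos hba, if_pos ⟨hac, hba⟩, twist_one_eq]
    · rw [if_neg hba, if_neg fun h => hba h.2, map_zero]
  · rw [if_neg hac, mul_zero, map_zero, if_neg fun h => hac h.1]

theorem cartan_tmul (a : Fin m ⊕ Fin n) (u : P) (x : M) :
    (tensorModule ρ φ).cartan a (u ⊗ₜ x) = ρ.cartan a u ⊗ₜ x + u ⊗ₜ φ.cartan a x := by
  have h1 : (tensorModule ρ φ).cartan a = derOp ρ φ (fieldOf (gen a) a) := by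
    change derOp ρ φ (fieldOf (gen a) a) + coefOp M ρ 0 = _
    rw [map_zero, add_zero]
  rw [h1, derOp_apply, LinearMap.add_apply, wder_fieldOf_gen, leftOp_tmul, glOp_apply]
  congr 1
  simp only [LinearMap.sum_apply, rightPd_fieldOf_gen]
  rw [Finset.sum_eq_single a, Finset.sum_eq_single a]
  · rw [if_pos ⟨rfl, rfl⟩, map_one, one_mul, rightOp_tmul, CharTwo.add_self_eq_zero, twist_zero]
    rfl
  · intro b _ hb
    rw [if_neg fun h => hb h.1.symm, map_zero, zero_mul, LinearMap.zero_apply]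
  · simp
  · intro b _ hb
    refine Finset.sum_eq_zero fun c _ => ?_
    rw [if_neg fun h => hb h.2, map_zero, zero_mul, LinearMap.zero_apply]
  · simp

theorem tmul_mem_weightSpace {μ ν : Fin m ⊕ Fin n → ℂ} {u : P} {x : M}
    (hu : u ∈ weightSpace ρ.cartan μ) (hx : x ∈ weightSpace φ.cartan ν) :
    u ⊗ₜ[ℂ] x ∈ weightSpace (tensorModule ρ φ).cartan (μ + ν) := by
  refine mem_weightSpace.2 fun a => ?_
  rw [cartan_tmul, mem_weightSpace.1 hu, mem_weightSpace.1 hx, Pi.add_apply,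
    ← TensorProduct.smul_tmul', TensorProduct.tmul_smul, add_smul]

omit [SuperSpace P] [SuperSpace M] in
theorem tmul_left_injective {u : P} (hu : u ≠ 0) :
    Function.Injective (TensorProduct.mk ℂ P M u) := by
  obtain ⟨f, hf⟩ : ∃ f : Module.Dual ℂ P, f u ≠ 0 := by
    by_contra! h
    exact hu ((Module.forall_dual_apply_eq_zero_iff ℂ u).1 h)
  rw [← LinearMap.ker_eq_bot, Submodule.eq_bot_iff]
  intro x hx
  have h := congrArg (fun t => TensorProduct.lid ℂ M (LinearMap.rTensor M f t))
    (LinearMap.mem_ker.1 hx)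
  simp only [TensorProduct.mk_apply, LinearMap.rTensor_tmul, TensorProduct.lid_tmul, map_zero] at h
  exact (smul_eq_zero.1 h).resolve_left hf

omit [SuperSpace P] [SuperSpace M] in
theorem tmul_ne_zero {u : P} {x : M} (hu : u ≠ 0) (hx : x ≠ 0) : u ⊗ₜ[ℂ] x ≠ 0 := fun h =>
  hx (tmul_left_injective hu (h.trans (TensorProduct.tmul_zero M u).symm))

variable {ρ φ}

/-- The weight spaces of `M` are no larger than those of `F(P, M)`. -/
theorem rank_weightSpace_le [Nontrivial P] (hP : IsWeight ρ.cartan) {N : ℕ}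
    (hN : ∀ wt, Module.rank ℂ (weightSpace (tensorModule ρ φ).cartan wt) ≤ N)
    (ν : Fin m ⊕ Fin n → ℂ) : Module.rank ℂ (weightSpace φ.cartan ν) ≤ N := by
  obtain ⟨μ, u, hu, hu0⟩ := exists_weight_vector hP
  refine rank_le_natCast_of_injective ((TensorProduct.mk ℂ P M u).restrict
    (p := weightSpace φ.cartan ν) (q := weightSpace (tensorModule ρ φ).cartan (μ + ν))
    fun x hx => tmul_mem_weightSpace ρ φ hu hx) ?_ (hN (μ + ν))
  intro x y h
  exact Subtype.ext (tmul_left_injective hu0 (congrArg Subtype.val h))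

theorem act_unitMat_mem_weightSpace {μ : Fin m ⊕ Fin n → ℂ} {x : M}
    (hx : x ∈ weightSpace φ.cartan μ) (a b : Fin m ⊕ Fin n) :
    φ.act (unitMat a b) x ∈ weightSpace φ.cartan (μ + Pi.single a 1 - Pi.single b 1) := by
  refine mem_weightSpace.2 fun c => ?_
  rw [cartan_act_unitMat, mem_weightSpace.1 hx c, map_smul, ← add_smul, Pi.sub_apply, Pi.add_apply,
    Pi.single_apply, Pi.single_apply]
  congr 1
  ring

theorem act_unitMat_pow_mem_weightSpace {μ : Fin m ⊕ Fin n → ℂ} {x : M}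
    (hx : x ∈ weightSpace φ.cartan μ) (a b : Fin m ⊕ Fin n) (r : ℕ) :
    (φ.act (unitMat a b) ^ r) x ∈
      weightSpace φ.cartan (μ + Pi.single a (r : ℂ) - Pi.single b (r : ℂ)) := by
  induction r with
  | zero => simpa using hx
  | succ r ih =>
    rw [pow_succ', Module.End.mul_apply]
    convert act_unitMat_mem_weightSpace ih a b using 2
    rw [Nat.cast_add_one, Pi.single_add, Pi.single_add]
    abel

/-- If `F(P, M)` is bounded by `N`, the off-diagonal matrix units of `𝔤𝔩ₘ` are nilpotent on `M`.
Otherwise the tensor products of `E^k v` with vectors of `P` of complementary weights would be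
`N + 1` independent vectors of one weight. -/
theorem act_unitMat_pow_eq_zero [Nontrivial P] (hP : IsWeight ρ.cartan) (hM : IsWeight φ.cartan)
    {N : ℕ} (hN : ∀ wt, Module.rank ℂ (weightSpace (tensorModule ρ φ).cartan wt) ≤ N)
    {i i' : Fin m} (hi : i ≠ i') : φ.act (unitMat (Sum.inl i) (Sum.inl i')) ^ N = 0 := by
  set E := φ.act (unitMat (Sum.inl i) (Sum.inl i')) with hE
  suffices h : ∀ μ, weightSpace φ.cartan μ ≤ LinearMap.ker (E ^ N) by
    have h' : (⊤ : Submodule ℂ M) ≤ LinearMap.ker (E ^ N) := hM.symm.le.trans (iSup_le h)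
    exact LinearMap.ker_eq_top.1 (top_le_iff.1 h')
  intro μ v hv
  rw [LinearMap.mem_ker]
  by_contra hEv
  obtain ⟨lam, q, hq, hq0⟩ : ∃ lam, ∃ q ∈ weightSpace ρ.cartan lam,
      (ρ.var (Sum.inl i) ^ N * ρ.var (Sum.inl i') ^ N) q ≠ 0 := by
    by_contra! hcon
    have h' : (⊤ : Submodule ℂ P) ≤
        LinearMap.ker (ρ.var (Sum.inl i) ^ N * ρ.var (Sum.inl i') ^ N) :=
      hP.symm.le.trans (iSup_le fun lam q hq => LinearMap.mem_ker.2 (hcon lam q hq))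
    exact ρ.var_pow_mul_ne_zero hi N N (LinearMap.ker_eq_top.1 (top_le_iff.1 h'))
  set x := ρ.var (Sum.inl i) with hx
  set y := ρ.var (Sum.inl i') with hy
  have hxy : Commute x y := by
    have h := ρ.var_mul_var (Sum.inl i) (Sum.inl i')
    simp only [ip, Sum.elim_inl, mul_zero, sg_zero, one_smul] at h
    exact h
  have hsplit : ∀ k ≤ N, (x ^ k * y ^ (N - k)) * (x ^ (N - k) * y ^ k) = x ^ N * y ^ N := by
    intro k hk
    rw [mul_assoc, ← mul_assoc (y ^ (N - k)), (hxy.symm.pow_pow (N - k) (N - k)).eq, mul_assoc,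
      ← mul_assoc (x ^ k), ← pow_add, ← pow_add]
    congr 2 <;> omega
  let w : Fin (N + 1) → P ⊗[ℂ] M := fun k => ((x ^ (N - k) * y ^ (k : ℕ)) q) ⊗ₜ ((E ^ (k : ℕ)) v)
  have hw0 : ∀ k, w k ≠ 0 := by
    intro k
    have hk : (k : ℕ) ≤ N := Nat.lt_succ_iff.1 k.2
    refine tmul_ne_zero (fun h => hq0 ?_) fun h => hEv ?_
    · rw [← hsplit k hk, Module.End.mul_apply, h, map_zero]
    · rw [← Nat.sub_add_cancel hk, pow_add, Module.End.mul_apply, h, map_zero]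
  have hEk : ∀ k : ℕ, φ.cartan (Sum.inl i) ((E ^ k) v) = (μ (Sum.inl i) + k) • (E ^ k) v := by
    intro k
    have h := mem_weightSpace.1 (act_unitMat_pow_mem_weightSpace hv (Sum.inl i) (Sum.inl i') k)
      (Sum.inl i)
    simpa [Pi.single_apply, hi] using h
  have hind : LinearIndependent ℂ w := by
    refine Module.End.eigenvectors_linearIndependent' (LinearMap.lTensor P (φ.cartan (Sum.inl i)))
      (fun k : Fin (N + 1) => μ (Sum.inl i) + (k : ℕ)) (fun k l h => ?_) w fun k => ⟨?_, hw0 k⟩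
    · exact Fin.ext (Nat.cast_injective (R := ℂ) (add_left_cancel h))
    · rw [Module.End.mem_eigenspace_iff, LinearMap.lTensor_tmul, hEk, TensorProduct.tmul_smul]
  have hmem : ∀ k, w k ∈ weightSpace (tensorModule ρ φ).cartan
      (lam + μ + Pi.single (Sum.inl i) (N : ℂ)) := by
    intro k
    have hk : (k : ℕ) ≤ N := Nat.lt_succ_iff.1 k.2
    have h1 := ρ.var_pow_mem_weightSpace (ρ.var_pow_mem_weightSpace hq (Sum.inl i') k)
      (Sum.inl i) (N - k)
    have h2 := act_unitMat_pow_mem_weightSpace hv (Sum.inl i) (Sum.inl i') k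
    convert tmul_mem_weightSpace ρ φ h1 h2 using 2
    · rw [Nat.cast_sub hk, Pi.single_sub]
      abel
    · rfl
  have hind' : LinearIndependent ℂ (fun k => (⟨w k, hmem k⟩ :
      weightSpace (tensorModule ρ φ).cartan (lam + μ + Pi.single (Sum.inl i) (N : ℂ)))) :=
    LinearIndependent.of_comp (Submodule.subtype _) hind
  have hcard := hind'.cardinal_lift_le_rank.trans (Cardinal.lift_le.2 (hN _))
  rw [Cardinal.mk_fin, Cardinal.lift_natCast, Cardinal.lift_natCast, Nat.cast_le] at hcard
  omega

end TensorWeights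

section TopSpace

variable {m n : ℕ} {M : Type*} [AddCommGroup M] [Module ℂ M] [SuperSpace M]
  (φ : LieSuperModule (GLSuper m n) M)

theorem LieSuperModule.cartan_hom (a : Fin m ⊕ Fin n) : IsHom 0 (φ.cartan a) := by
  rw [← CharTwo.add_self_eq_zero (ip a)]
  exact φ.act_hom (unitMat_hom a a)

theorem raise_comm (i i' : Fin m) (j j' : Fin n) (x : M) :
    φ.act (unitMat (Sum.inl i) (Sum.inr j)) (φ.act (unitMat (Sum.inl i') (Sum.inr j')) x) =
      -φ.act (unitMat (Sum.inl i') (Sum.inr j')) (φ.act (unitMat (Sum.inl i) (Sum.inr j)) x) := by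
  rw [act_unitMat_comm]
  simp [ip, sg_one]

theorem lower_comm (i i' : Fin m) (j j' : Fin n) (x : M) :
    φ.act (unitMat (Sum.inr j) (Sum.inl i)) (φ.act (unitMat (Sum.inr j') (Sum.inl i')) x) =
      -φ.act (unitMat (Sum.inr j') (Sum.inl i')) (φ.act (unitMat (Sum.inr j) (Sum.inl i)) x) := by
  rw [act_unitMat_comm]
  simp [ip, sg_one]

omit [SuperSpace M] in
theorem eq_zero_of_eq_neg {x : M} (h : x = -x) : x = 0 := by
  rw [eq_neg_iff_add_eq_zero, ← two_smul ℂ] at h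
  exact (smul_eq_zero.1 h).resolve_left two_ne_zero

/-- A nonzero weight module contains a nonzero homogeneous weight vector killed by `𝔤𝔩(m,n)₁`: apply
a maximal nonvanishing product of the pairwise anticommuting matrix units of `𝔤𝔩(m,n)₁`. -/
theorem exists_singular_vector [Nontrivial M] (hw : IsWeight φ.cartan) :
    ∃ (p : ZMod 2) (μ : Fin m ⊕ Fin n → ℂ) (v : M), v ≠ 0 ∧ v ∈ weightSpace φ.cartan μ ∧
      IsHom p v ∧ ∀ i j, φ.act (unitMat (Sum.inl i) (Sum.inr j)) v = 0 := by
  classical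
  suffices h : ∀ s : Finset (Fin m × Fin n), ∃ (p : ZMod 2) (μ : Fin m ⊕ Fin n → ℂ) (v : M),
      v ≠ 0 ∧ v ∈ weightSpace φ.cartan μ ∧ IsHom p v ∧
      ∀ q ∈ s, φ.act (unitMat (Sum.inl q.1) (Sum.inr q.2)) v = 0 by
    obtain ⟨p, μ, v, h1, h2, h3, h4⟩ := h Finset.univ
    exact ⟨p, μ, v, h1, h2, h3, fun i j => h4 (i, j) (Finset.mem_univ _)⟩
  intro s
  induction s using Finset.induction_on with
  | empty =>
    obtain ⟨p, μ, v, h1, h2, h3⟩ := exists_homogeneous_weight_vector φ.cartan_hom hw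
    exact ⟨p, μ, v, h1, h2, h3, by simp⟩
  | insert q s hq ih =>
    obtain ⟨p, μ, v, h1, h2, h3, h4⟩ := ih
    by_cases h0 : φ.act (unitMat (Sum.inl q.1) (Sum.inr q.2)) v = 0
    · refine ⟨p, μ, v, h1, h2, h3, fun r hr => ?_⟩
      rcases Finset.mem_insert.1 hr with rfl | hr
      · exact h0
      · exact h4 r hr
    · refine ⟨_, _, _, h0, act_unitMat_mem_weightSpace h2 _ _,
        (φ.act_hom (unitMat_hom _ _)).apply h3, fun r hr => ?_⟩
      rcases Finset.mem_insert.1 hr with rfl | hr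
      · exact eq_zero_of_eq_neg (raise_comm φ _ _ _ _ v)
      · rw [raise_comm, h4 r hr, map_zero, neg_zero]

/-- The homogeneous vectors of parity `p` killed by `𝔤𝔩(m,n)₁` on which the grading element acts
by `c`. -/
def topSpace (p : ZMod 2) (c : ℂ) : Submodule ℂ M :=
  component M p ⊓ (gradOp φ).eigenspace c ⊓
    ⨅ (i : Fin m) (j : Fin n), LinearMap.ker (φ.act (unitMat (Sum.inl i) (Sum.inr j)))

variable {φ} {p : ZMod 2} {c : ℂ}

theorem mem_topSpace {v : M} : v ∈ topSpace φ p c ↔ IsHom p v ∧ gradOp φ v = c • v ∧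
    ∀ i j, φ.act (unitMat (Sum.inl i) (Sum.inr j)) v = 0 := by
  simp only [topSpace, Submodule.mem_inf, Module.End.mem_eigenspace_iff, Submodule.mem_iInf,
    LinearMap.mem_ker, and_assoc]
  rfl

theorem topSpace_even_mem {a b : Fin m ⊕ Fin n} (hab : ip a = ip b) {v : M}
    (hv : v ∈ topSpace φ p c) : φ.act (unitMat a b) v ∈ topSpace φ p c := by
  obtain ⟨h1, h2, h3⟩ := mem_topSpace.1 hv
  refine mem_topSpace.2 ⟨?_, ?_, fun i j => ?_⟩
  · have := (φ.act_hom (unitMat_hom a b)).apply h1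
    rwa [hab, CharTwo.add_self_eq_zero, zero_add] at this
  · have hd : (deg a : ℂ) - deg b = 0 := by
      rcases a with a | a <;> rcases b with b | b <;> simp [ip] at hab <;> simp [deg]
    rw [gradOp_act_unitMat, h2, map_smul, hd, zero_smul, add_zero]
  · rw [act_unitMat_comm, h3, map_zero, smul_zero, zero_add]
    rcases a with a | a <;> rcases b with b | b
    · simp [h3]
    · simp [ip] at hab
    · simp [ip] at hab
    · simp [h3]

theorem topSpace_act_upper {v : M} (hv : v ∈ topSpace φ p c) (X : GLEven m n)
    (Z : Matrix (Fin m) (Fin n) ℂ) : φ.act (upper X Z) v = φ.act (upper X 0) v := by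
  have h3 := (mem_topSpace.1 hv).2.2
  rw [act_eq_sum, act_eq_sum]
  simp only [Fintype.sum_sum_type, h3, smul_zero, Finset.sum_const_zero, add_zero]
  simp [upper]

theorem topSpace_act_mem {v : M} (hv : v ∈ topSpace φ p c) (X : GLEven m n) :
    φ.act (upper X 0) v ∈ topSpace φ p c := by
  rw [act_eq_sum]
  refine Submodule.sum_mem _ fun a _ => Submodule.sum_mem _ fun b _ => ?_
  by_cases hab : ip a = ip b
  · exact Submodule.smul_mem _ _ (topSpace_even_mem hab hv)
  · have : (upper X 0 : GLSuper m n) a b = 0 := by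
      rcases a with a | a <;> rcases b with b | b <;> simp [ip] at hab <;> simp [upper]
    rw [this, zero_smul]
    exact zero_mem _

/-- The representation of `𝔤𝔩(m,n)₀` on a graded module. -/
def evenRep (φ : LieSuperModule (GLSuper m n) M) : GLEven m n →ₗ⁅ℂ⁆ Module.End ℂ M where
  toFun X := φ.act (upper X 0)
  map_add' X Y := by
    rw [← map_add]
    congr 1
    simp [upper, Matrix.fromBlocks_add]
  map_smul' r X := by
    rw [RingHom.id_apply, ← map_smul]
    congr 1
    simp [upper, Matrix.fromBlocks_smul]
  map_lie' {X Y} := by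
    have hhom : ∀ X : GLEven m n, IsHom 0 (upper X 0) := fun X => by
      rw [IsHom, parity_upper, neg_zero, sg_zero, one_smul]
    have hb : upper ⁅X, Y⁆ 0 = bracket (upper X 0) (upper Y 0) := by
      refine Eq.trans ?_ (supercomm_eq (hhom X) (hhom Y)).symm
      rw [mul_zero, sg_zero, one_smul]
      simp [upper, Matrix.fromBlocks_multiply, LieRing.of_associative_ring_bracket,
        sub_eq_add_neg, Matrix.fromBlocks_neg, Matrix.fromBlocks_add]
    change φ.act (upper ⁅X, Y⁆ 0) = _
    rw [hb, φ.act_bracket (hhom X) (hhom Y), mul_zero, sg_zero, one_smul]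
    rfl

/-- The representation of `𝔤𝔩(m,n)₀` on the top space. -/
def topRep (φ : LieSuperModule (GLSuper m n) M) (p : ZMod 2) (c : ℂ) :
    GLEven m n →ₗ⁅ℂ⁆ Module.End ℂ (topSpace φ p c) :=
  restrictLie (evenRep φ) (topSpace φ p c) fun X _ hv => topSpace_act_mem hv X

theorem topRep_coe (X : GLEven m n) (v : topSpace φ p c) :
    (topRep φ p c X v : M) = φ.act (upper X 0) v := rfl

/-- The top space of a simple module is a simple `𝔤𝔩(m,n)₀`-module: an invariant subspace generates
the whole module under the lowering operators, and is recovered as an eigenspace of the grading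
element. -/
theorem topRep_irreducible (hsimple : IsGradedSimple φ.act) (N : Submodule ℂ (topSpace φ p c))
    (hN : ∀ X, ∀ v ∈ N, topRep φ p c X v ∈ N) : N = ⊥ ∨ N = ⊤ := by
  set B := N.map (topSpace φ p c).subtype with hB
  have hle : B ≤ topSpace φ p c := Submodule.map_subtype_le _ _
  have hlayer : IsTopLayer φ B c := by
    constructor
    · intro v hv
      rw [(mem_topSpace.1 (hle hv)).1]
      exact B.smul_mem _ hv
    · rintro a b hab _ ⟨v, hv, rfl⟩
      rcases a with a | a <;> rcases b with b | b
      · exact ⟨topRep φ p c _ v, hN _ v hv, by rw [unitMat_inl]; rfl⟩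
      · simp [ip] at hab
      · simp [ip] at hab
      · exact ⟨topRep φ p c _ v, hN _ v hv, by rw [unitMat_inr]; rfl⟩
    · exact fun i j v hv => (mem_topSpace.1 (hle hv)).2.2 i j
    · exact fun v hv => Module.End.mem_eigenspace_iff.2 (mem_topSpace.1 (hle hv)).2.1
  rcases hsimple.2 _ hlayer.isGradedSub with h | h
  · left
    have : B = ⊥ := le_bot_iff.1 (h ▸ le_lowerSpan)
    exact Submodule.map_injective_of_injective (Submodule.injective_subtype _)
      (by rw [← hB, this, Submodule.map_bot])
  · right
    rw [eq_top_iff]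
    intro v _
    have : (v : M) ∈ B := hlayer.mem_of_mem_eigenspace (h ▸ Submodule.mem_top)
      (Module.End.mem_eigenspace_iff.2 (mem_topSpace.1 v.2).2.1)
    obtain ⟨w, hw, e⟩ := this
    exact Subtype.ext e ▸ hw

end TopSpace

section FiniteWeights

variable {m n : ℕ} {M : Type*} [AddCommGroup M] [Module ℂ M] [SuperSpace M]
  {φ : LieSuperModule (GLSuper m n) M}

/-- The weight of a highest weight vector for an `𝔰𝔩₂` inside `𝔤𝔩ₘ` whose lowering operator is
nilpotent: if `s` is minimal with `f ^ (s + 1) v = 0`, then `0 = e f ^ (s + 1) v` is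
`(s + 1) (d - s) f ^ s v`, where `d` is the eigenvalue of `[e, f]` on `v`. -/
theorem exists_nat_of_primitive {i i' : Fin m} (hi : i ≠ i') {N : ℕ}
    (hf : φ.act (unitMat (Sum.inl i') (Sum.inl i)) ^ N = 0) {μ : Fin m ⊕ Fin n → ℂ} {v : M}
    (hv : v ∈ weightSpace φ.cartan μ) (hv0 : v ≠ 0)
    (he : φ.act (unitMat (Sum.inl i) (Sum.inl i')) v = 0) :
    ∃ s : ℕ, s < N ∧ μ (Sum.inl i) - μ (Sum.inl i') = s := by
  classical
  set e := φ.act (unitMat (Sum.inl i) (Sum.inl i')) with hedef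
  set f := φ.act (unitMat (Sum.inl i') (Sum.inl i)) with hfdef
  have hcomm : ∀ x, e (f x) = f (e x) + (φ.cartan (Sum.inl i) x - φ.cartan (Sum.inl i') x) := by
    intro x
    rw [hedef, act_unitMat_comm]
    simp [ip, sg_zero, LieSuperModule.cartan, hfdef]
  set d := μ (Sum.inl i) - μ (Sum.inl i') with hd
  have hwt : ∀ r : ℕ, φ.cartan (Sum.inl i) ((f ^ r) v) - φ.cartan (Sum.inl i') ((f ^ r) v) =
      (d - 2 * r) • (f ^ r) v := by
    intro r
    have h := act_unitMat_pow_mem_weightSpace hv (Sum.inl i') (Sum.inl i) r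
    have h1 := mem_weightSpace.1 h (Sum.inl i)
    have h2 := mem_weightSpace.1 h (Sum.inl i')
    rw [h1, h2, ← sub_smul]
    congr 1
    simp [hi, hi.symm, hd]
    ring
  have hstep : ∀ r : ℕ, e ((f ^ (r + 1)) v) = ((r + 1 : ℂ) * (d - r)) • (f ^ r) v := by
    intro r
    induction r with
    | zero =>
      have h0 := hwt 0
      simp only [pow_zero, Module.End.one_apply] at h0
      rw [zero_add, pow_one, hcomm, he, map_zero, zero_add, h0]
      simp
    | succ r ih =>
      rw [pow_succ' f (r + 1), Module.End.mul_apply, hcomm, ih, map_smul, hwt,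
        ← Module.End.mul_apply, ← pow_succ', ← add_smul]
      congr 1
      push_cast
      ring
  have hex : ∃ s, (f ^ (s + 1)) v = 0 := ⟨N, by rw [pow_succ', hf, mul_zero, LinearMap.zero_apply]⟩
  set s := Nat.find hex with hs
  have hs0 : (f ^ (s + 1)) v = 0 := Nat.find_spec hex
  have hs1 : (f ^ s) v ≠ 0 := by
    cases h : s with
    | zero => simpa using hv0
    | succ r => exact Nat.find_min hex (m := r) (by omega)
  refine ⟨s, ?_, ?_⟩
  · by_contra! hle
    refine hs1 ?_
    rw [← Nat.sub_add_cancel hle, pow_add, hf, mul_zero, LinearMap.zero_apply]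
  · have h := hstep s
    rw [hs0, map_zero, eq_comm, smul_eq_zero] at h
    have h' := h.resolve_right hs1
    exact sub_eq_zero.1 ((mul_eq_zero.1 h').resolve_left (Nat.cast_add_one_ne_zero s))

/-- The bound for an arbitrary weight vector is obtained by raising it to a highest weight vector,
which increases the difference of the two coordinates by an even number. -/
theorem exists_weight_difference {i i' : Fin m} (hi : i ≠ i') {N : ℕ}
    (he : φ.act (unitMat (Sum.inl i) (Sum.inl i')) ^ N = 0)
    (hf : φ.act (unitMat (Sum.inl i') (Sum.inl i)) ^ N = 0) {μ : Fin m ⊕ Fin n → ℂ} {v : M}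
    (hv : v ∈ weightSpace φ.cartan μ) (hv0 : v ≠ 0) :
    ∃ k : ℤ, k ≤ N ∧ μ (Sum.inl i) - μ (Sum.inl i') = k := by
  classical
  set e := φ.act (unitMat (Sum.inl i) (Sum.inl i')) with hedef
  have hex : ∃ s, (e ^ (s + 1)) v = 0 := ⟨N, by rw [pow_succ', he, mul_zero, LinearMap.zero_apply]⟩
  set r := Nat.find hex with hr
  have hr0 : (e ^ (r + 1)) v = 0 := Nat.find_spec hex
  have hr1 : (e ^ r) v ≠ 0 := by
    cases h : r with
    | zero => simpa using hv0
    | succ r => exact Nat.find_min hex (m := r) (by omega)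
  obtain ⟨s, hs, hd⟩ := exists_nat_of_primitive hi hf
    (act_unitMat_pow_mem_weightSpace hv (Sum.inl i) (Sum.inl i') r) hr1
    (by rw [← hedef, ← Module.End.mul_apply, ← pow_succ']; exact hr0)
  refine ⟨s - 2 * r, by omega, ?_⟩
  simp [hi, hi.symm] at hd
  push_cast
  rw [← hd]
  ring

/-- The weights of a weight module with nilpotent off-diagonal `𝔤𝔩ₘ`-matrix units are finite in
number once the sum of the even coordinates and the odd coordinates are prescribed: the differences
of the even coordinates take finitely many values, and with the sum they determine the weight. -/
theorem finite_weights {N : ℕ} (hN : ∀ i i' : Fin m, i ≠ i' →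
      φ.act (unitMat (Sum.inl i) (Sum.inl i')) ^ N = 0) (c : ℂ) (ν : Fin n → ℂ) :
    {μ : Fin m ⊕ Fin n → ℂ | weightSpace φ.cartan μ ≠ ⊥ ∧ ∑ i, μ (Sum.inl i) = c ∧
      ∀ j, μ (Sum.inr j) = ν j}.Finite := by
  set D : Set ℂ := (fun k : ℤ => (k : ℂ)) '' Set.Icc (-(N : ℤ)) N with hD
  have hDfin : (Set.univ.pi fun _ : Fin m × Fin m => D).Finite :=
    Set.Finite.pi fun _ => (Set.finite_Icc _ _).image _
  refine Set.Finite.of_injOn (f := fun μ (q : Fin m × Fin m) => μ (Sum.inl q.1) - μ (Sum.inl q.2))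
    ?_ ?_ hDfin
  · rintro μ ⟨hμ, -, -⟩ ⟨i, i'⟩ -
    obtain ⟨v, hv, hv0⟩ := Submodule.exists_mem_ne_zero_of_ne_bot hμ
    by_cases hi : i = i'
    · exact ⟨0, by simp, by simp [hi]⟩
    · obtain ⟨k, hk, hk'⟩ := exists_weight_difference hi (hN i i' hi) (hN i' i (Ne.symm hi)) hv hv0
      obtain ⟨l, hl, hl'⟩ := exists_weight_difference (Ne.symm hi) (hN i' i (Ne.symm hi))
        (hN i i' hi) hv hv0
      have hkl : l = -k := by
        have : (l : ℂ) = ((-k : ℤ) : ℂ) := by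
          rw [← hl', Int.cast_neg, ← hk', neg_sub]
        exact_mod_cast this
      exact ⟨k, ⟨by omega, hk⟩, hk'.symm⟩
  · rintro μ ⟨-, hμ, hμ'⟩ μ' ⟨-, hμ₁, hμ₁'⟩ h
    funext a
    rcases a with i | j
    · have h1 : ∑ i', (μ (Sum.inl i) - μ (Sum.inl i')) = ∑ i', (μ' (Sum.inl i) - μ' (Sum.inl i')) :=
        Finset.sum_congr rfl fun i' _ => congrFun h (i, i')
      rw [Finset.sum_sub_distrib, Finset.sum_sub_distrib, hμ, hμ₁] at h1
      simp only [Finset.sum_const, Finset.card_univ, Fintype.card_fin, nsmul_eq_mul] at h1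
      have hm : (m : ℂ) ≠ 0 := Nat.cast_ne_zero.2 (Nat.pos_iff_ne_zero.1 i.pos)
      exact mul_left_cancel₀ hm (sub_left_injective h1)
    · rw [hμ', hμ₁']

end FiniteWeights

/-! ### Boundedness of `F(P, M)` determines `M` -/

section Forward

variable {m n : ℕ} {M : Type v} [AddCommGroup M] [Module ℂ M] [SuperSpace M]
  {φ : LieSuperModule (GLSuper m n) M}

theorem topRep_single_inl (p : ZMod 2) (c : ℂ) (i i' : Fin m) (v : topSpace φ p c) :
    (topRep φ p c (Matrix.single i i' 1, 0) v : M) =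
      φ.act (unitMat (Sum.inl i) (Sum.inl i')) v := by
  rw [topRep_coe, unitMat_inl]

theorem topRep_single_inr (p : ZMod 2) (c : ℂ) (j j' : Fin n) (v : topSpace φ p c) :
    (topRep φ p c (0, Matrix.single j j' 1) v : M) =
      φ.act (unitMat (Sum.inr j) (Sum.inr j')) v := by
  rw [topRep_coe, unitMat_inr]

/-- The vectors of the top space with prescribed odd weight coordinates. -/
def oddSlice (φ : LieSuperModule (GLSuper m n) M) (p : ZMod 2) (c : ℂ) (ν : Fin n → ℂ) :
    Submodule ℂ (topSpace φ p c) :=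
  ⨅ j, ((φ.cartan (Sum.inr j)).eigenspace (ν j)).comap (topSpace φ p c).subtype

theorem mem_oddSlice {p : ZMod 2} {c : ℂ} {ν : Fin n → ℂ} {v : topSpace φ p c} :
    v ∈ oddSlice φ p c ν ↔ ∀ j, φ.cartan (Sum.inr j) v = ν j • (v : M) := by
  simp [oddSlice]

/-- The elements of `𝔤𝔩ₘ` do not change the odd weight coordinates. -/
theorem oddSlice_stable {p : ZMod 2} {c : ℂ} {ν : Fin n → ℂ} (x : Matrix (Fin m) (Fin m) ℂ)
    {v : topSpace φ p c} (hv : v ∈ oddSlice φ p c ν) :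
    topRep φ p c (x, 0) v ∈ oddSlice φ p c ν := by
  rw [mem_oddSlice] at *
  intro j
  have key : ∀ a b, φ.cartan (Sum.inr j) ((upper (x, 0) 0 : GLSuper m n) a b •
      φ.act (unitMat a b) (v : M)) = ν j • ((upper (x, 0) 0 : GLSuper m n) a b •
      φ.act (unitMat a b) (v : M)) := by
    intro a b
    rcases a with a | a <;> rcases b with b | b
    · rw [map_smul, cartan_act_unitMat, hv j, map_smul, smul_comm (ν j)]
      simp
    all_goals simp [upper]
  rw [topRep_coe, act_eq_sum]
  simp only [map_sum, key, Finset.smul_sum]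

/-- When the off-diagonal matrix units of `𝔤𝔩ₘ` are nilpotent and the weight spaces are
finite-dimensional, prescribing the odd weight coordinates cuts out a finite-dimensional subspace
of the top space. -/
theorem finiteDimensional_oddSlice (hw : IsWeight φ.cartan) {N : ℕ}
    (hdim : ∀ μ, Module.rank ℂ (weightSpace φ.cartan μ) ≤ N)
    (hN : ∀ i i' : Fin m, i ≠ i' → φ.act (unitMat (Sum.inl i) (Sum.inl i')) ^ N = 0)
    (p : ZMod 2) (c : ℂ) (ν : Fin n → ℂ) : FiniteDimensional ℂ (oddSlice φ p c ν) := by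
  set Y := (oddSlice φ p c ν).map (topSpace φ p c).subtype with hY
  set s := (finite_weights hN c ν).toFinset with hs
  have hYinv : ∀ a, ∀ v ∈ Y, φ.cartan a v ∈ Y := by
    rintro (i | j) _ ⟨v, hv, rfl⟩
    · exact ⟨_, oddSlice_stable (Matrix.single i i 1) hv, topRep_single_inl p c i i v⟩
    · have h := mem_oddSlice.1 hv j
      refine ⟨ν j • v, Submodule.smul_mem _ _ hv, ?_⟩
      rw [map_smul]
      exact h.symm
  have hle : Y ≤ s.sup (weightSpace φ.cartan) := by
    refine (le_iSup_inf_weightSpace hw hYinv).trans (iSup_le fun μ => ?_)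
    rintro v ⟨⟨w, hw', rfl⟩, hv⟩
    by_cases hv0 : (topSpace φ p c).subtype w = 0
    · rw [hv0]; exact zero_mem _
    · have hμ : μ ∈ s := by
        rw [hs, Set.Finite.mem_toFinset]
        refine ⟨Submodule.ne_bot_iff _ |>.2 ⟨_, hv, hv0⟩, ?_, fun j => ?_⟩
        · have h1 := (mem_topSpace.1 w.2).2.1
          have h2 : ∀ a, φ.cartan a (w : M) = μ a • (w : M) := mem_weightSpace.1 hv
          simp only [gradOp, LinearMap.sum_apply, h2, ← Finset.sum_smul] at h1
          exact smul_left_injective ℂ hv0 h1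
        · exact smul_left_injective ℂ hv0
            ((mem_weightSpace.1 hv (Sum.inr j)).symm.trans (mem_oddSlice.1 hw' j))
      exact (Finset.le_sup hμ : weightSpace φ.cartan μ ≤ _) hv
  have hfin : FiniteDimensional ℂ (s.sup (weightSpace φ.cartan) : Submodule ℂ M) := by
    refine Module.rank_lt_aleph0_iff.1 ?_
    exact (rank_finset_sup_le s _ N fun μ _ => hdim μ).trans_lt Cardinal.natCast_lt_aleph0
  have hYfin : FiniteDimensional ℂ Y := Submodule.finiteDimensional_of_le hle
  exact LinearEquiv.finiteDimensional (Submodule.equivMapOfInjective _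
    (Submodule.injective_subtype _) (oddSlice φ p c ν)).symm

theorem isGradedSimple_parityChange (h : IsGradedSimple φ.act) :
    IsGradedSimple φ.parityChange.act := by
  refine ⟨h.1, fun N hN => h.2 N ⟨fun v hv => ?_, hN.act_mem⟩⟩
  have := N.neg_mem (hN.parity_mem v hv)
  rwa [show -(parity (V := ParityChange M) v) = (parity v : M) from neg_neg _] at this

theorem isomorphic_parityChange {L : Type*} [AddCommGroup L] [Module ℂ L] [SuperSpace L]
    {ψ : LieSuperModule (GLSuper m n) L} (h : φ.parityChange.Isomorphic ψ) :
    φ.Isomorphic ψ.parityChange := by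
  obtain ⟨e, he, he'⟩ := h
  refine ⟨(e : M ≃ₗ[ℂ] L), fun v => ?_, he'⟩
  have h1 : e (-(parity v : M) : M) = parity (e v) := he v
  change e (parity v : M) = -parity (e v)
  rw [← h1]
  exact (neg_eq_iff_eq_neg.2 (map_neg e _)).symm

/-- A simple weight module with bounded weight multiplicities and nilpotent off-diagonal
`𝔤𝔩ₘ`-matrix units is the simple top of a Kac module of the asserted kind. -/
theorem exists_isomorphic_LModule (hsimple : IsGradedSimple φ.act) (hw : IsWeight φ.cartan)
    {N : ℕ} (hdim : ∀ μ, Module.rank ℂ (weightSpace φ.cartan μ) ≤ N)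
    (hN : ∀ i i' : Fin m, i ≠ i' → φ.act (unitMat (Sum.inl i) (Sum.inl i')) ^ N = 0) :
    ∃ (V₁ V₂ : Type v)
      (_ : AddCommGroup V₁) (_ : Module ℂ V₁) (_ : LieRingModule (Matrix (Fin m) (Fin m) ℂ) V₁)
      (_ : LieModule ℂ (Matrix (Fin m) (Fin m) ℂ) V₁)
      (_ : AddCommGroup V₂) (_ : Module ℂ V₂) (_ : LieRingModule (Matrix (Fin n) (Fin n) ℂ) V₂)
      (_ : LieModule ℂ (Matrix (Fin n) (Fin n) ℂ) V₂),
      FiniteDimensional ℂ V₁ ∧ LieModule.IsIrreducible ℂ (Matrix (Fin m) (Fin m) ℂ) V₁ ∧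
      LieModule.IsIrreducible ℂ (Matrix (Fin n) (Fin n) ℂ) V₂ ∧ IsBounded (glCartan n V₂) ∧
      (φ.Isomorphic (LModule (outerTensor m n V₁ V₂)) ∨
        φ.Isomorphic (LModule (outerTensor m n V₁ V₂)).parityChange) := by
  have := hsimple.1
  obtain ⟨p, μ, v, hv0, hv, hvp, hvr⟩ := exists_singular_vector φ hw
  set c := ∑ i, μ (Sum.inl i) with hc
  have hvtop : v ∈ topSpace φ p c := by
    refine mem_topSpace.2 ⟨hvp, ?_, hvr⟩
    simp only [gradOp, LinearMap.sum_apply, mem_weightSpace.1 hv, hc, Finset.sum_smul]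
  set ν : Fin n → ℂ := fun j => μ (Sum.inr j) with hν
  have hslice : (⟨v, hvtop⟩ : topSpace φ p c) ∈ oddSlice φ p c ν :=
    mem_oddSlice.2 fun j => mem_weightSpace.1 hv (Sum.inr j)
  have hfin := finiteDimensional_oddSlice hw hdim hN p c ν
  obtain ⟨V₁, V₂, i1, i2, i3, i4, i5, i6, i7, i8, hfd, hirr₁, hirr₂, e, he⟩ :=
    exists_outerTensor (topRep φ p c) (topRep_irreducible hsimple) (oddSlice φ p c ν)
      ((Submodule.ne_bot_iff _).2 ⟨_, hslice, fun h => hv0 (congrArg Subtype.val h)⟩)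
      fun x w hw => oddSlice_stable x hw
  refine ⟨V₁, V₂, i1, i2, i3, i4, i5, i6, i7, i8, hfd, hirr₁, hirr₂, ?_, ?_⟩
  · have hnt : Nontrivial V₁ :=
      LieModule.nontrivial_of_isIrreducible ℂ (Matrix (Fin m) (Fin m) ℂ) V₁
    obtain ⟨κ, w, hwκ, hw0⟩ := exists_weight_vector (isWeight_glCartan (k := m) (V := V₁))
    -- `V₂` embeds into `M` by `x ↦ w ⊗ x`, for a fixed weight vector `w` of `V₁`
    let j : V₂ →ₗ[ℂ] M := (topSpace φ p c).subtype ∘ₗ e.toLinearMap ∘ₗ TensorProduct.mk ℂ V₁ V₂ w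
    have hj : Function.Injective j :=
      (Submodule.injective_subtype _).comp (e.injective.comp (tmul_left_injective hw0))
    have hj₂ : ∀ l x, j (glCartan n V₂ l x) = φ.cartan (Sum.inr l) (j x) := by
      intro l x
      have h := he (0, Matrix.single l l 1) (w ⊗ₜ x)
      have h0 : outerTensor m n V₁ V₂ (0, Matrix.single l l 1) (w ⊗ₜ x) =
          w ⊗ₜ glCartan n V₂ l x := by
        change ⁅(0 : Matrix (Fin m) (Fin m) ℂ), w⁆ ⊗ₜ x + w ⊗ₜ glCartan n V₂ l x = _
        rw [zero_lie, TensorProduct.zero_tmul, zero_add]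
      rw [h0] at h
      exact (congrArg Subtype.val h).trans (topRep_single_inr p c l l _)
    have hj₁ : ∀ l x, φ.cartan (Sum.inl l) (j x) = κ l • j x := by
      intro l x
      have h := he (Matrix.single l l 1, 0) (w ⊗ₜ x)
      have h0 : outerTensor m n V₁ V₂ (Matrix.single l l 1, 0) (w ⊗ₜ x) = κ l • (w ⊗ₜ x) := by
        change (glCartan m V₁ l w) ⊗ₜ x + w ⊗ₜ ⁅(0 : Matrix (Fin n) (Fin n) ℂ), x⁆ = _
        rw [zero_lie, TensorProduct.tmul_zero, add_zero, mem_weightSpace.1 hwκ,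
          TensorProduct.smul_tmul']
      rw [h0, map_smul] at h
      exact (topRep_single_inl p c l l _).symm.trans (congrArg Subtype.val h).symm
    refine ⟨(hw.comp Sum.inr).of_injective j hj hj₂, N, fun wt => ?_⟩
    refine rank_le_natCast_of_injective (j.restrict (p := weightSpace (glCartan n V₂) wt)
      (q := weightSpace φ.cartan (Sum.elim κ wt)) fun x hx => mem_weightSpace.2 ?_) ?_ (hdim _)
    · rintro (l | l)
      · exact hj₁ l x
      · rw [← hj₂, mem_weightSpace.1 hx, map_smul]
        rfl
    · intro x y h
      have h' : j x = j y :=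
        congrArg (fun z : weightSpace φ.cartan (Sum.elim κ wt) => (z : M)) h
      exact Subtype.ext (hj h')
  · have hnt : Nontrivial (V₁ ⊗[ℂ] V₂) := by
      refine e.toEquiv.nontrivial_congr.2 ⟨⟨v, hvtop⟩, 0, fun h => hv0 (congrArg Subtype.val h)⟩
    have hinj : Function.Injective ((topSpace φ p c).subtype ∘ₗ e.toLinearMap) :=
      (Submodule.injective_subtype _).comp e.injective
    have hup : ∀ X Z t, φ.act (upper X Z) (((topSpace φ p c).subtype ∘ₗ e.toLinearMap) t) =
        ((topSpace φ p c).subtype ∘ₗ e.toLinearMap) (outerTensor m n V₁ V₂ X t) := by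
      intro X Z t
      change φ.act (upper X Z) (e t : M) = (e (outerTensor m n V₁ V₂ X t) : M)
      rw [he, topRep_coe, topSpace_act_upper (e t).2]
    have hgrad : ∀ t, gradOp φ (((topSpace φ p c).subtype ∘ₗ e.toLinearMap) t) =
        c • ((topSpace φ p c).subtype ∘ₗ e.toLinearMap) t := fun t => (mem_topSpace.1 (e t).2).2.1
    have hpar : ∀ t, parity (((topSpace φ p c).subtype ∘ₗ e.toLinearMap) t) =
        sg p • ((topSpace φ p c).subtype ∘ₗ e.toLinearMap) t := fun t => (mem_topSpace.1 (e t).2).1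
    obtain rfl | rfl := par_cases p
    · left
      refine isomorphic_LModule (outerTensor m n V₁ V₂) hsimple hinj hup (fun t => ?_) hgrad
      rw [hpar, sg_zero, one_smul]
    · right
      refine isomorphic_parityChange (isomorphic_LModule (φ := φ.parityChange)
        (j := ((topSpace φ 1 c).subtype ∘ₗ e.toLinearMap : (V₁ ⊗[ℂ] V₂) →ₗ[ℂ] M))
        (outerTensor m n V₁ V₂) (isGradedSimple_parityChange hsimple) hinj hup (fun t => ?_) hgrad)
      have h := hpar t
      rw [sg_one, neg_smul, one_smul] at h
      exact neg_eq_iff_eq_neg.2 h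

end Forward

/-! ### Boundedness of `F(P, M)` from that of `V₂` -/

section ShiftSpanned

variable {m n : ℕ} {M : Type*} [AddCommGroup M] [Module ℂ M] [SuperSpace M]
  (φ : LieSuperModule (GLSuper m n) M) (V₂ : Type*) [AddCommGroup V₂] [Module ℂ V₂]
  [LieRingModule (Matrix (Fin n) (Fin n) ℂ) V₂] [LieModule ℂ (Matrix (Fin n) (Fin n) ℂ) V₂]

/-- `X` is contained in a finite sum of images of `V₂` under linear maps that send weight vectors to
weight vectors and translate the weights, a weight of `V₂` being extended by `0` to the even
coordinates. -/
def IsShiftSpanned (X : Submodule ℂ M) : Prop :=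
  ∃ (T : Type) (_ : Fintype T) (θ : T → V₂ →ₗ[ℂ] M) (β : T → Fin m ⊕ Fin n → ℂ),
    (∀ s μ, ∀ x ∈ weightSpace (glCartan n V₂) μ,
      θ s x ∈ weightSpace φ.cartan (β s + Sum.elim (0 : Fin m → ℂ) μ)) ∧
      X ≤ ⨆ s, LinearMap.range (θ s)

variable {φ V₂}

theorem IsShiftSpanned.mono {X Y : Submodule ℂ M} (hY : IsShiftSpanned φ V₂ Y) (h : X ≤ Y) :
    IsShiftSpanned φ V₂ X := by
  obtain ⟨T, i, θ, β, h1, h2⟩ := hY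
  exact ⟨T, i, θ, β, h1, h.trans h2⟩

theorem IsShiftSpanned.sup {X Y : Submodule ℂ M} (hX : IsShiftSpanned φ V₂ X)
    (hY : IsShiftSpanned φ V₂ Y) : IsShiftSpanned φ V₂ (X ⊔ Y) := by
  obtain ⟨T, i, θ, β, h1, h2⟩ := hX
  obtain ⟨T', i', θ', β', h1', h2'⟩ := hY
  refine ⟨T ⊕ T', inferInstance, Sum.elim θ θ', Sum.elim β β', ?_, sup_le ?_ ?_⟩
  · rintro (s | s)
    · exact h1 s
    · exact h1' s
  · exact h2.trans (iSup_le fun s =>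
      le_iSup (fun s => LinearMap.range (Sum.elim θ θ' s)) (Sum.inl s))
  · exact h2'.trans (iSup_le fun s =>
      le_iSup (fun s => LinearMap.range (Sum.elim θ θ' s)) (Sum.inr s))

theorem IsShiftSpanned.map {X : Submodule ℂ M} (hX : IsShiftSpanned φ V₂ X)
    (a b : Fin m ⊕ Fin n) : IsShiftSpanned φ V₂ (X.map (φ.act (unitMat a b))) := by
  obtain ⟨T, i, θ, β, h1, h2⟩ := hX
  refine ⟨T, i, fun s => φ.act (unitMat a b) ∘ₗ θ s,
    fun s => β s + Pi.single a 1 - Pi.single b 1, ?_, ?_⟩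
  · intro s μ x hx
    have h := act_unitMat_mem_weightSpace (h1 s μ x hx) a b
    rw [show β s + Sum.elim (0 : Fin m → ℂ) μ + Pi.single a 1 - Pi.single b 1 =
      β s + Pi.single a 1 - Pi.single b 1 + Sum.elim (0 : Fin m → ℂ) μ by abel] at h
    exact h
  · refine (Submodule.map_mono h2).trans ?_
    rw [Submodule.map_iSup]
    refine iSup_mono fun s => ?_
    rw [LinearMap.range_comp]

/-- The span of the images of `B` under products of distinct lowering matrix units taken from a
list. -/
def lowerList (φ : LieSuperModule (GLSuper m n) M) (B : Submodule ℂ M) :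
    List (Fin n × Fin m) → Submodule ℂ M
  | [] => B
  | q :: l => lowerList φ B l ⊔
      (lowerList φ B l).map (φ.act (unitMat (Sum.inr q.1) (Sum.inl q.2)))

theorem le_lowerList (B : Submodule ℂ M) (l : List (Fin n × Fin m)) : B ≤ lowerList φ B l := by
  induction l with
  | nil => exact le_rfl
  | cons q l ih => exact ih.trans le_sup_left

/-- Anticommutation moves a further factor to the place of its equal in the product, where the
square vanishes, so products without repetitions suffice. -/
theorem lowerList_stable (B : Submodule ℂ M) {l : List (Fin n × Fin m)} {q : Fin n × Fin m}
    (hq : q ∈ l) {v : M} (hv : v ∈ lowerList φ B l) :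
    φ.act (unitMat (Sum.inr q.1) (Sum.inl q.2)) v ∈ lowerList φ B l := by
  induction l generalizing v with
  | nil => simp at hq
  | cons r l ih =>
    obtain ⟨x, hx, _, ⟨y, hy, rfl⟩, rfl⟩ := Submodule.mem_sup.1 hv
    rw [map_add]
    rcases List.mem_cons.1 hq with rfl | hq
    · -- the square of an odd matrix unit acts by zero
      rw [eq_zero_of_eq_neg (lower_comm φ q.2 q.2 q.1 q.1 y), add_zero]
      exact Submodule.mem_sup_right ⟨x, hx, rfl⟩
    · rw [lower_comm φ q.2 r.2 q.1 r.1 y]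
      exact add_mem (Submodule.mem_sup_left (ih hq hx))
        (neg_mem (Submodule.mem_sup_right ⟨_, ih hq hy, rfl⟩))

theorem IsShiftSpanned.lowerSpan {B : Submodule ℂ M} (hB : IsShiftSpanned φ V₂ B) :
    IsShiftSpanned φ V₂ (lowerSpan φ B) := by
  have h : ∀ l, IsShiftSpanned φ V₂ (lowerList φ B l) := by
    intro l
    induction l with
    | nil => exact hB
    | cons q l ih => exact ih.sup (ih.map _ _)
  refine (h Finset.univ.toList).mono (lowerSpan_le (le_lowerList B _) fun j i x hx => ?_)
  exact lowerList_stable B (q := (j, i)) (Finset.mem_toList.2 (Finset.mem_univ _)) hx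

end ShiftSpanned

section Converse

variable {m n : ℕ}

/-- Schur's lemma for the identity matrix, which is central in `𝔤𝔩ₘ`. -/
theorem exists_scalar_of_irreducible (V : Type*) [AddCommGroup V] [Module ℂ V]
    [LieRingModule (Matrix (Fin m) (Fin m) ℂ) V] [LieModule ℂ (Matrix (Fin m) (Fin m) ℂ) V]
    [FiniteDimensional ℂ V] [hirr : LieModule.IsIrreducible ℂ (Matrix (Fin m) (Fin m) ℂ) V] :
    ∃ c : ℂ, ∀ v : V, ⁅(1 : Matrix (Fin m) (Fin m) ℂ), v⁆ = c • v := by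
  have : Nontrivial V := LieModule.nontrivial_of_isIrreducible ℂ (Matrix (Fin m) (Fin m) ℂ) V
  obtain ⟨c, hc⟩ := Module.End.exists_eigenvalue
    (LieModule.toEnd ℂ (Matrix (Fin m) (Fin m) ℂ) V 1)
  obtain ⟨w, hw⟩ := hc.exists_hasEigenvector
  let N : LieSubmodule ℂ (Matrix (Fin m) (Fin m) ℂ) V :=
    { Module.End.eigenspace (LieModule.toEnd ℂ (Matrix (Fin m) (Fin m) ℂ) V 1) c with
      lie_mem := by
        intro x v hv
        have hv' : ⁅(1 : Matrix (Fin m) (Fin m) ℂ), v⁆ = c • v := Module.End.mem_eigenspace_iff.1 hv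
        refine Module.End.mem_eigenspace_iff.2 ?_
        have h1 : ⁅(1 : Matrix (Fin m) (Fin m) ℂ), x⁆ = 0 := by
          rw [LieRing.of_associative_ring_bracket, one_mul, mul_one, sub_self]
        rw [LieModule.toEnd_apply_apply, leibniz_lie, h1, zero_lie, zero_add, hv', lie_smul] }
  have hN : N = ⊤ := (hirr.eq_bot_or_eq_top N).resolve_left fun h => hw.2 (by
    have hmem : w ∈ N := hw.1
    rw [h] at hmem
    exact (LieSubmodule.mem_bot w).1 hmem)
  refine ⟨c, fun v => ?_⟩
  have hv : v ∈ N := hN ▸ LieSubmodule.mem_top v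
  exact Module.End.mem_eigenspace_iff.1 hv

theorem exists_finite_weight_span {ι V : Type*} [AddCommGroup V] [Module ℂ V]
    [FiniteDimensional ℂ V] {h : ι → Module.End ℂ V} (hw : IsWeight h) :
    ∃ (d : ℕ) (w : Fin d → V) (κ : Fin d → ι → ℂ), (∀ s, w s ∈ weightSpace h (κ s)) ∧
      Submodule.span ℂ (Set.range w) = ⊤ := by
  set S : Set V := {v | ∃ wt, v ∈ weightSpace h wt} with hS
  have hspan : Submodule.span ℂ S = ⊤ := by
    rw [eq_top_iff, ← hw]
    exact iSup_le fun wt v hv => Submodule.subset_span ⟨wt, hv⟩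
  obtain ⟨b, hbS, hb, hli⟩ := exists_linearIndependent ℂ S
  have hfin : b.Finite := hli.setFinite
  have : Fintype b := hfin.fintype
  let e := Fintype.equivFin b
  choose κ hκ using fun s : Fin (Fintype.card b) => hbS (e.symm s).2
  refine ⟨_, fun s => (e.symm s : V), κ, hκ, ?_⟩
  have : Set.range (fun s => (e.symm s : V)) = b := by
    rw [Set.range_comp' Subtype.val e.symm, e.symm.surjective.range_eq, Set.image_univ,
      Subtype.range_coe]
  rw [this, hb, hspan]

variable {M : Type*} [AddCommGroup M] [Module ℂ M] [SuperSpace M]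
  {φ : LieSuperModule (GLSuper m n) M}

/-- A quotient of the Kac module of `V₁ ⊗ V₂`, with `V₁` finite-dimensional, is a finite sum of
translated images of `V₂`. -/
theorem isShiftSpanned_top (V₁ V₂ : Type*) [AddCommGroup V₁] [Module ℂ V₁]
    [LieRingModule (Matrix (Fin m) (Fin m) ℂ) V₁] [LieModule ℂ (Matrix (Fin m) (Fin m) ℂ) V₁]
    [AddCommGroup V₂] [Module ℂ V₂]
    [LieRingModule (Matrix (Fin n) (Fin n) ℂ) V₂] [LieModule ℂ (Matrix (Fin n) (Fin n) ℂ) V₂]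
    [FiniteDimensional ℂ V₁] [LieModule.IsIrreducible ℂ (Matrix (Fin m) (Fin m) ℂ) V₁]
    (π : Kac (outerTensor m n V₁ V₂) →ₗ[ℂ] M) (hsurj : Function.Surjective π)
    (hact : ∀ x w, π ((Kac.module (outerTensor m n V₁ V₂)).act x w) = φ.act x (π w)) :
    IsShiftSpanned φ V₂ (⊤ : Submodule ℂ M) := by
  obtain ⟨c, hc⟩ := exists_scalar_of_irreducible (m := m) V₁
  have hc' : ∀ t, outerTensor m n V₁ V₂ (1, 0) t = c • t := by
    intro t
    induction t using TensorProduct.induction_on with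
    | zero => simp
    | add s t hs ht => rw [map_add, hs, ht, smul_add]
    | tmul v x =>
      change ⁅(1 : Matrix (Fin m) (Fin m) ℂ), v⁆ ⊗ₜ x + v ⊗ₜ ⁅(0 : Matrix (Fin n) (Fin n) ℂ), x⁆ = _
      rw [hc, zero_lie, TensorProduct.tmul_zero, add_zero, TensorProduct.smul_tmul']
  set B : Submodule ℂ M := LinearMap.range (π ∘ₗ Kac.top (outerTensor m n V₁ V₂))
  have htop : lowerSpan φ B = ⊤ := by
    have h : lowerSpan (Kac.module (outerTensor m n V₁ V₂))
        (LinearMap.range (Kac.top (outerTensor m n V₁ V₂))) ≤ (lowerSpan φ B).comap π := by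
      refine lowerSpan_le ?_ fun j i x hx => ?_
      · rintro _ ⟨t, rfl⟩
        exact le_lowerSpan (φ := φ) ⟨t, rfl⟩
      · rw [Submodule.mem_comap, hact]
        have : lowerSpan φ B ≤ (lowerSpan φ B).comap
            (φ.act (unitMat (Sum.inr j) (Sum.inl i))) := iSup_le fun k v hv =>
          Submodule.mem_iSup_of_mem (k + 1) (lower_mem_lowerIter hv j i)
        exact this hx
    rw [Kac.lowerSpan_eq_top (outerTensor m n V₁ V₂) hc'] at h
    rw [eq_top_iff]
    intro v _
    obtain ⟨w, rfl⟩ := hsurj v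
    exact h trivial
  rw [← htop]
  refine IsShiftSpanned.lowerSpan ?_
  obtain ⟨d, w, κ, hwκ, hspan⟩ := exists_finite_weight_span (isWeight_glCartan (k := m) (V := V₁))
  refine ⟨Fin d, inferInstance,
    fun s => π ∘ₗ Kac.top (outerTensor m n V₁ V₂) ∘ₗ TensorProduct.mk ℂ V₁ V₂ (w s),
    fun s => Sum.elim (κ s) (0 : Fin n → ℂ), ?_, ?_⟩
  · intro s μ x hx
    have hcart : ∀ X : GLEven m n,
        φ.act (upper X 0) (π (Kac.top (outerTensor m n V₁ V₂) (w s ⊗ₜ x))) =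
        π (Kac.top (outerTensor m n V₁ V₂) (outerTensor m n V₁ V₂ X (w s ⊗ₜ x))) := by
      intro X
      rw [← hact, Kac.act_upper_top]
    refine mem_weightSpace.2 ?_
    rintro (i | j)
    · have h0 : outerTensor m n V₁ V₂ (Matrix.single i i 1, 0) (w s ⊗ₜ x) = κ s i • (w s ⊗ₜ x) := by
        change (glCartan m V₁ i (w s)) ⊗ₜ x + w s ⊗ₜ ⁅(0 : Matrix (Fin n) (Fin n) ℂ), x⁆ = _
        rw [zero_lie, TensorProduct.tmul_zero, add_zero, mem_weightSpace.1 (hwκ s),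
          TensorProduct.smul_tmul']
      have h := hcart (Matrix.single i i 1, 0)
      rw [h0, map_smul, map_smul, ← unitMat_inl] at h
      simpa using! h
    · have h0 : outerTensor m n V₁ V₂ (0, Matrix.single j j 1) (w s ⊗ₜ x) = μ j • (w s ⊗ₜ x) := by
        change ⁅(0 : Matrix (Fin m) (Fin m) ℂ), w s⁆ ⊗ₜ x + w s ⊗ₜ glCartan n V₂ j x = _
        rw [zero_lie, TensorProduct.zero_tmul, zero_add, mem_weightSpace.1 hx,
          TensorProduct.tmul_smul]
      have h := hcart (0, Matrix.single j j 1)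
      rw [h0, map_smul, map_smul, ← unitMat_inr] at h
      simpa using! h
  · rintro _ ⟨t, rfl⟩
    induction t using TensorProduct.induction_on with
    | zero => rw [map_zero]; exact zero_mem _
    | add s t hs ht => rw [map_add]; exact add_mem hs ht
    | tmul v x =>
      have hv : v ∈ Submodule.span ℂ (Set.range w) := by rw [hspan]; trivial
      induction hv using Submodule.span_induction with
      | mem v hv =>
        obtain ⟨s, rfl⟩ := hv
        exact Submodule.mem_iSup_of_mem s ⟨x, rfl⟩
      | zero => rw [TensorProduct.zero_tmul, map_zero]; exact zero_mem _
      | add v v' _ _ h h' => rw [TensorProduct.add_tmul, map_add]; exact add_mem h h'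
      | smul r v _ h =>
        rw [← TensorProduct.smul_tmul', map_smul]
        exact Submodule.smul_mem _ r h

variable {P : Type*} [AddCommGroup P] [Module ℂ P] [SuperSpace P] {ρ : WeylModule m n P}

/-- If `M` is a finite sum of translated images of a bounded `𝔤𝔩ₙ`-module, then `F(P, M)` is
bounded: the even weight coordinates determine the monomial in the even variables, and there are at
most `3 ^ n` possibilities for the odd variables. -/
theorem isBounded_tensorModule {V₂ : Type*} [AddCommGroup V₂] [Module ℂ V₂]
    [LieRingModule (Matrix (Fin n) (Fin n) ℂ) V₂] [LieModule ℂ (Matrix (Fin n) (Fin n) ℂ) V₂]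
    (hsimple : IsGradedSimple ρ.act) (hP : IsWeight ρ.cartan)
    (hV₂ : IsBounded (glCartan n V₂)) (hM : IsShiftSpanned φ V₂ (⊤ : Submodule ℂ M)) :
    IsBounded (tensorModule ρ φ).cartan := by
  obtain ⟨lam, e, he, he0, hespan⟩ := ρ.exists_weight_span hsimple hP
  obtain ⟨T, hT, θ, β, hθ, hθtop⟩ := hM
  obtain ⟨hV₂w, N, hN⟩ := hV₂
  let J : T → (Fin m ⊕ Fin n → ℤ) → V₂ →ₗ[ℂ] P ⊗[ℂ] M := fun s k =>
    TensorProduct.mk ℂ P M (e k) ∘ₗ θ s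
  let X : T × (Fin m ⊕ Fin n → ℤ) × (Fin n → ℂ) → Submodule ℂ (P ⊗[ℂ] M) := fun τ =>
    (weightSpace (glCartan n V₂) τ.2.2).map (J τ.1 τ.2.1)
  let wt : T × (Fin m ⊕ Fin n → ℤ) × (Fin n → ℂ) → Fin m ⊕ Fin n → ℂ := fun τ =>
    (fun a => lam a + τ.2.1 a) + (β τ.1 + Sum.elim (0 : Fin m → ℂ) τ.2.2)
  have hX : ∀ τ, X τ ≤ weightSpace (tensorModule ρ φ).cartan (wt τ) := by
    rintro ⟨s, k, μ⟩ _ ⟨x, hx, rfl⟩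
    exact tmul_mem_weightSpace ρ φ (he k) (hθ s μ x hx)
  have htop : ⨆ τ, X τ = ⊤ := by
    rw [eq_top_iff, ← TensorProduct.span_tmul_eq_top, Submodule.span_le]
    rintro _ ⟨u, x, rfl⟩
    have hu : u ∈ Submodule.span ℂ (Set.range e) := by rw [hespan]; trivial
    rw [SetLike.mem_coe]
    induction hu using Submodule.span_induction with
    | zero => rw [TensorProduct.zero_tmul]; exact zero_mem _
    | add v v' _ _ h h' => rw [TensorProduct.add_tmul]; exact add_mem h h'
    | smul r v _ h => rw [← TensorProduct.smul_tmul']; exact Submodule.smul_mem _ r h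
    | mem u hu =>
      obtain ⟨k, rfl⟩ := hu
      have h1 : (⊤ : Submodule ℂ M) ≤ (⨆ τ, X τ).comap (TensorProduct.mk ℂ P M (e k)) := by
        refine hθtop.trans (iSup_le fun s => ?_)
        rintro _ ⟨y, rfl⟩
        have h2 : (⊤ : Submodule ℂ V₂) ≤ (⨆ τ, X τ).comap (J s k) := by
          refine hV₂w.symm.le.trans (iSup_le fun μ y hy => ?_)
          exact Submodule.mem_iSup_of_mem (s, k, μ) ⟨y, hy, rfl⟩
        exact h2 trivial
      exact h1 trivial
  refine ⟨?_, Fintype.card (T × (Fin n → Fin 3)) * N, fun ν => ?_⟩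
  · rw [IsWeight, eq_top_iff, ← htop]
    exact iSup_le fun τ => (hX τ).trans (le_iSup (weightSpace (tensorModule ρ φ).cartan) (wt τ))
  classical
  -- the even part of the exponent is determined by the index `s` and the even part of `ν`
  let ke : T → Fin m → ℤ := fun s =>
    if h : ∃ k : Fin m → ℤ, ∀ i, lam (Sum.inl i) + k i + β s (Sum.inl i) = ν (Sum.inl i)
    then h.choose else 0
  let K : T × (Fin n → Fin 3) → Fin m ⊕ Fin n → ℤ := fun q =>
    Sum.elim (ke q.1) fun j => (q.2 j : ℕ) - 1
  let μ : T × (Fin n → Fin 3) → Fin n → ℂ := fun q j =>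
    ν (Sum.inr j) - (lam (Sum.inr j) + K q (Sum.inr j)) - β q.1 (Sum.inr j)
  let Z : T × (Fin n → Fin 3) → Submodule ℂ (P ⊗[ℂ] M) := fun q => X (q.1, K q, μ q)
  have hle : weightSpace (tensorModule ρ φ).cartan ν ≤ Finset.univ.sup Z := by
    refine (weightSpace_le_iSup hX htop ν).trans (iSup₂_le ?_)
    rintro ⟨s, k, κ⟩ hτ
    by_cases hbig : ∃ j, 2 ≤ |k (Sum.inr j)|
    · obtain ⟨j, hj⟩ := hbig
      rintro _ ⟨x, -, rfl⟩
      change e k ⊗ₜ θ s x ∈ _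
      rw [he0 k j hj, TensorProduct.zero_tmul]
      exact zero_mem _
    · push Not at hbig
      have hlt : ∀ j, (k (Sum.inr j) + 1).toNat < 3 := fun j => by
        have := abs_lt.1 (hbig j); omega
      let q : T × (Fin n → Fin 3) := (s, fun j => ⟨(k (Sum.inr j) + 1).toNat, hlt j⟩)
      have hinl : ∀ i, lam (Sum.inl i) + k (Sum.inl i) + β s (Sum.inl i) = ν (Sum.inl i) := by
        intro i
        have h := congrFun hτ (Sum.inl i)
        simp [wt] at h
        exact h
      have hke : ke s = fun i => k (Sum.inl i) := by
        have hex : ∃ k : Fin m → ℤ, ∀ i,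
            lam (Sum.inl i) + k i + β s (Sum.inl i) = ν (Sum.inl i) := ⟨_, hinl⟩
        have h1 : ke s = hex.choose := dif_pos hex
        funext i
        have h2 := (hex.choose_spec i).trans (hinl i).symm
        have h3 : ((hex.choose i : ℤ) : ℂ) = (k (Sum.inl i) : ℂ) := by linear_combination h2
        rw [h1]
        exact_mod_cast h3
      have hK : K q = k := by
        funext a
        rcases a with i | j
        · exact congrFun hke i
        · have := abs_lt.1 (hbig j)
          change (((k (Sum.inr j) + 1).toNat : ℕ) : ℤ) - 1 = k (Sum.inr j)
          omega
      have hμ : μ q = κ := by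
        funext j
        have h := congrFun hτ (Sum.inr j)
        simp [wt] at h
        simp only [μ, hK]
        rw [← h]
        ring
      have hZ : Z q = X (s, k, κ) := by
        change X (q.1, K q, μ q) = _
        rw [hK, hμ]
      rw [← hZ]
      exact Finset.le_sup (Finset.mem_univ q)
  have h1 := rank_finset_sup_le Finset.univ Z N fun q _ => rank_map_le_natCast _ _ (hN _)
  exact (Submodule.rank_mono hle).trans h1

end Converse

end SuperLie

end

theorem lemma3p7 (m n : ℕ) (hmn : (m, n) ≠ (0, 0))
    {P : Type u} [AddCommGroup P] [Module ℂ P] [SuperSpace P] (ρ : WeylModule m n P)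
    (hP_simple : IsGradedSimple ρ.act) (hP_weight : IsWeight ρ.cartan)
    {M : Type v} [AddCommGroup M] [Module ℂ M] [SuperSpace M]
    (φ : LieSuperModule (GLSuper m n) M)
    (hM_simple : IsGradedSimple φ.act) (hM_weight : IsWeight φ.cartan) :
    IsBounded (tensorModule ρ φ).cartan ↔
      ∃ (V₁ V₂ : Type v)
        (_ : AddCommGroup V₁) (_ : Module ℂ V₁) (_ : LieRingModule (Matrix (Fin m) (Fin m) ℂ) V₁)
        (_ : LieModule ℂ (Matrix (Fin m) (Fin m) ℂ) V₁)
        (_ : AddCommGroup V₂) (_ : Module ℂ V₂) (_ : LieRingModule (Matrix (Fin n) (Fin n) ℂ) V₂)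
        (_ : LieModule ℂ (Matrix (Fin n) (Fin n) ℂ) V₂),
        FiniteDimensional ℂ V₁ ∧ LieModule.IsIrreducible ℂ (Matrix (Fin m) (Fin m) ℂ) V₁ ∧
        LieModule.IsIrreducible ℂ (Matrix (Fin n) (Fin n) ℂ) V₂ ∧ IsBounded (glCartan n V₂) ∧
        (φ.Isomorphic (LModule (outerTensor m n V₁ V₂)) ∨
          φ.Isomorphic (LModule (outerTensor m n V₁ V₂)).parityChange) := by
  have := hP_simple.1
  constructor
  · rintro ⟨-, N, hN⟩
    exact exists_isomorphic_LModule hM_simple hM_weight (rank_weightSpace_le hP_weight hN)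
      fun i i' hi => act_unitMat_pow_eq_zero hP_weight hM_weight hN hi
  · rintro ⟨V₁, V₂, i1, i2, i3, i4, i5, i6, i7, i8, hfd, hirr₁, hirr₂, hbd, hiso⟩
    -- the grading plays no role here, so both cases give a linear equivalence with `L(V₁ ⊗ V₂)`
    obtain ⟨e, he⟩ : ∃ e : M ≃ₗ[ℂ] LTop (outerTensor m n V₁ V₂),
        ∀ x v, e (φ.act x v) = (LModule (outerTensor m n V₁ V₂)).act x (e v) := by
      rcases hiso with ⟨e, -, he⟩ | ⟨e, -, he⟩
      · exact ⟨e, he⟩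
      · exact ⟨e, he⟩
    refine isBounded_tensorModule hP_simple hP_weight hbd (isShiftSpanned_top V₁ V₂
      (e.symm.toLinearMap ∘ₗ (Kac.module (outerTensor m n V₁ V₂)).topMk) ?_ fun x w => ?_)
    · exact e.symm.surjective.comp (LieSuperModule.topMk_surjective _)
    · change e.symm _ = φ.act x (e.symm _)
      rw [e.symm_apply_eq, he, e.apply_symm_apply]
      rfl
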